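/- Let $M$ be a connected smooth manifold of dimension 6 with a Riemannian metric $g$. For a smooth orthogonal almost complex structure $J$ on $(M,g)$ let $\Omega(X,Y)=g(JX,Y)$, and call an orthonormal basis $e=(e_1,\dots,e_6)$ of a tangent space adapted to $(g,J)$ if $\Omega=e_{12}+e_{34}+e_{56}$. A characteristic connection of $(g,J)$ is a connection $\nabla^c$ with $\nabla^cg=0$, $\nabla^cJ=0$ whose torsion $T^c(X,Y,Z)=g(T^c(X,Y),Z)$ is totally skew-symmetric (it is unique if it exists). Let $SU(2)=\{\mathrm{diag}(A,1):A\in SU(2)\}\subset U(3)$, acting on a tangent space through an adapted frame. The structure $(M,g,J)$ has parallel torsion related to $SU(2)$ if it has a characteristic connection with $\nabla^cT^c=0$ and, at each point, with respect to some adapted frame, $\mathrm{Hol}(\nabla^c)\subset SU(2)\subset \mathrm{Iso}(T^c)$, where $\mathrm{Iso}(T^c)=\{a\in U(3): aT^c=T^c\}$. **Theorem.** Let $(M,g,J)$ have parallel torsion related to $SU(2)$, with characteristic connection $\nabla^c$ and torsion form $T^c\neq 0$ (i.e. the structure is not Kähler). Then there is a smooth family $(\tilde J_q)_{q\in S^2}$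 of smooth orthogonal almost complex structures on $(M,g)$, which contains $J$ and in which distinct parameters give structures that differ at every point of $M$, such that: 1. for every $q\in S^2$, $(M,g,\tilde J_q)$ has parallel torsion related to $SU(2)$, and its characteristic connection is again $\nabla^c$; 2. every orbit type of the torsion form is realized: there is $r>0$ such that for every $q$ there are $\alpha_1,\alpha_5\ge 0$ with $\alpha_1^2+\alpha_5^2=r^2$ for which at each point of $M$ there is a $(g,\tilde J_q)$-adapted frame with $$T^c=\alpha_1\,(e_{14}+e_{23})\wedge e_5+\alpha_5\,(e_{12}+e_{34})\wedge e_5 ,$$ and conversely, for all $\alpha_1,\alpha_5\ge 0$ with $\alpha_1^2+\alpha_5^2=r^2$ there is some $q\in S^2$ such that at each point of $M$ there is a $(g,\tilde J_q)$-adapted frame in which $T^c$ has this form; 3. in particular, for some $q$ the structure $(g,\tilde J_q)$ is of strict type $W_4$ (a generalized Hopf structure): at each point its intrinsic torsion is non-zero and lies in $W_4=\{\theta(\Omega_q\wedge\xi)\}$, where $\Omega_q$ is the Kähler form of $(g,\tilde J_q)$ and $\xi$ ranges over the tangent vectors at that point. Here the intrinsic torsion is the projection to $T^*M\otimes\mathfrak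 m$ of the Levi-Civita connection form in adapted frames, $\mathfrak m$ is the space of 2-forms $\omega$ with $\omega(\tilde J_qX,\tilde J_qY)=-\omega(X,Y)$, and $\theta(T)(X)=-\tfrac12\,\mathrm{pr}_{\mathfrak m}(T(X,\cdot,\cdot))$. -/

import Mathlib

open Bundle Manifold ContDiff Topology

noncomputable section

/-- The model space of a six-dimensional manifold. -/
abbrev E6 : Type := EuclideanSpace ℝ (Fin 6)

section AlmostHermitian

variable {M : Type*} [TopologicalSpace M] [ChartedSpace E6 M] [IsManifold (𝓡 6) ∞ M]
  [RiemannianBundle (fun x : M => TangentSpace (𝓡 6) x)]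

variable (M) in
/-- A smooth almost complex structure on the Riemannian manifold `M` which is orthogonal for the
metric, i.e. (together with the metric) an almost hermitian structure. -/
@[ext]
structure OrthogonalACS where
  toFun : (x : M) → TangentSpace (𝓡 6) x →L[ℝ] TangentSpace (𝓡 6) x
  smooth : ContMDiff (𝓡 6) ((𝓡 6).prod 𝓘(ℝ, E6 →L[ℝ] E6)) ∞
    (fun x => TotalSpace.mk' (E6 →L[ℝ] E6)
      (E := fun x : M => TangentSpace (𝓡 6) x →L[ℝ] TangentSpace (𝓡 6) x) x (toFun x))
  sq (x : M) (v : TangentSpace (𝓡 6) x) : toFun x (toFun x v) = -v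
  orthogonal (x : M) (v w : TangentSpace (𝓡 6) x) :
    inner ℝ (toFun x v) (toFun x w) = inner ℝ v w

instance : CoeFun (OrthogonalACS M)
    (fun _ => (x : M) → TangentSpace (𝓡 6) x →L[ℝ] TangentSpace (𝓡 6) x) :=
  ⟨OrthogonalACS.toFun⟩

variable (M) in
/-- Affine connections on `M`; `cov Y x v` is the covariant derivative of `Y` at `x` in the
direction `v`. -/
abbrev AffineConnection : Type _ :=
  CovariantDerivative (𝓡 6) E6 (fun x : M => TangentSpace (𝓡 6) x)

/-- The vector field `X` is differentiable at the point `x`. -/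
def IsDiffAt (X : (y : M) → TangentSpace (𝓡 6) y) (x : M) : Prop :=
  MDifferentiableAt (𝓡 6) (𝓡 6).tangent (fun y => (⟨y, X y⟩ : TangentBundle (𝓡 6) M)) x

/-! ### Linear algebra in a tangent space -/

/-- The Kähler form `Ω(X,Y) = g(JX,Y)`. -/
def kahlerForm (J : OrthogonalACS M) (x : M) (X Y : TangentSpace (𝓡 6) x) : ℝ :=
  inner ℝ (J x X) Y

/-- An orthonormal basis `e₁,…,e₆` (here indexed by `0,…,5`) of a tangent space is adapted to
`(g,J)` if `J e₁ = e₂`, `J e₃ = e₄`, `J e₅ = e₆`, i.e. if `Ω = e₁₂ + e₃₄ + e₅₆`. -/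
def IsAdapted (J : OrthogonalACS M) {x : M}
    (e : OrthonormalBasis (Fin 6) ℝ (TangentSpace (𝓡 6) x)) : Prop :=
  J x (e 0) = e 1 ∧ J x (e 2) = e 3 ∧ J x (e 4) = e 5

/-- The identification of `ℂ³` with a tangent space given by an adapted frame:
`(z₁,z₂,z₃) ↦ ∑ₖ Re(zₖ) e₂ₖ₋₁ + Im(zₖ) e₂ₖ`. -/
def ofComplex {x : M} (e : OrthonormalBasis (Fin 6) ℝ (TangentSpace (𝓡 6) x))
    (z : Fin 3 → ℂ) : TangentSpace (𝓡 6) x :=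
  (z 0).re • e 0 + (z 0).im • e 1 + (z 1).re • e 2 + (z 1).im • e 3
    + (z 2).re • e 4 + (z 2).im • e 5

/-- The embedding of `2 × 2` matrices into `3 × 3` matrices `A ↦ diag(A, 1)`. -/
def blockMatrix (A : Matrix (Fin 2) (Fin 2) ℂ) : Matrix (Fin 3) (Fin 3) ℂ :=
  !![A 0 0, A 0 1, 0; A 1 0, A 1 1, 0; 0, 0, 1]

/-- The group `SU(2) = {diag(A,1) : A ∈ SU(2)} ⊂ U(3)`, acting on the tangent space at `x` through
the frame `e`. -/
def SU2At {x : M} (e : OrthonormalBasis (Fin 6) ℝ (TangentSpace (𝓡 6) x)) :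
    Set (TangentSpace (𝓡 6) x →ₗ[ℝ] TangentSpace (𝓡 6) x) :=
  {a | ∃ A ∈ Matrix.specialUnitaryGroup (Fin 2) ℂ,
    ∀ z : Fin 3 → ℂ, a (ofComplex e z) = ofComplex e ((blockMatrix A).mulVec z)}

/-- The 3-form `e_i ∧ e_j ∧ e_k` evaluated on three vectors given by their coordinates. -/
def wedge3 (i j k : Fin 6) (X Y Z : E6) : ℝ :=
  Matrix.det !![X i, X j, X k; Y i, Y j, Y k; Z i, Z j, Z k]

/-- The 3-form `α₁ (e₁₄ + e₂₃) ∧ e₅ + α₅ (e₁₂ + e₃₄) ∧ e₅` on `ℝ⁶`. -/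
def normalForm (α₁ α₅ : ℝ) (X Y Z : E6) : ℝ :=
  α₁ * (wedge3 0 3 4 X Y Z + wedge3 1 2 4 X Y Z)
    + α₅ * (wedge3 0 1 4 X Y Z + wedge3 2 3 4 X Y Z)

/-! ### Torsion, characteristic connection, holonomy -/

/-- The torsion of a connection as a (3,0)-tensor, `T(X,Y,Z) = g(T(X,Y),Z)`. -/
def torsionForm (cov : AffineConnection M) (x : M) (X Y Z : TangentSpace (𝓡 6) x) : ℝ :=
  inner ℝ (cov.torsion x X Y) Z

set_option synthInstance.maxHeartbeats 400000
variable [IsContMDiffRiemannianBundle (𝓡 6) ∞ E6 (fun x : M => TangentSpace (𝓡 6) x)]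

/-- `cov` is the characteristic connection of `(g,J)`: a (smooth) hermitian connection, `∇g = 0`
and `∇J = 0`, with totally skew-symmetric torsion. -/
structure IsCharacteristicConnection (J : OrthogonalACS M) (cov : AffineConnection M) :
    Prop where
  smooth : cov.ContMDiffCovariantDerivative ∞
  metric : cov.IsMetricCompatible
  complex : ∀ (x : M) (Y : (y : M) → TangentSpace (𝓡 6) y), IsDiffAt Y x →
    ∀ v : TangentSpace (𝓡 6) x, cov (fun y => J y (Y y)) x v = J x (cov Y x v)
  skew : ∀ (x : M) (X Y Z : TangentSpace (𝓡 6) x),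
    torsionForm cov x X Y Z = -torsionForm cov x X Z Y

/-- The torsion form is parallel, `∇T = 0`. -/
def HasParallelTorsion (cov : AffineConnection M) : Prop :=
  ∀ (x : M) (X Y Z : (y : M) → TangentSpace (𝓡 6) y),
    IsDiffAt X x → IsDiffAt Y x → IsDiffAt Z x →
    ∀ v : TangentSpace (𝓡 6) x,
      mvfderiv (𝓡 6) (fun y => torsionForm cov y (X y) (Y y) (Z y)) x v =
        torsionForm cov x (cov X x v) (Y x) (Z x) + torsionForm cov x (X x) (cov Y x v) (Z x)
          + torsionForm cov x (X x) (Y x) (cov Z x v)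

/-- `W` is the covariant derivative `DV/dt` at time `t` of the vector field `V` along the curve
`γ`: writing `V = ∑ fᵢ · (Xᵢ ∘ γ)` near `t` with vector fields `Xᵢ` on `M`, one has
`DV/dt = ∑ fᵢ' Xᵢ + fᵢ ∇_{γ'} Xᵢ`. -/
def HasCovDerivAlong (cov : AffineConnection M) (γ : ℝ → M)
    (V : (t : ℝ) → TangentSpace (𝓡 6) (γ t)) (t : ℝ) (W : TangentSpace (𝓡 6) (γ t)) : Prop :=
  ∃ (n : ℕ) (f : Fin n → ℝ → ℝ) (X : Fin n → (x : M) → TangentSpace (𝓡 6) x),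
    (∀ i, DifferentiableAt ℝ (f i) t) ∧ (∀ i, IsDiffAt (X i) (γ t)) ∧
    (∀ᶠ s in 𝓝 t, V s = ∑ i, f i s • X i (γ s)) ∧
    W = ∑ i, (deriv (f i) t • X i (γ t)
      + f i t • cov (X i) (γ t) (mfderiv 𝓘(ℝ, ℝ) (𝓡 6) γ t (1 : ℝ)))

/-- Parallel transport along piecewise smooth curves from `x` to `y`: along a segment of a smooth
curve, `P` sends the initial value of every parallel field to its final value, and piecewise
smooth curves are concatenations of such segments. -/
inductive IsParallelTransport (cov : AffineConnection M) :
    (x y : M) → (TangentSpace (𝓡 6) x →ₗ[ℝ] TangentSpace (𝓡 6) y) → Prop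
  | segment (γ : ℝ → M) (hγ : ContMDiff 𝓘(ℝ, ℝ) (𝓡 6) ∞ γ) (a b : ℝ)
      (P : TangentSpace (𝓡 6) (γ a) →ₗ[ℝ] TangentSpace (𝓡 6) (γ b))
      (hP : ∀ v : TangentSpace (𝓡 6) (γ a), ∃ V : (t : ℝ) → TangentSpace (𝓡 6) (γ t),
        (∀ t, HasCovDerivAlong cov γ V t 0) ∧ V a = v ∧ V b = P v) :
      IsParallelTransport cov (γ a) (γ b) P
  | trans {x y z : M} {P : TangentSpace (𝓡 6) x →ₗ[ℝ] TangentSpace (𝓡 6) y}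
      {Q : TangentSpace (𝓡 6) y →ₗ[ℝ] TangentSpace (𝓡 6) z}
      (hP : IsParallelTransport cov x y P) (hQ : IsParallelTransport cov y z Q) :
      IsParallelTransport cov x z (Q.comp P)

/-- The holonomy group at `x`: parallel transports along piecewise smooth loops at `x`. -/
def holonomyGroup (cov : AffineConnection M) (x : M) :
    Set (TangentSpace (𝓡 6) x →ₗ[ℝ] TangentSpace (𝓡 6) x) :=
  {P | IsParallelTransport cov x x P}

/-- The isotropy group of the torsion form at `x`: all unitary transformations of the tangent
space which preserve the torsion form. -/
def isotropyGroup (J : OrthogonalACS M) (cov : AffineConnection M) (x : M) :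
    Set (TangentSpace (𝓡 6) x →ₗ[ℝ] TangentSpace (𝓡 6) x) :=
  {a | (∀ X Y, (inner ℝ (a X) (a Y) : ℝ) = inner ℝ X Y) ∧ (∀ X, a (J x X) = J x (a X)) ∧
    ∀ X Y Z, torsionForm cov x (a X) (a Y) (a Z) = torsionForm cov x X Y Z}

/-- `(g,J)` is an almost hermitian structure with parallel torsion related to `SU(2)`, with
characteristic connection `cov = ∇ᶜ`: `∇ᶜTᶜ = 0` and `Hol(∇ᶜ) ⊂ SU(2) ⊂ Iso(Tᶜ)`. -/
structure IsRelatedToSU2 (J : OrthogonalACS M) (cov : AffineConnection M) : Prop where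
  characteristic : IsCharacteristicConnection J cov
  parallel : HasParallelTorsion cov
  su2 : ∀ x : M, ∃ e : OrthonormalBasis (Fin 6) ℝ (TangentSpace (𝓡 6) x), IsAdapted J e ∧
    holonomyGroup cov x ⊆ SU2At e ∧ SU2At e ⊆ isotropyGroup J cov x

/-- At every point, the `U(3)`-orbit of the torsion form with respect to `(g,J)` is the orbit of
`α₁ (e₁₄ + e₂₃) ∧ e₅ + α₅ (e₁₂ + e₃₄) ∧ e₅`. -/
def HasTorsionOrbit (J : OrthogonalACS M) (cov : AffineConnection M) (α₁ α₅ : ℝ) : Prop :=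
  ∀ x : M, ∃ e : OrthonormalBasis (Fin 6) ℝ (TangentSpace (𝓡 6) x), IsAdapted J e ∧
    ∀ X Y Z : TangentSpace (𝓡 6) x,
      torsionForm cov x X Y Z = normalForm α₁ α₅ (e.repr X) (e.repr Y) (e.repr Z)

/-! ### Intrinsic torsion and the class `W₄` -/

/-- `D` is the Levi-Civita connection. -/
def IsLeviCivita (D : AffineConnection M) : Prop :=
  D.IsMetricCompatible ∧ ∀ x : M, D.torsion x = 0

/-- The tensor `(∇_X J) Y = ∇_X (J Y) - J (∇_X Y)` at the point `x`. -/
def derivJ (J : OrthogonalACS M) (D : AffineConnection M) (x : M)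
    (X Y : TangentSpace (𝓡 6) x) : TangentSpace (𝓡 6) x :=
  D (fun y => J y (FiberBundle.extend E6 Y y)) x X - J x (D (FiberBundle.extend E6 Y) x X)

/-- The intrinsic torsion `Γ(X)(Y,Z)` of `(g,J)`, where `D` is the Levi-Civita connection: the
projection of the connection form to the 2-forms anti-commuting with `J`. In an adapted frame, the
connection form `ω(X)(Y,Z)` satisfies `g((∇_X J)Y,Z) = ω(X)(JY,Z) + ω(X)(Y,JZ)`, so that its
projection `(ω(X)(Y,Z) - ω(X)(JY,JZ))/2` equals `-g((∇_X J)Y,JZ)/2`. -/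
def intrinsicTorsion (J : OrthogonalACS M) (D : AffineConnection M) (x : M)
    (X Y Z : TangentSpace (𝓡 6) x) : ℝ :=
  -(1 / 2) * inner ℝ (derivJ J D x X Y) (J x Z)

/-- The 3-form `Ω ∧ ξ`. -/
def kahlerWedge (J : OrthogonalACS M) (x : M) (ξ X Y Z : TangentSpace (𝓡 6) x) : ℝ :=
  kahlerForm J x X Y * inner ℝ ξ Z + kahlerForm J x Y Z * inner ℝ ξ X
    + kahlerForm J x Z X * inner ℝ ξ Y

/-- The map `θ(T) = -½ ∑ eᵢ ⊗ pr_𝔪(eᵢ ⌟ T)` from 3-forms to the space of intrinsic torsions, where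
`pr_𝔪(ω)(Y,Z) = (ω(Y,Z) - ω(JY,JZ))/2` projects 2-forms to those anti-commuting with `J`. -/
def thetaMap (J : OrthogonalACS M) (x : M)
    (T : TangentSpace (𝓡 6) x → TangentSpace (𝓡 6) x → TangentSpace (𝓡 6) x → ℝ)
    (X Y Z : TangentSpace (𝓡 6) x) : ℝ :=
  -(1 / 2) * ((T X Y Z - T X (J x Y) (J x Z)) / 2)

/-- `(g,J)` is of strict type `W₄`: at every point the intrinsic torsion lies in
`W₄ = {θ(Ω ∧ ξ)}` and is not zero. -/
def IsStrictTypeW4 (J : OrthogonalACS M) : Prop :=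
  ∃ D : AffineConnection M, IsLeviCivita D ∧ ∀ x : M,
    (∃ ξ, intrinsicTorsion J D x = thetaMap J x (kahlerWedge J x ξ)) ∧
      intrinsicTorsion J D x ≠ 0

/-! ### Families of almost complex structures -/

/-- The sphere `S² ⊂ ℝ³`. -/
abbrev S2 : Type := Metric.sphere (0 : EuclideanSpace ℝ (Fin 3)) 1

/-- A smooth `S²`-family of orthogonal almost complex structures: smooth jointly in the parameter
and in the point of `M`, and such that distinct parameters give almost complex structures that
differ at every point of `M`. -/
structure IsSphereFamily (Jt : S2 → OrthogonalACS M) : Prop where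
  smooth : ContMDiff ((𝓡 2).prod (𝓡 6)) ((𝓡 6).prod 𝓘(ℝ, E6 →L[ℝ] E6)) ∞
    (fun p : S2 × M => TotalSpace.mk' (E6 →L[ℝ] E6)
      (E := fun x : M => TangentSpace (𝓡 6) x →L[ℝ] TangentSpace (𝓡 6) x) p.2 (Jt p.1 p.2))
  injective : ∀ x : M, Function.Injective (fun q : S2 => Jt q x)

end AlmostHermitian

end

/-!
Identify a tangent space with `ℍ ⊕ ℂ` by an adapted frame, so that `SU(2)` acts on `ℍ` by right
multiplication with unit quaternions. Since the holonomy lies in `SU(2)`, the left multiplications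
`(x, w) ↦ (p x, z w)` commute with it and extend to parallel, hence smooth, endomorphisms of `TM`,
and the vectors of `ℂ` extend to parallel vector fields.

The torsion form is parallel, so its value at one point determines it. An `SU(2)`-invariant 3-form
on `ℍ ⊕ ℂ` is `⟨a ·, ·⟩ ∧ 1 + ⟨b ·, ·⟩ ∧ i` for imaginary quaternions `a` and `b`. By the
Jacobi identity, the commutator of the torsion endomorphisms of the parallel vector fields `1` and
`i` is a curvature operator, so it commutes with the left multiplications. On `ℍ` it is left
multiplication by the commutator of `a` and `b`, which is thus both central and imaginary, hence
zero. So `a` and `b` are proportional, and after a rotation of the frame `T = ⟨i ·, ·⟩ ∧ r` with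
`r > 0`.

The structures are `J_q = (q, i)` for imaginary unit quaternions `q`: they are orthogonal and
parallel, and have the same torsion. Rotating `q` to `i` expresses `T` in a frame adapted to `J_q`,
and the angle `β` between `q` and `i` yields `α₁ = r |sin β|` and `α₅ = r |cos β|`. For `q = i` the
form `T` is the wedge product of the Kähler form with a parallel vector field, which is type `W₄`.
-/

noncomputable section

section Calculus

theorem exists_hasDerivAt_mul_of_norm_le {R : Type*} [NormedRing R] [NormedAlgebra ℝ R]
    [CompleteSpace R] {A : ℝ → R} (hA : ContinuousOn A (Set.Icc (-2) 2)) {C : ℝ}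
    (hC : C * (‖(1 : R)‖ + 1) ≤ 1 / 2) (hAC : ∀ t ∈ Set.Icc (-2 : ℝ) 2, ‖A t‖ ≤ C) :
    ∃ Φ : ℝ → R, Φ 0 = 1 ∧ ∀ t ∈ Set.Ioo (-2 : ℝ) 2, HasDerivAt Φ (A t * Φ t) t := by
  have hC₀ : 0 ≤ C := (norm_nonneg _).trans (hAC 0 (by norm_num))
  have hpl : IsPicardLindelof (fun t Φ => A t * Φ) (tmin := -2) (tmax := 2) ⟨0, by norm_num⟩
      (1 : R) 1 0 ⟨C * (‖(1 : R)‖ + 1), by positivity⟩ ⟨C, hC₀⟩ := by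
    refine ⟨fun t ht => LipschitzOnWith.of_dist_le_mul fun x _ y _ => ?_,
      fun x _ => hA.mul continuousOn_const, fun t ht x hx => ?_, ?_⟩
    · rw [dist_eq_norm, dist_eq_norm, ← mul_sub]
      exact (norm_mul_le _ _).trans (mul_le_mul_of_nonneg_right (hAC t ht) (norm_nonneg _))
    · have hx' : ‖x‖ ≤ ‖(1 : R)‖ + 1 := norm_le_of_mem_closedBall hx
      exact (norm_mul_le _ _).trans (mul_le_mul (hAC t ht) hx' (norm_nonneg _) hC₀)
    · change C * (‖(1 : R)‖ + 1) * max (2 - 0) (0 - -2) ≤ 1 - 0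
      norm_num
      linarith
  obtain ⟨Φ, h₀, hΦ⟩ := hpl.exists_eq_forall_mem_Icc_hasDerivWithinAt₀
  exact ⟨Φ, h₀, fun t ht =>
    (hΦ t (Set.Ioo_subset_Icc_self ht)).hasDerivAt (Icc_mem_nhds ht.1 ht.2)⟩

theorem norm_sub_one_le_of_hasDerivAt_mul {R : Type*} [NormedRing R] [NormedAlgebra ℝ R]
    {A Φ : ℝ → R} (h₀ : Φ 0 = 1) (hΦ : ∀ t ∈ Set.Icc (0 : ℝ) 1, HasDerivAt Φ (A t * Φ t) t) {C : ℝ}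
    (hC : C ≤ 1) (hAC : ∀ t ∈ Set.Icc (0 : ℝ) 1, ‖A t‖ ≤ C) :
    ‖Φ 1 - 1‖ ≤ 2 * (C * ‖(1 : R)‖) := by
  have hderiv : ∀ t ∈ Set.Icc (0 : ℝ) 1, HasDerivAt (fun t => Φ t - 1) (A t * Φ t) t :=
    fun t ht => (hΦ t ht).sub_const 1
  have hbound : ∀ t ∈ Set.Ico (0 : ℝ) 1,
      ‖A t * Φ t‖ ≤ 1 * ‖Φ t - 1‖ + C * ‖(1 : R)‖ := by
    intro t ht
    have hAt := hAC t (Set.Ico_subset_Icc_self ht)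
    calc ‖A t * Φ t‖ = ‖A t * (Φ t - 1) + A t * 1‖ := by rw [← mul_add, sub_add_cancel]
      _ ≤ ‖A t‖ * ‖Φ t - 1‖ + ‖A t‖ * ‖(1 : R)‖ :=
        (norm_add_le _ _).trans (add_le_add (norm_mul_le _ _) (norm_mul_le _ _))
      _ ≤ 1 * ‖Φ t - 1‖ + C * ‖(1 : R)‖ := by gcongr; exact hAt.trans hC
  have hgronwall := norm_le_gronwallBound_of_norm_deriv_right_le (δ := 0)
    (fun t ht => (hderiv t ht).continuousAt.continuousWithinAt)
    (fun t ht => (hderiv t (Set.Ico_subset_Icc_self ht)).hasDerivWithinAt)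
    (by simp [h₀]) hbound 1 (by norm_num)
  rw [gronwallBound_of_K_ne_0 one_ne_zero] at hgronwall
  have hC₀ : 0 ≤ C := (norm_nonneg _).trans (hAC 0 (by norm_num))
  have he : Real.exp 1 - 1 ≤ 2 := by linarith [Real.exp_one_lt_d9]
  calc ‖Φ 1 - 1‖ ≤ C * ‖(1 : R)‖ * (Real.exp 1 - 1) := by simpa using hgronwall
    _ ≤ C * ‖(1 : R)‖ * 2 := by gcongr
    _ = 2 * (C * ‖(1 : R)‖) := mul_comm _ _

/-- `Φ v` solves the linear equation `Φ' = -G Φ`, `Φ 0 = 1`, along the straight line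
`t ↦ z₀ + t v`, whenever `v` is small; the lines stay in the set `N` for `|t| < 2`. -/
structure IsLinearFlow {E R : Type*} [NormedAddCommGroup E] [NormedSpace ℝ E] [NormedRing R]
    [NormedAlgebra ℝ R] (G : E → E →L[ℝ] R) (N : Set E) (z₀ : E) (Φ : E → ℝ → R) : Prop where
  tendsto_one : Filter.Tendsto (fun v => Φ v 1) (𝓝 0) (𝓝 1)
  map_zero : ∀ᶠ v in 𝓝 0, Φ v 0 = 1
  line_mem : ∀ᶠ v in 𝓝 0, ∀ t ∈ Set.Ioo (-2 : ℝ) 2, z₀ + t • v ∈ N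
  hasDerivAt : ∀ᶠ v in 𝓝 0, ∀ t ∈ Set.Ioo (-2 : ℝ) 2,
    HasDerivAt (Φ v) (-(G (z₀ + t • v) v) * Φ v t) t

theorem eventually_forall_line {E : Type*} [NormedAddCommGroup E] [NormedSpace ℝ E]
    {p : E → Prop} {z₀ : E} (hp : ∀ᶠ z in 𝓝 z₀, p z) (r : ℝ) :
    ∀ᶠ v in 𝓝 (0 : E), ∀ t ∈ Set.Icc (-r) r, p (z₀ + t • v) := by
  have hline : Filter.Tendsto (fun q : E × ℝ => z₀ + q.2 • q.1) (𝓝ˢ ({0} ×ˢ Set.Icc (-r) r))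
      (𝓝 z₀) := by
    refine Filter.Tendsto.mono_right ((by fun_prop : Continuous fun q : E × ℝ =>
      z₀ + q.2 • q.1).tendsto_nhdsSet (t := {z₀}) ?_) nhdsSet_singleton.le
    rintro ⟨v, t⟩ ⟨rfl, -⟩
    simp
  have hprod := hline.eventually hp
  rw [(isCompact_singleton).nhdsSet_prod_eq isCompact_Icc, nhdsSet_singleton] at hprod
  exact (hprod.curry).mono fun v hv t ht => (hv.self_of_nhdsSet) t ht

theorem exists_isLinearFlow {E R : Type*} [NormedAddCommGroup E] [NormedSpace ℝ E] [NormedRing R]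
    [NormedAlgebra ℝ R] [CompleteSpace R] {G : E → E →L[ℝ] R} {N : Set E} (hN : IsOpen N)
    (hG : ContinuousOn G N) {z₀ : E} (hz₀ : z₀ ∈ N) : ∃ Φ, IsLinearFlow G N z₀ Φ := by
  set K := ‖G z₀‖ + 1
  have hnear : ∀ᶠ z in 𝓝 z₀, z ∈ N ∧ ‖G z‖ < K :=
    (hN.eventually_mem hz₀).and ((hG.continuousAt (hN.mem_nhds hz₀)).norm.eventually_lt_const
      (lt_add_one _))
  have hline := eventually_forall_line hnear 2
  have hsmall : ∀ᶠ v in 𝓝 (0 : E), K * ‖v‖ * (‖(1 : R)‖ + 1) < 1 / 2 ∧ K * ‖v‖ < 1 := by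
    have hcont : Continuous fun v : E => K * ‖v‖ := by fun_prop
    exact ((hcont.mul_const (‖(1 : R)‖ + 1)).tendsto' 0 0 (by simp)).eventually_lt_const
      (by norm_num) |>.and ((hcont.tendsto' 0 0 (by simp)).eventually_lt_const one_pos)
  have hnorm : ∀ v : E, (∀ t ∈ Set.Icc (-2 : ℝ) 2, z₀ + t • v ∈ N ∧ ‖G (z₀ + t • v)‖ < K) →
      ∀ t ∈ Set.Icc (-2 : ℝ) 2, ‖-(G (z₀ + t • v) v)‖ ≤ K * ‖v‖ := fun v hv t ht => by
    rw [norm_neg]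
    exact (G _).le_of_opNorm_le (hv t ht).2.le v
  have hsol : ∀ᶠ v in 𝓝 (0 : E), ∃ Φ : ℝ → R, Φ 0 = 1 ∧
      (∀ t ∈ Set.Ioo (-2 : ℝ) 2, HasDerivAt Φ (-(G (z₀ + t • v) v) * Φ t) t) ∧
      ‖Φ 1 - 1‖ ≤ 2 * (K * ‖v‖ * ‖(1 : R)‖) := by
    filter_upwards [hline, hsmall] with v hv hvK
    have hcont : ContinuousOn (fun t : ℝ => -(G (z₀ + t • v) v)) (Set.Icc (-2) 2) :=
      ((hG.comp (by fun_prop) fun t ht => (hv t ht).1).clm_apply continuousOn_const).neg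
    obtain ⟨Φ, h₀, hΦ⟩ := exists_hasDerivAt_mul_of_norm_le hcont hvK.1.le (hnorm v hv)
    exact ⟨Φ, h₀, hΦ, norm_sub_one_le_of_hasDerivAt_mul h₀
      (fun t ht => hΦ t ⟨by linarith [ht.1], by linarith [ht.2]⟩) hvK.2.le
      fun t ht => hnorm v hv t ⟨by linarith [ht.1], by linarith [ht.2]⟩⟩
  choose! Φ hΦ using fun (v : E) (hv : ∃ Φ : ℝ → R, Φ 0 = 1 ∧
      (∀ t ∈ Set.Ioo (-2 : ℝ) 2, HasDerivAt Φ (-(G (z₀ + t • v) v) * Φ t) t) ∧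
      ‖Φ 1 - 1‖ ≤ 2 * (K * ‖v‖ * ‖(1 : R)‖)) => hv
  refine ⟨Φ, ?_, hsol.mono fun v hv => (hΦ v hv).1,
    hline.mono fun v hv t ht => (hv t (Set.Ioo_subset_Icc_self ht)).1,
    hsol.mono fun v hv => (hΦ v hv).2.1⟩
  rw [tendsto_iff_norm_sub_tendsto_zero]
  exact squeeze_zero' (.of_forall fun _ => norm_nonneg _) (hsol.mono fun v hv => (hΦ v hv).2.2)
    ((by fun_prop : Continuous fun v : E => 2 * (K * ‖v‖ * ‖(1 : R)‖)).tendsto' 0 0 (by simp))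

theorem hasFDerivAt_of_hasLineDerivAt {E F : Type*} [NormedAddCommGroup E] [NormedSpace ℝ E]
    [NormedAddCommGroup F] [NormedSpace ℝ F] {U : Set E} (hU : IsOpen U) {ψ : E → F}
    {D : E → E →L[ℝ] F} (hD : ContinuousOn D U)
    (h : ∀ z ∈ U, ∀ v, HasLineDerivAt ℝ ψ (D z v) z v) {z : E} (hz : z ∈ U) :
    HasFDerivAt ψ (D z) z := by
  rw [hasFDerivAt_iff_isLittleO_nhds_zero, Asymptotics.isLittleO_iff]
  intro ε hε
  have hnear : ∀ᶠ y in 𝓝 z, y ∈ U ∧ ‖D y - D z‖ < ε := (hU.eventually_mem hz).and <| by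
    simpa [dist_eq_norm] using
      Metric.continuousAt_iff'.1 (hD.continuousAt (hU.mem_nhds hz)) ε hε
  filter_upwards [eventually_forall_line hnear 1] with v hv
  have hseg : ∀ s ∈ Set.Icc (0 : ℝ) 1, z + s • v ∈ U ∧ ‖D (z + s • v) - D z‖ < ε :=
    fun s hs => hv s ⟨by linarith [hs.1], hs.2⟩
  have hderiv : ∀ s ∈ Set.Icc (0 : ℝ) 1,
      HasDerivAt (fun s : ℝ => ψ (z + s • v) - s • D z v) (D (z + s • v) v - D z v) s := by
    intro s hs
    have hline : HasDerivAt (fun t : ℝ => ψ (z + s • v + t • v)) (D (z + s • v) v) (s - s) := by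
      simpa [HasLineDerivAt] using h _ (hseg s hs).1 v
    have hshift : HasDerivAt (fun t : ℝ => ψ (z + t • v)) (D (z + s • v) v) s :=
      (hline.comp_sub_const s s).congr_of_eventuallyEq (.of_forall fun t => by
        simp only [add_assoc, ← add_smul, add_sub_cancel])
    simpa using hshift.fun_sub ((hasDerivAt_id s).smul_const (D z v))
  have hmean := norm_image_sub_le_of_norm_deriv_le_segment_01' (C := ε * ‖v‖)
    (fun s hs => (hderiv s hs).hasDerivWithinAt) (fun s hs => by
      rw [← sub_apply]
      exact (D _ - D z).le_of_opNorm_le (hseg s (Set.Ico_subset_Icc_self hs)).2.le v)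
  simpa [sub_sub, add_comm, sub_right_comm] using hmean

theorem hasLineDerivAt_of_eventually {E F : Type*} [NormedAddCommGroup E] [NormedSpace ℝ E]
    [NormedAddCommGroup F] [NormedSpace ℝ F] {ψ : E → F} {D : E →L[ℝ] F} {z : E}
    (h : ∀ᶠ v in 𝓝 0, HasLineDerivAt ℝ ψ (D v) z v) (v : E) : HasLineDerivAt ℝ ψ (D v) z v := by
  have hscale : ∀ᶠ c in 𝓝[≠] (0 : ℝ), HasLineDerivAt ℝ ψ (D (c • v)) z (c • v) :=
    ((by fun_prop : Continuous fun c : ℝ => c • v).tendsto' 0 0 (by simp)).eventually h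
      |>.filter_mono nhdsWithin_le_nhds
  obtain ⟨c, hc, hc₀⟩ := (hscale.and self_mem_nhdsWithin).exists
  simpa [inv_smul_smul₀ (show c ≠ 0 from hc₀)] using hc.smul c⁻¹

/-- The hypothesis `hD` holds when `D` is expressed through `ψ` itself, so regularity bootstraps
from continuity. -/
theorem contDiffOn_of_hasLineDerivAt {E F : Type*} [NormedAddCommGroup E] [NormedSpace ℝ E]
    [NormedAddCommGroup F] [NormedSpace ℝ F] {U : Set E} (hU : IsOpen U) {ψ : E → F}
    (hψ : ContinuousOn ψ U) {D : E → E →L[ℝ] F}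
    (hD : ∀ n : ℕ, ContDiffOn ℝ n ψ U → ContDiffOn ℝ n D U)
    (h : ∀ z ∈ U, ∀ v, HasLineDerivAt ℝ ψ (D z v) z v) :
    ContDiffOn ℝ ∞ ψ U ∧ ∀ z ∈ U, HasFDerivAt ψ (D z) z := by
  have hψ₀ : ContDiffOn ℝ ((0 : ℕ) : ℕ∞ω) ψ U := by simpa [contDiffOn_zero] using hψ
  have hderiv : ∀ z ∈ U, HasFDerivAt ψ (D z) z := fun z hz =>
    hasFDerivAt_of_hasLineDerivAt hU (hD 0 hψ₀).continuousOn h hz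
  refine ⟨contDiffOn_infty.2 fun n => ?_, hderiv⟩
  induction n with
  | zero => exact hψ₀
  | succ n ih =>
    push_cast
    rw [contDiffOn_succ_iff_fderiv_of_isOpen hU]
    exact ⟨fun z hz => (hderiv z hz).differentiableAt.differentiableWithinAt, by simp,
      (hD n ih).congr fun z hz => (hderiv z hz).fderiv⟩

theorem IsLinearFlow.contDiffOn_of_equivariant {E F R : Type*} [NormedAddCommGroup E]
    [NormedSpace ℝ E] [NormedAddCommGroup F] [NormedSpace ℝ F] [NormedRing R] [NormedAlgebra ℝ R]
    {ρ : R → F → F} {ρ' : F →L[ℝ] R →L[ℝ] F}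
    (hρ : ∀ w, HasFDerivAt (fun a => ρ a w) (ρ' w) 1) (hρ_one : ∀ w, ρ 1 w = w)
    {G : E → E →L[ℝ] R} {N : Set E} (hN : IsOpen N) (hG : ContDiffOn ℝ ∞ G N) {ψ : E → F}
    (h : ∀ z ∈ N, ∃ Φ, IsLinearFlow G N z Φ ∧
      ∀ᶠ v in 𝓝 0, ∀ s ∈ Set.Icc (-1 : ℝ) 1, ψ (z + s • v) = ρ (Φ v s) (ψ z)) :
    ContDiffOn ℝ ∞ ψ N ∧ ∀ z ∈ N, HasFDerivAt ψ (-(ρ' (ψ z)).comp (G z)) z := by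
  refine contDiffOn_of_hasLineDerivAt hN (fun z hz => ?_) (fun n hn => ?_) fun z hz => ?_
  · obtain ⟨Φ, hΦ, hψ⟩ := h z hz
    have hlim : Filter.Tendsto (fun v => ρ (Φ v 1) (ψ z)) (𝓝 0) (𝓝 (ψ z)) := by
      simpa [hρ_one, Function.comp_def] using
        (hρ (ψ z)).continuousAt.tendsto.comp hΦ.tendsto_one
    refine ContinuousAt.continuousWithinAt (continuousAt_of_tendsto_nhds (y := ψ z) ?_)
    rw [← map_add_left_nhds_zero, Filter.tendsto_map'_iff]
    exact hlim.congr' (hψ.mono fun v hv => by simpa using (hv 1 (by norm_num)).symm)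
  · exact ((ρ'.contDiff.comp_contDiffOn hn).clm_comp
      (hG.of_le (by exact_mod_cast le_top))).neg
  · obtain ⟨Φ, hΦ, hψ⟩ := h z hz
    refine hasLineDerivAt_of_eventually ?_
    filter_upwards [hψ, hΦ.map_zero, hΦ.hasDerivAt] with v hv hv₀ hderiv
    have hΦv : HasDerivAt (Φ v) (-(G z v)) 0 := by
      simpa [hv₀] using hderiv 0 (by norm_num)
    have hflow := (hv₀ ▸ hρ (ψ z)).comp_hasDerivAt 0 hΦv
    refine (hflow.congr_deriv (by simp)).congr_of_eventuallyEq ?_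
    filter_upwards [Icc_mem_nhds (show (-1 : ℝ) < 0 by norm_num) (show (0 : ℝ) < 1 by norm_num)]
      with s hs using hv s hs

theorem hasFDerivAt_mul_inverse_one {R : Type*} [NormedRing R] [NormedAlgebra ℝ R]
    [CompleteSpace R] (w : R) :
    HasFDerivAt (fun a : R => a * w * Ring.inverse a)
      ((ContinuousLinearMap.mul ℝ R).flip w - ContinuousLinearMap.mul ℝ R w) 1 := by
  have hinv := hasFDerivAt_ringInverse (𝕜 := ℝ) (1 : Rˣ)
  rw [Units.val_one] at hinv
  refine (((hasFDerivAt_id (1 : R)).mul_const' w).mul' hinv).congr_fderiv ?_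
  ext b
  change 1 * w * -(((1⁻¹ : Rˣ) : R) * b * ((1⁻¹ : Rˣ) : R)) + b * w * Ring.inverse 1 = b * w - w * b
  simp [neg_add_eq_sub]

theorem IsLinearFlow.contDiffOn_of_conj {E R : Type*} [NormedAddCommGroup E] [NormedSpace ℝ E]
    [NormedRing R] [NormedAlgebra ℝ R] [CompleteSpace R] {G : E → E →L[ℝ] R} {N : Set E}
    (hN : IsOpen N) (hG : ContDiffOn ℝ ∞ G N) {ψ : E → R}
    (h : ∀ z ∈ N, ∃ Φ, IsLinearFlow G N z Φ ∧ ∀ᶠ v in 𝓝 0, ∀ s ∈ Set.Icc (-1 : ℝ) 1,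
      ψ (z + s • v) = Φ v s * ψ z * Ring.inverse (Φ v s)) :
    ContDiffOn ℝ ∞ ψ N ∧ ∀ z ∈ N, ∃ ψ' : E →L[ℝ] R, HasFDerivAt ψ ψ' z ∧
      ∀ v, ψ' v = ψ z * G z v - G z v * ψ z := by
  obtain ⟨hψ, hψ'⟩ := IsLinearFlow.contDiffOn_of_equivariant
    (ρ := fun a w => a * w * Ring.inverse a)
    (ρ' := (ContinuousLinearMap.mul ℝ R).flip - ContinuousLinearMap.mul ℝ R)
    hasFDerivAt_mul_inverse_one (by simp) hN hG h
  exact ⟨hψ, fun z hz => ⟨_, hψ' z hz, fun v => by simp⟩⟩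

theorem hasDerivAt_linearMap_apply {E F : Type*} [NormedAddCommGroup E] [NormedSpace ℝ E]
    [FiniteDimensional ℝ E] [NormedAddCommGroup F] [NormedSpace ℝ F] {f : ℝ → E →ₗ[ℝ] F}
    {f' : E →ₗ[ℝ] F} {c : ℝ → E} {c' : E} {t : ℝ}
    (hf : ∀ w, HasDerivAt (fun s => f s w) (f' w) t) (hc : HasDerivAt c c' t) :
    HasDerivAt (fun s => f s (c s)) (f' (c t) + f t c') t := by
  let b := Module.finBasis ℝ E
  have hcoord : ∀ i, HasDerivAt (fun s => b.repr (c s) i) (b.repr c' i) t := fun i =>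
    (LinearMap.toContinuousLinearMap (b.coord i)).hasFDerivAt.comp_hasDerivAt t hc
  have hsum : HasDerivAt (fun s => ∑ i, b.repr (c s) i • f s (b i))
      (∑ i, (b.repr (c t) i • f' (b i) + b.repr c' i • f t (b i))) t :=
    HasDerivAt.fun_sum fun i _ => (hcoord i).smul (hf (b i))
  have hexpand : ∀ (g : E →ₗ[ℝ] F) (w : E), ∑ i, b.repr w i • g (b i) = g w := fun g w => by
    conv_rhs => rw [← b.sum_repr w]
    simp only [map_sum, map_smul]
  simpa only [Finset.sum_add_distrib, hexpand] using hsum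

end Calculus

section Charts

variable {E : Type*} [NormedAddCommGroup E] [NormedSpace ℝ E] {M : Type*} [TopologicalSpace M]
  [ChartedSpace E M]

theorem symm_mem_chart_source {p : M} {z : E} (hz : z ∈ (extChartAt 𝓘(ℝ, E) p).target) :
    (extChartAt 𝓘(ℝ, E) p).symm z ∈ (chartAt E p).source := by
  simpa using (extChartAt 𝓘(ℝ, E) p).map_target hz

variable [IsManifold 𝓘(ℝ, E) ∞ M]

/-- The tangent vector at `x` with prescribed coordinates in the chart at `p`. -/
def chartLift (p x : M) : E →L[ℝ] TangentSpace 𝓘(ℝ, E) x :=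
  (trivializationAt E (TangentSpace 𝓘(ℝ, E)) p).symmL ℝ x

/-- The coordinates of a tangent vector at `x` in the chart at `p`. -/
def chartCoord (p x : M) : TangentSpace 𝓘(ℝ, E) x →L[ℝ] E :=
  (trivializationAt E (TangentSpace 𝓘(ℝ, E)) p).continuousLinearMapAt ℝ x

theorem chartCoord_chartLift {p x : M} (hx : x ∈ (chartAt E p).source) (w : E) :
    chartCoord p x (chartLift p x w) = w :=
  Trivialization.continuousLinearMapAt_symmL _ (by simpa using hx) w

theorem chartLift_chartCoord {p x : M} (hx : x ∈ (chartAt E p).source)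
    (v : TangentSpace 𝓘(ℝ, E) x) : chartLift p x (chartCoord p x v) = v :=
  Trivialization.symmL_continuousLinearMapAt _ (by simpa using hx) v

theorem trivializationAt_apply_snd {p x : M} (hx : x ∈ (chartAt E p).source)
    (v : TangentSpace 𝓘(ℝ, E) x) :
    (trivializationAt E (TangentSpace 𝓘(ℝ, E)) p ⟨x, v⟩).2 = chartCoord p x v := by
  rw [chartCoord, Trivialization.continuousLinearMapAt_apply, Trivialization.linearMapAt_apply,
    if_pos (by simpa using hx)]

theorem trivializationAt_section_eventuallyEq {p x : M} (hx : x ∈ (chartAt E p).source)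
    (X : (y : M) → TangentSpace 𝓘(ℝ, E) y) :
    (fun y => (trivializationAt E (TangentSpace 𝓘(ℝ, E)) p ⟨y, X y⟩).2) =ᶠ[𝓝 x]
      fun y => chartCoord p y (X y) := by
  filter_upwards [(chartAt E p).open_source.mem_nhds hx] with y hy
    using trivializationAt_apply_snd hy (X y)

theorem contMDiffAt_iff_chartCoord {p x : M} (hx : x ∈ (chartAt E p).source)
    {X : (y : M) → TangentSpace 𝓘(ℝ, E) y} :
    CMDiffAt ∞ (T% X) x ↔ CMDiffAt ∞ (fun y => chartCoord p y (X y)) x := by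
  rw [Trivialization.contMDiffAt_section_iff (trivializationAt E (TangentSpace 𝓘(ℝ, E)) p)
    (by simpa using hx)]
  exact (trivializationAt_section_eventuallyEq hx X).contMDiffAt_iff

theorem mdifferentiableAt_iff_chartCoord {p x : M} (hx : x ∈ (chartAt E p).source)
    {X : (y : M) → TangentSpace 𝓘(ℝ, E) y} :
    MDiffAt (T% X) x ↔ MDiffAt (fun y => chartCoord p y (X y)) x := by
  rw [Trivialization.mdifferentiableAt_section_iff 𝓘(ℝ, E)
    (trivializationAt E (TangentSpace 𝓘(ℝ, E)) p) X (by simpa using hx)]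
  exact (trivializationAt_section_eventuallyEq hx X).mdifferentiableAt_iff

theorem chartCoord_chartLift_eventuallyEq {p x : M} (hx : x ∈ (chartAt E p).source) (ξ : M → E) :
    (fun y => chartCoord p y (chartLift p y (ξ y))) =ᶠ[𝓝 x] ξ := by
  filter_upwards [(chartAt E p).open_source.mem_nhds hx] with y hy
    using chartCoord_chartLift hy (ξ y)

theorem contMDiffAt_chartLift {p x : M} (hx : x ∈ (chartAt E p).source) {ξ : M → E}
    (hξ : CMDiffAt ∞ ξ x) : CMDiffAt ∞ (T% fun y => chartLift p y (ξ y)) x :=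
  (contMDiffAt_iff_chartCoord hx).2
    (hξ.congr_of_eventuallyEq (chartCoord_chartLift_eventuallyEq hx ξ))

theorem mdifferentiableAt_chartLift {p x : M} (hx : x ∈ (chartAt E p).source) {ξ : M → E}
    (hξ : MDiffAt ξ x) : MDiffAt (T% fun y => chartLift p y (ξ y)) x :=
  (mdifferentiableAt_iff_chartCoord hx).2
    (hξ.congr_of_eventuallyEq (chartCoord_chartLift_eventuallyEq hx ξ))

theorem hasMFDerivAt_extChartAt_chartCoord {p x : M} (hx : x ∈ (chartAt E p).source) :
    HasMFDerivAt 𝓘(ℝ, E) 𝓘(ℝ, E) (extChartAt 𝓘(ℝ, E) p) x (chartCoord p x) := by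
  have h := (mdifferentiableAt_extChartAt (I := 𝓘(ℝ, E)) hx).hasMFDerivAt
  rwa [← TangentBundle.continuousLinearMapAt_trivializationAt hx] at h

theorem hasMFDerivAt_symm_comp {p : M} {z : ℝ → E} {z' : E} {t : ℝ} (hz : HasDerivAt z z' t)
    (ht : z t ∈ (extChartAt 𝓘(ℝ, E) p).target) :
    HasMFDerivAt 𝓘(ℝ, ℝ) 𝓘(ℝ, E) (fun s => (extChartAt 𝓘(ℝ, E) p).symm (z s)) t
      ((chartLift p ((extChartAt 𝓘(ℝ, E) p).symm (z t))).comp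
        (ContinuousLinearMap.toSpanSingleton ℝ z')) := by
  have hdiff : MDifferentiableAt 𝓘(ℝ, E) 𝓘(ℝ, E) (extChartAt 𝓘(ℝ, E) p).symm (z t) :=
    ((contMDiffOn_extChartAt_symm (n := ∞) p).contMDiffAt
      ((isOpen_extChartAt_target p).mem_nhds ht)).mdifferentiableAt (by simp)
  have hsymmL := TangentBundle.symmL_trivializationAt (I := 𝓘(ℝ, E)) (𝕜 := ℝ)
    (symm_mem_chart_source ht)
  rw [(extChartAt 𝓘(ℝ, E) p).right_inv ht, ModelWithCorners.range_eq_univ,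
    mfderivWithin_univ] at hsymmL
  have h := hdiff.hasMFDerivAt
  rw [← hsymmL] at h
  exact h.comp t hz.hasFDerivAt.hasMFDerivAt

theorem hasDerivAt_comp_symm {p : M} {z : ℝ → E} {z' : E} {t : ℝ} (hz : HasDerivAt z z' t)
    (ht : z t ∈ (extChartAt 𝓘(ℝ, E) p).target) {F : Type*} [NormedAddCommGroup F]
    [NormedSpace ℝ F] {f : M → F} (hf : MDiffAt f ((extChartAt 𝓘(ℝ, E) p).symm (z t))) :
    HasDerivAt (fun s => f ((extChartAt 𝓘(ℝ, E) p).symm (z s)))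
      (mvfderiv 𝓘(ℝ, E) f ((extChartAt 𝓘(ℝ, E) p).symm (z t)) (chartLift p _ z')) t := by
  have h : HasFDerivAt (fun s => f ((extChartAt 𝓘(ℝ, E) p).symm (z s)))
      ((mvfderiv 𝓘(ℝ, E) f _).comp ((chartLift p _).comp
        (ContinuousLinearMap.toSpanSingleton ℝ z'))) t :=
    (hf.hasMFDerivAt.comp t (hasMFDerivAt_symm_comp hz ht)).hasFDerivAt
  refine h.hasDerivAt.congr_deriv ?_
  change mvfderiv 𝓘(ℝ, E) f _ (chartLift p _ ((1 : ℝ) • z')) = _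
  rw [one_smul]

theorem exists_contMDiff_eventuallyEq [FiniteDimensional ℝ E] [T2Space M] {U : Set M}
    (hU : IsOpen U) {X : (x : M) → TangentSpace 𝓘(ℝ, E) x} (hX : CMDiff[U] ∞ (T% X)) {x : M}
    (hx : x ∈ U) : ∃ Y : (x : M) → TangentSpace 𝓘(ℝ, E) x,
      CMDiff ∞ (T% Y) ∧ ∀ᶠ y in 𝓝 x, X y = Y y := by
  obtain ⟨f, -, hf⟩ := (SmoothBumpFunction.nhds_basis_tsupport (I := 𝓘(ℝ, E)) x).mem_iff.1
    (hU.mem_nhds hx)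
  refine ⟨(fun y => f y) • X, ContMDiffOn.smul_section_of_tsupport f.contMDiff.contMDiffOn hU hf hX,
    ?_⟩
  filter_upwards [f.eventuallyEq_one] with y hy
  simp [hy]

theorem chartLift_eq_sum {ι : Type*} [Fintype ι] (b : Module.Basis ι ℝ E) (p x : M) (w : E) :
    chartLift p x w = ∑ i, b.repr w i • chartLift p x (b i) := by
  conv_lhs => rw [← b.sum_repr w]
  simp only [map_sum, map_smul]

end Charts

section Christoffel

variable {E : Type*} [NormedAddCommGroup E] [NormedSpace ℝ E] {M : Type*} [TopologicalSpace M]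
  [ChartedSpace E M] [IsManifold 𝓘(ℝ, E) ∞ M]
  {cov : CovariantDerivative 𝓘(ℝ, E) E (fun x : M => TangentSpace 𝓘(ℝ, E) x)}

theorem cov_eq_of_eventuallyEq {X Y : (x : M) → TangentSpace 𝓘(ℝ, E) x} {x : M}
    (hX : MDiffAt (T% X) x) (h : ∀ᶠ y in 𝓝 x, X y = Y y) : cov X x = cov Y x :=
  cov.isCovariantDerivativeOnUniv.congr_of_eventuallyEq hX
    (hX.congr_of_eventuallyEq (h.mono fun y hy => by dsimp only; rw [hy])) Filter.univ_mem h

theorem cov_sum_smul {ι : Type*} (s : Finset ι) {f : ι → M → ℝ}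
    {X : ι → (x : M) → TangentSpace 𝓘(ℝ, E) x} {x : M} (hf : ∀ i, MDiffAt (f i) x)
    (hX : ∀ i, MDiffAt (T% (X i)) x) (v : TangentSpace 𝓘(ℝ, E) x) :
    cov (fun y => ∑ i ∈ s, f i y • X i y) x v =
      ∑ i ∈ s, (mvfderiv 𝓘(ℝ, E) (f i) x v • X i x + f i x • cov (X i) x v) := by
  classical
  have hsmul : ∀ i, MDiffAt (T% (f i • X i)) x := fun i => (hf i).smul_section (hX i)
  induction s using Finset.induction_on with
  | empty =>
    have hzero : (fun y : M => ∑ i ∈ (∅ : Finset ι), f i y • X i y) = 0 := by ext; simp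
    rw [hzero, cov.zero]
    simp
  | insert i s hi ih =>
    have hsum : (fun y : M => ∑ i ∈ insert i s, f i y • X i y) =
        f i • X i + fun y => ∑ i ∈ s, f i y • X i y := by
      ext y
      simp [Finset.sum_insert hi]
    rw [hsum, Finset.sum_insert hi, ← ih, cov.isCovariantDerivativeOnUniv.add (hsmul i)
      (MDifferentiableAt.sum_section (t := fun i y => f i y • X i y) fun i _ => hsmul i),
      cov.isCovariantDerivativeOnUniv.leibniz (hX i) (hf i)]
    simp [add_comm]

theorem contMDiffAt_cov [FiniteDimensional ℝ E] [T2Space M]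
    (hcov : cov.ContMDiffCovariantDerivative ∞) {U : Set M} (hU : IsOpen U)
    {X : (x : M) → TangentSpace 𝓘(ℝ, E) x} (hX : CMDiff[U] ∞ (T% X)) {x : M} (hx : x ∈ U) :
    ContMDiffAt 𝓘(ℝ, E) (𝓘(ℝ, E).prod 𝓘(ℝ, E →L[ℝ] E)) ∞ (fun y => TotalSpace.mk' (E →L[ℝ] E)
      (E := fun y : M => TangentSpace 𝓘(ℝ, E) y →L[ℝ] TangentSpace 𝓘(ℝ, E) y) y (cov X y)) x := by
  obtain ⟨Y, hY, hXY⟩ := exists_contMDiff_eventuallyEq hU hX hx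
  have hcovY := hcov.contMDiff.contMDiff (σ := Y) (by simpa using hY.contMDiffOn)
  refine (hcovY.contMDiffAt Filter.univ_mem).congr_of_eventuallyEq ?_
  filter_upwards [hXY.eventually_nhds, hU.mem_nhds hx] with y hy hyU
  rw [cov_eq_of_eventuallyEq (((hX y hyU).contMDiffAt (hU.mem_nhds hyU)).mdifferentiableAt
    (by simp)) hy]

theorem contMDiffOn_chartLift_const (p : M) (w : E) :
    CMDiff[(chartAt E p).source] ∞ (T% fun x => chartLift p x w) := fun _ hx =>
  (contMDiffAt_chartLift hx contMDiffAt_const).contMDiffWithinAt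

variable [FiniteDimensional ℝ E]

variable (cov) in
/-- The Christoffel symbols of a connection in the chart at `p`: `christoffel cov p z v w` is the
coordinate vector of `∇_v w` for the fields with constant coordinates `v` and `w`. It is assembled
from a basis so as to be linear in `w` also outside the target of the chart. -/
def christoffel (p : M) (z : E) : E →L[ℝ] E →L[ℝ] E :=
  let b := Module.finBasis ℝ E
  let x := (extChartAt 𝓘(ℝ, E) p).symm z
  ∑ i, (ContinuousLinearMap.smulRightL ℝ E E (LinearMap.toContinuousLinearMap (b.coord i))).comp
    ((chartCoord p x).comp ((cov (fun y => chartLift p y (b i)) x).comp (chartLift p x)))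

theorem contDiffOn_christoffel [T2Space M] (hcov : cov.ContMDiffCovariantDerivative ∞) (p : M) :
    ContDiffOn ℝ ∞ (christoffel cov p) (extChartAt 𝓘(ℝ, E) p).target := by
  let b := Module.finBasis ℝ E
  have hcoord : ∀ i, ContMDiffOn 𝓘(ℝ, E) 𝓘(ℝ, E →L[ℝ] E) ∞ (fun x => (chartCoord p x).comp
      ((cov (fun y => chartLift p y (b i)) x).comp (chartLift p x))) (chartAt E p).source := by
    intro i
    have hsec := (Trivialization.contMDiffOn_section_baseSet_iff
      (s := fun x => cov (fun y => chartLift p y (b i)) x) (trivializationAt (E →L[ℝ] E)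
        (fun x : M => TangentSpace 𝓘(ℝ, E) x →L[ℝ] TangentSpace 𝓘(ℝ, E) x) p)).1 fun x hx =>
      (contMDiffAt_cov hcov (chartAt E p).open_source (contMDiffOn_chartLift_const p (b i))
        (by simpa using hx)).contMDiffWithinAt
    refine (hsec.mono fun x hx => by simpa using hx).congr fun x _ => ?_
    rw [hom_trivializationAt_apply]
    rfl
  refine ContDiffOn.sum fun i _ => contDiffOn_const.clm_comp ?_
  rw [← contMDiffOn_iff_contDiffOn]
  exact (hcoord i).comp (contMDiffOn_extChartAt_symm (n := ∞) p) fun z hz =>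
    symm_mem_chart_source hz

theorem chartLift_christoffel {p : M} {z : E} (hz : z ∈ (extChartAt 𝓘(ℝ, E) p).target) (v w : E) :
    chartLift p ((extChartAt 𝓘(ℝ, E) p).symm z) (christoffel cov p z v w) =
      ∑ i, (Module.finBasis ℝ E).repr w i • cov (fun y => chartLift p y (Module.finBasis ℝ E i))
        ((extChartAt 𝓘(ℝ, E) p).symm z) (chartLift p _ v) := by
  have hx := symm_mem_chart_source hz
  simp only [christoffel, sum_apply, map_sum]
  refine Finset.sum_congr rfl fun i _ => ?_
  change chartLift p _ ((Module.finBasis ℝ E).repr w i • chartCoord p _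
    (cov (fun y => chartLift p y (Module.finBasis ℝ E i)) _ (chartLift p _ v))) = _
  rw [map_smul, chartLift_chartCoord hx]

theorem cov_chartLift {p : M} {z : E} (hz : z ∈ (extChartAt 𝓘(ℝ, E) p).target) {ξ : E → E}
    {ξ' : E →L[ℝ] E} (hξ : HasFDerivAt ξ ξ' z) (v : E) :
    cov (fun x => chartLift p x (ξ (extChartAt 𝓘(ℝ, E) p x))) ((extChartAt 𝓘(ℝ, E) p).symm z)
      (chartLift p _ v) = chartLift p _ (ξ' v + christoffel cov p z v (ξ z)) := by
  let b := Module.finBasis ℝ E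
  have hx := symm_mem_chart_source hz
  have hφx : extChartAt 𝓘(ℝ, E) p ((extChartAt 𝓘(ℝ, E) p).symm z) = z :=
    (extChartAt 𝓘(ℝ, E) p).right_inv hz
  have hcoord : ∀ i, HasMFDerivAt 𝓘(ℝ, E) 𝓘(ℝ, ℝ)
      (fun y => b.repr (ξ (extChartAt 𝓘(ℝ, E) p y)) i) ((extChartAt 𝓘(ℝ, E) p).symm z)
      (((LinearMap.toContinuousLinearMap (b.coord i)).comp ξ').comp (chartCoord p _)) := fun i => by
    have h := (LinearMap.toContinuousLinearMap (b.coord i)).hasFDerivAt.comp z hξ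
    rw [← hφx] at h
    exact h.hasMFDerivAt.comp _ (hasMFDerivAt_extChartAt_chartCoord hx)
  have hcoord_apply : ∀ i, mvfderiv 𝓘(ℝ, E) (fun y => b.repr (ξ (extChartAt 𝓘(ℝ, E) p y)) i)
      ((extChartAt 𝓘(ℝ, E) p).symm z) (chartLift p _ v) = b.repr (ξ' v) i := fun i => by
    rw [mvfderiv, (hcoord i).mfderiv]
    change b.repr (ξ' (chartCoord p _ (chartLift p _ v))) i = _
    rw [chartCoord_chartLift hx]
  simp only [fun y => chartLift_eq_sum b p y (ξ (extChartAt 𝓘(ℝ, E) p y))]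
  rw [cov_sum_smul Finset.univ (fun i => (hcoord i).mdifferentiableAt)
    fun i => mdifferentiableAt_chartLift hx mdifferentiableAt_const]
  simp only [hcoord_apply, Finset.sum_add_distrib, hφx]
  rw [← chartLift_eq_sum, map_add, chartLift_christoffel hz]

theorem cov_chartLift_const {p : M} {z : E} (hz : z ∈ (extChartAt 𝓘(ℝ, E) p).target) (v w : E) :
    cov (fun x => chartLift p x w) ((extChartAt 𝓘(ℝ, E) p).symm z) (chartLift p _ v) =
      chartLift p _ (christoffel cov p z v w) := by
  simpa using cov_chartLift (cov := cov) hz (hasFDerivAt_const w z) v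

end Christoffel

section ParallelForms

variable {E : Type*} [NormedAddCommGroup E] [NormedSpace ℝ E] [FiniteDimensional ℝ E]

theorem hasDerivAt_bilinear_zero {B : ℝ → E →ₗ[ℝ] E →ₗ[ℝ] ℝ} {Γ : E →ₗ[ℝ] E} {c d : ℝ → E} {t : ℝ}
    (hB : ∀ v w, HasDerivAt (fun s => B s v w) (B t (Γ v) w + B t v (Γ w)) t)
    (hc : HasDerivAt c (-Γ (c t)) t) (hd : HasDerivAt d (-Γ (d t)) t) :
    HasDerivAt (fun s => B s (c s) (d s)) 0 t := by
  have hleft : ∀ w, HasDerivAt (fun s => B s (c s) w) (B t (c t) (Γ w)) t := fun w => by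
    simpa using hasDerivAt_linearMap_apply (f := fun s => (B s).flip w)
      (f' := (B t).flip w ∘ₗ Γ + (B t).flip (Γ w)) (fun v => hB v w) hc
  simpa using hasDerivAt_linearMap_apply (f := fun s => B s (c s)) (f' := B t (c t) ∘ₗ Γ) hleft hd

theorem hasDerivAt_trilinear_zero {B : ℝ → E →ₗ[ℝ] E →ₗ[ℝ] E →ₗ[ℝ] ℝ} {Γ : E →ₗ[ℝ] E}
    {c d e : ℝ → E} {t : ℝ}
    (hB : ∀ u v w, HasDerivAt (fun s => B s u v w)
      (B t (Γ u) v w + B t u (Γ v) w + B t u v (Γ w)) t)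
    (hc : HasDerivAt c (-Γ (c t)) t) (hd : HasDerivAt d (-Γ (d t)) t)
    (he : HasDerivAt e (-Γ (e t)) t) :
    HasDerivAt (fun s => B s (c s) (d s) (e s)) 0 t := by
  have hleft : ∀ v w, HasDerivAt (fun s => B s (c s) v w)
      (B t (c t) (Γ v) w + B t (c t) v (Γ w)) t := fun v w => by
    refine (hasDerivAt_linearMap_apply (f := fun s => ((B s).flip v).flip w)
      (f' := ((B t).flip v).flip w ∘ₗ Γ + ((B t).flip (Γ v)).flip w + ((B t).flip v).flip (Γ w))
      (fun u => hB u v w) hc).congr_deriv ?_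
    simp only [LinearMap.add_apply, LinearMap.comp_apply, LinearMap.flip_apply, map_neg]
    ring
  exact hasDerivAt_bilinear_zero (B := fun s => B s (c s)) hleft hd he

end ParallelForms

section ParallelCurves

variable {M : Type*} [TopologicalSpace M] [ChartedSpace E6 M] [IsManifold (𝓡 6) ∞ M]

/-- The field of bilinear forms `F` is parallel for the connection `cov`: the product rule holds
for the fields with constant coordinates in a chart, which is enough by linearity. -/
def IsParallelBilin (cov : AffineConnection M)
    (F : (x : M) → TangentSpace (𝓡 6) x →ₗ[ℝ] TangentSpace (𝓡 6) x →ₗ[ℝ] ℝ) : Prop :=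
  ∀ p x : M, x ∈ (chartAt E6 p).source → ∀ v w : E6,
    MDifferentiableAt (𝓡 6) 𝓘(ℝ, ℝ) (fun y => F y (chartLift p y v) (chartLift p y w)) x ∧
    ∀ u, mvfderiv (𝓡 6) (fun y => F y (chartLift p y v) (chartLift p y w)) x u =
      F x (cov (fun y => chartLift p y v) x u) (chartLift p x w) +
        F x (chartLift p x v) (cov (fun y => chartLift p y w) x u)

/-- The field of trilinear forms `F` is parallel for the connection `cov`, again tested on fields
with constant coordinates in a chart. -/
def IsParallelTrilin (cov : AffineConnection M)
    (F : (x : M) → TangentSpace (𝓡 6) x →ₗ[ℝ] TangentSpace (𝓡 6) x →ₗ[ℝ]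
      TangentSpace (𝓡 6) x →ₗ[ℝ] ℝ) : Prop :=
  ∀ p x : M, x ∈ (chartAt E6 p).source → ∀ v₁ v₂ v₃ : E6,
    MDifferentiableAt (𝓡 6) 𝓘(ℝ, ℝ)
      (fun y => F y (chartLift p y v₁) (chartLift p y v₂) (chartLift p y v₃)) x ∧
    ∀ u, mvfderiv (𝓡 6)
        (fun y => F y (chartLift p y v₁) (chartLift p y v₂) (chartLift p y v₃)) x u =
      F x (cov (fun y => chartLift p y v₁) x u) (chartLift p x v₂) (chartLift p x v₃) +
        F x (chartLift p x v₁) (cov (fun y => chartLift p y v₂) x u) (chartLift p x v₃) +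
        F x (chartLift p x v₁) (chartLift p x v₂) (cov (fun y => chartLift p y v₃) x u)

/-- `c` is the coordinate expression, in the chart at `p`, of a parallel field along the curve with
coordinates `z` and velocity `z'`. -/
structure IsParallelCoord (cov : AffineConnection M) (p : M) (z z' c : ℝ → E6) : Prop where
  mem_target : ∀ t, z t ∈ (extChartAt (𝓡 6) p).target
  hasDerivAt_curve : ∀ t, HasDerivAt z (z' t) t
  hasDerivAt_field : ∀ t, HasDerivAt c (-christoffel cov p (z t) (z' t) (c t)) t

variable {cov : AffineConnection M} {p : M} {z z' c d e : ℝ → E6}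

theorem IsParallelCoord.hasCovDerivAlong (hc : IsParallelCoord cov p z z' c) (t : ℝ) :
    HasCovDerivAlong cov (fun s => (extChartAt (𝓡 6) p).symm (z s))
      (fun s => chartLift p _ (c s)) t 0 := by
  let b := Module.finBasis ℝ E6
  have hd : ∀ i, HasDerivAt (fun s => b.repr (c s) i)
      (b.repr (-christoffel cov p (z t) (z' t) (c t)) i) t := fun i =>
    (LinearMap.toContinuousLinearMap (b.coord i)).hasFDerivAt.comp_hasDerivAt t
      (hc.hasDerivAt_field t)
  have hx := symm_mem_chart_source (hc.mem_target t)
  have hvelocity : mfderiv 𝓘(ℝ, ℝ) (𝓡 6) (fun s => (extChartAt (𝓡 6) p).symm (z s)) t (1 : ℝ) =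
      chartLift p _ (z' t) := by
    rw [(hasMFDerivAt_symm_comp (hc.hasDerivAt_curve t) (hc.mem_target t)).mfderiv]
    change chartLift p _ ((1 : ℝ) • z' t) = _
    rw [one_smul]
  refine ⟨_, fun i s => b.repr (c s) i, fun i x => chartLift p x (b i),
    fun i => (hd i).differentiableAt,
    fun i => mdifferentiableAt_chartLift hx mdifferentiableAt_const,
    .of_forall fun s => chartLift_eq_sum b p _ (c s), ?_⟩
  simp only [hvelocity, (hd _).deriv, Finset.sum_add_distrib]
  rw [← chartLift_eq_sum, ← chartLift_christoffel (hc.mem_target t), ← map_add, neg_add_cancel,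
    map_zero]

theorem IsParallelBilin.eq_of_isParallelCoord
    {F : (x : M) → TangentSpace (𝓡 6) x →ₗ[ℝ] TangentSpace (𝓡 6) x →ₗ[ℝ] ℝ}
    (hF : IsParallelBilin cov F) (hc : IsParallelCoord cov p z z' c)
    (hd : IsParallelCoord cov p z z' d) (a b : ℝ) :
    F ((extChartAt (𝓡 6) p).symm (z a)) (chartLift p _ (c a)) (chartLift p _ (d a)) =
      F ((extChartAt (𝓡 6) p).symm (z b)) (chartLift p _ (c b)) (chartLift p _ (d b)) := by
  have hderiv : ∀ t, HasDerivAt (fun t => F ((extChartAt (𝓡 6) p).symm (z t))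
      (chartLift p _ (c t)) (chartLift p _ (d t))) 0 t := by
    intro t
    refine hasDerivAt_bilinear_zero (Γ := (christoffel cov p (z t) (z' t)).toLinearMap)
      (B := fun s => (F ((extChartAt (𝓡 6) p).symm (z s))).compl₁₂
        (chartLift p _).toLinearMap (chartLift p _).toLinearMap) (fun v w => ?_)
      (hc.hasDerivAt_field t) (hd.hasDerivAt_field t)
    have hz := hc.mem_target t
    obtain ⟨hdiff, hprod⟩ := hF p _ (symm_mem_chart_source hz) v w
    have h := hasDerivAt_comp_symm (hc.hasDerivAt_curve t) hz hdiff
    rwa [hprod, cov_chartLift_const hz, cov_chartLift_const hz] at h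
  exact is_const_of_deriv_eq_zero (fun t => (hderiv t).differentiableAt)
    (fun t => (hderiv t).deriv) a b

theorem IsParallelTrilin.eq_of_isParallelCoord
    {F : (x : M) → TangentSpace (𝓡 6) x →ₗ[ℝ] TangentSpace (𝓡 6) x →ₗ[ℝ]
      TangentSpace (𝓡 6) x →ₗ[ℝ] ℝ}
    (hF : IsParallelTrilin cov F) (hc : IsParallelCoord cov p z z' c)
    (hd : IsParallelCoord cov p z z' d) (he : IsParallelCoord cov p z z' e) (a b : ℝ) :
    F ((extChartAt (𝓡 6) p).symm (z a)) (chartLift p _ (c a)) (chartLift p _ (d a))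
        (chartLift p _ (e a)) =
      F ((extChartAt (𝓡 6) p).symm (z b)) (chartLift p _ (c b)) (chartLift p _ (d b))
        (chartLift p _ (e b)) := by
  have hderiv : ∀ t, HasDerivAt (fun t => F ((extChartAt (𝓡 6) p).symm (z t))
      (chartLift p _ (c t)) (chartLift p _ (d t)) (chartLift p _ (e t))) 0 t := by
    intro t
    refine hasDerivAt_trilinear_zero (Γ := (christoffel cov p (z t) (z' t)).toLinearMap)
      (B := fun s => ((F ((extChartAt (𝓡 6) p).symm (z s))).compl₁₂
        (chartLift p _).toLinearMap (chartLift p _).toLinearMap).compr₂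
        (LinearMap.lcomp ℝ ℝ (chartLift p _).toLinearMap)) (fun u v w => ?_)
      (hc.hasDerivAt_field t) (hd.hasDerivAt_field t) (he.hasDerivAt_field t)
    have hz := hc.mem_target t
    obtain ⟨hdiff, hprod⟩ := hF p _ (symm_mem_chart_source hz) u v w
    have h := hasDerivAt_comp_symm (hc.hasDerivAt_curve t) hz hdiff
    rwa [hprod, cov_chartLift_const hz, cov_chartLift_const hz, cov_chartLift_const hz] at h
  exact is_const_of_deriv_eq_zero (fun t => (hderiv t).differentiableAt)
    (fun t => (hderiv t).deriv) a b

theorem isParallelTransport_of_isParallelCoord (hz : ContDiff ℝ ∞ z) (a b : ℝ)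
    (P : TangentSpace (𝓡 6) ((extChartAt (𝓡 6) p).symm (z a)) →ₗ[ℝ]
      TangentSpace (𝓡 6) ((extChartAt (𝓡 6) p).symm (z b)))
    (hP : ∀ v, ∃ c, IsParallelCoord cov p z z' c ∧ chartLift p _ (c a) = v ∧
      chartLift p _ (c b) = P v) :
    IsParallelTransport cov ((extChartAt (𝓡 6) p).symm (z a)) ((extChartAt (𝓡 6) p).symm (z b))
      P := by
  refine IsParallelTransport.segment (fun s => (extChartAt (𝓡 6) p).symm (z s)) (fun t => ?_) a b P
    fun v => ?_
  · obtain ⟨c, hc, -⟩ := hP 0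
    exact ((contMDiffOn_extChartAt_symm (n := ∞) p).contMDiffAt
      ((isOpen_extChartAt_target p).mem_nhds (hc.mem_target t))).comp t hz.contMDiff.contMDiffAt
  · obtain ⟨c, hc, ha, hb⟩ := hP v
    exact ⟨fun s => chartLift p _ (c s), hc.hasCovDerivAlong, ha, hb⟩

end ParallelCurves

section ParallelTensors

variable {M : Type*} [TopologicalSpace M] [ChartedSpace E6 M] [IsManifold (𝓡 6) ∞ M]
  {cov : AffineConnection M}

theorem mdifferentiableAt_cov_chartLift [T2Space M] (hcov : cov.ContMDiffCovariantDerivative ∞)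
    {p x : M} (hx : x ∈ (chartAt E6 p).source) (v w : E6) :
    IsDiffAt (fun y => cov (fun y => chartLift p y w) y (chartLift p y v)) x :=
  MDifferentiableAt.clm_bundle_apply ((contMDiffAt_cov hcov (chartAt E6 p).open_source
    (contMDiffOn_chartLift_const p w) hx).mdifferentiableAt (by simp))
    (mdifferentiableAt_chartLift hx mdifferentiableAt_const)

theorem mdifferentiableAt_mlieBracket_chartLift {p x : M} (hx : x ∈ (chartAt E6 p).source)
    (v w : E6) : IsDiffAt (VectorField.mlieBracket (𝓡 6) (fun y => chartLift p y v)
      (fun y => chartLift p y w)) x := by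
  have : IsManifold (𝓡 6) (((⊤ : ℕ∞) : ℕ∞ω) + 1) M := by simpa
  have : IsManifold (𝓡 6) (minSmoothness ℝ 2) M := by
    simpa using (inferInstance : IsManifold (𝓡 6) 2 M)
  exact (ContMDiffAt.mlieBracket_vectorField (m := 1) (n := ⊤)
    (contMDiffAt_chartLift hx contMDiffAt_const) (contMDiffAt_chartLift hx contMDiffAt_const)
    (by simpa using (by exact_mod_cast le_top : ((1 + 1 : ℕ∞) : ℕ∞ω) ≤ ∞))).mdifferentiableAt
    (by simp)

theorem mdifferentiableAt_torsion_chartLift [T2Space M]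
    (hcov : cov.ContMDiffCovariantDerivative ∞) {p x : M} (hx : x ∈ (chartAt E6 p).source)
    (v w : E6) : IsDiffAt (fun y => cov.torsion y (chartLift p y v) (chartLift p y w)) x := by
  have hd := mdifferentiableAt_sub_section (mdifferentiableAt_sub_section
    (mdifferentiableAt_cov_chartLift hcov hx v w) (mdifferentiableAt_cov_chartLift hcov hx w v))
    (mdifferentiableAt_mlieBracket_chartLift hx v w)
  refine MDifferentiableAt.congr_of_eventuallyEq hd ?_
  filter_upwards [(chartAt E6 p).open_source.mem_nhds hx] with y hy
  rw [cov.torsion_apply (X := fun y => chartLift p y v) (Y := fun y => chartLift p y w)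
    (mdifferentiableAt_chartLift hy mdifferentiableAt_const)
    (mdifferentiableAt_chartLift hy mdifferentiableAt_const)]
  rfl

variable [RiemannianBundle (fun x : M => TangentSpace (𝓡 6) x)]

theorem OrthogonalACS.isDiffAt (J : OrthogonalACS M) {X : (x : M) → TangentSpace (𝓡 6) x} {x : M}
    (hX : IsDiffAt X x) : IsDiffAt (fun y => J y (X y)) x :=
  MDifferentiableAt.clm_bundle_apply ((J.smooth x).mdifferentiableAt (by simp)) hX

/-- The metric, with values in the linear maps that `IsParallelBilin` expects. -/
def metricBilin (x : M) : TangentSpace (𝓡 6) x →ₗ[ℝ] TangentSpace (𝓡 6) x →ₗ[ℝ] ℝ :=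
  innerₗ (TangentSpace (𝓡 6) x)

/-- The torsion form, with values in the linear maps that `IsParallelTrilin` expects. -/
def torsionTrilin (cov : AffineConnection M) (x : M) :
    TangentSpace (𝓡 6) x →ₗ[ℝ] TangentSpace (𝓡 6) x →ₗ[ℝ] TangentSpace (𝓡 6) x →ₗ[ℝ] ℝ :=
  LinearMap.compr₂ (ContinuousLinearMap.toLinearMap₁₂ (cov.torsion x))
    (innerₗ (TangentSpace (𝓡 6) x))

variable [IsContMDiffRiemannianBundle (𝓡 6) ∞ E6 (fun x : M => TangentSpace (𝓡 6) x)]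

-- A shortcut: the search for this instance otherwise exceeds the default heartbeat limit.
instance : IsContMDiffRiemannianBundle (𝓡 6) 1 E6 (fun x : M => TangentSpace (𝓡 6) x) :=
  .of_le (n := ∞) (by simp)

theorem isParallelBilin_metric (hcov : cov.IsMetricCompatible) :
    IsParallelBilin cov (metricBilin (M := M)) := by
  intro p x hx v w
  have hv : IsDiffAt (fun y => chartLift p y v) x :=
    mdifferentiableAt_chartLift hx mdifferentiableAt_const
  have hw : IsDiffAt (fun y => chartLift p y w) x :=
    mdifferentiableAt_chartLift hx mdifferentiableAt_const
  refine ⟨hv.inner_bundle hw, fun u => ?_⟩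
  simpa using! hcov.mvfderiv_inner_eq (FiberBundle.extend E6 u) hv hw

theorem isParallelBilin_kahler {J : OrthogonalACS M} (hJ : IsCharacteristicConnection J cov) :
    IsParallelBilin cov (fun x => metricBilin x ∘ₗ (J x).toLinearMap) := by
  intro p x hx v w
  have hv : IsDiffAt (fun y => chartLift p y v) x :=
    mdifferentiableAt_chartLift hx mdifferentiableAt_const
  have hw : IsDiffAt (fun y => chartLift p y w) x :=
    mdifferentiableAt_chartLift hx mdifferentiableAt_const
  refine ⟨(J.isDiffAt hv).inner_bundle hw, fun u => ?_⟩
  have hprod := hJ.metric.mvfderiv_inner_eq (FiberBundle.extend E6 u) (J.isDiffAt hv) hw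
  dsimp only at hprod
  rw [hJ.complex x _ hv] at hprod
  simpa using! hprod

theorem isParallelTrilin_torsion [T2Space M] (hcov : cov.ContMDiffCovariantDerivative ∞)
    (hT : HasParallelTorsion cov) : IsParallelTrilin cov (torsionTrilin cov) := by
  intro p x hx v₁ v₂ v₃
  have hd : ∀ v, IsDiffAt (fun y => chartLift p y v) x := fun v =>
    mdifferentiableAt_chartLift hx mdifferentiableAt_const
  exact ⟨(mdifferentiableAt_torsion_chartLift hcov hx v₁ v₂).inner_bundle (hd v₃),
    hT x _ _ _ (hd v₁) (hd v₂) (hd v₃)⟩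

end ParallelTensors

section Transport

variable {M : Type*} [TopologicalSpace M] [ChartedSpace E6 M] [IsManifold (𝓡 6) ∞ M]
  {cov : AffineConnection M} {p : M}

theorem IsLinearFlow.eventually_isParallelCoord {z₀ : E6} {Φ : E6 → ℝ → E6 →L[ℝ] E6}
    (hΦ : IsLinearFlow (christoffel cov p) (extChartAt (𝓡 6) p).target z₀ Φ) :
    ∀ᶠ v in 𝓝 0, ∀ s ∈ Set.Icc (-1 : ℝ) 1, ∀ w, IsParallelCoord cov p
      (fun t => z₀ + (s * Real.smoothTransition t) • v)
      (fun t => (s * deriv Real.smoothTransition t) • v)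
      (fun t => Φ v (s * Real.smoothTransition t) w) := by
  filter_upwards [hΦ.line_mem, hΦ.hasDerivAt] with v hmem hderiv s hs w
  have hparam : ∀ t, s * Real.smoothTransition t ∈ Set.Ioo (-2 : ℝ) 2 := fun t => by
    have h₀ := Real.smoothTransition.nonneg t
    have h₁ := Real.smoothTransition.le_one t
    constructor <;> nlinarith [hs.1, hs.2]
  have hχ : ∀ t, HasDerivAt (fun t => s * Real.smoothTransition t)
      (s * deriv Real.smoothTransition t) t := fun t =>
    ((Real.smoothTransition.contDiff.differentiable (n := 1) (by simp) t).hasDerivAt).const_mul s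
  refine ⟨fun t => hmem _ (hparam t), fun t => ((hχ t).smul_const v).const_add z₀, fun t => ?_⟩
  have hflow := (hderiv _ (hparam t)).scomp t (hχ t)
  have hfield := hflow.clm_apply (hasDerivAt_const t w)
  refine hfield.congr_deriv ?_
  simp

variable [RiemannianBundle (fun x : M => TangentSpace (𝓡 6) x)] {J : OrthogonalACS M}

/-- `P` and its inverse are parallel transports which preserve the metric, the almost complex
structure and the torsion. -/
structure IsReversibleTransport (J : OrthogonalACS M) (cov : AffineConnection M) {x y : M}
    (P : TangentSpace (𝓡 6) x ≃ₗ[ℝ] TangentSpace (𝓡 6) y) : Prop where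
  transport : IsParallelTransport cov x y P.toLinearMap
  transport_symm : IsParallelTransport cov y x P.symm.toLinearMap
  inner_map (v w : TangentSpace (𝓡 6) x) : (inner ℝ (P v) (P w) : ℝ) = inner ℝ v w
  map_acs (v : TangentSpace (𝓡 6) x) : P (J x v) = J y (P v)
  map_torsion (v w : TangentSpace (𝓡 6) x) : P (cov.torsion x v w) = cov.torsion y (P v) (P w)

theorem IsReversibleTransport.symm {x y : M} {P : TangentSpace (𝓡 6) x ≃ₗ[ℝ] TangentSpace (𝓡 6) y}
    (hP : IsReversibleTransport J cov P) : IsReversibleTransport J cov P.symm where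
  transport := hP.transport_symm
  transport_symm := hP.transport
  inner_map v w := by rw [← hP.inner_map]; simp
  map_acs v := by rw [LinearEquiv.symm_apply_eq, hP.map_acs]; simp
  map_torsion v w := by rw [LinearEquiv.symm_apply_eq, hP.map_torsion]; simp

theorem IsReversibleTransport.trans {x y z : M}
    {P : TangentSpace (𝓡 6) x ≃ₗ[ℝ] TangentSpace (𝓡 6) y}
    {Q : TangentSpace (𝓡 6) y ≃ₗ[ℝ] TangentSpace (𝓡 6) z}
    (hP : IsReversibleTransport J cov P) (hQ : IsReversibleTransport J cov Q) :
    IsReversibleTransport J cov (P.trans Q) where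
  transport := hP.transport.trans hQ.transport
  transport_symm := hQ.transport_symm.trans hP.transport_symm
  inner_map v w := by simp [hP.inner_map, hQ.inner_map]
  map_acs v := by simp [hP.map_acs, hQ.map_acs]
  map_torsion v w := by simp [hP.map_torsion, hQ.map_torsion]

variable [IsContMDiffRiemannianBundle (𝓡 6) ∞ E6 (fun x : M => TangentSpace (𝓡 6) x)]

theorem exists_linearEquiv_of_isParallelCoord (hcov : cov.IsMetricCompatible) {a b : ℝ}
    {z z' : ℝ → E6} {c : E6 → ℝ → E6} {A : E6 →L[ℝ] E6}
    (hc : ∀ w, IsParallelCoord cov p z z' (c w)) (ha : ∀ w, c w a = w) (hb : ∀ w, c w b = A w) :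
    ∃ P : TangentSpace (𝓡 6) ((extChartAt (𝓡 6) p).symm (z a)) ≃ₗ[ℝ]
        TangentSpace (𝓡 6) ((extChartAt (𝓡 6) p).symm (z b)),
      (∀ v w, (inner ℝ (P v) (P w) : ℝ) = inner ℝ v w) ∧
      ∀ w, P (chartLift p _ w) = chartLift p _ (A w) := by
  have hx := symm_mem_chart_source ((hc 0).mem_target a)
  let L : TangentSpace (𝓡 6) ((extChartAt (𝓡 6) p).symm (z a)) →ₗ[ℝ]
      TangentSpace (𝓡 6) ((extChartAt (𝓡 6) p).symm (z b)) :=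
    ((chartLift p _).comp (A.comp (chartCoord p _))).toLinearMap
  have hL : ∀ w, L (chartLift p _ w) = chartLift p _ (A w) := fun w => by
    change chartLift p _ (A (chartCoord p _ (chartLift p _ w))) = _
    rw [chartCoord_chartLift hx]
  have hinner : ∀ v w, (inner ℝ (L v) (L w) : ℝ) = inner ℝ v w := fun v w => by
    have h := (isParallelBilin_metric hcov).eq_of_isParallelCoord (hc (chartCoord p _ v))
      (hc (chartCoord p _ w)) a b
    rw [ha, ha, hb, hb, ← hL, ← hL, chartLift_chartCoord hx, chartLift_chartCoord hx] at h
    exact h.symm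
  have hinj : Function.Injective L := (injective_iff_map_eq_zero L).2 fun v hv => by
    have h := hinner v v
    rw [hv, inner_zero_left] at h
    exact inner_self_eq_zero.1 h.symm
  have hfin : ∀ x : M, FiniteDimensional ℝ (TangentSpace (𝓡 6) x) := fun _ =>
    inferInstanceAs (FiniteDimensional ℝ E6)
  exact ⟨LinearEquiv.ofInjectiveOfFinrankEq L hinj rfl, hinner, hL⟩

theorem exists_isReversibleTransport_of_isParallelCoord [T2Space M]
    (hJ : IsCharacteristicConnection J cov) (hT : HasParallelTorsion cov) {a b : ℝ} {z z' : ℝ → E6}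
    (hz : ContDiff ℝ ∞ z) {z₀ z₁ : E6} (hz₀ : z a = z₀) (hz₁ : z b = z₁) {c : E6 → ℝ → E6}
    {A : E6 →L[ℝ] E6} (hc : ∀ w, IsParallelCoord cov p z z' (c w)) (ha : ∀ w, c w a = w)
    (hb : ∀ w, c w b = A w) :
    ∃ P : TangentSpace (𝓡 6) ((extChartAt (𝓡 6) p).symm z₀) ≃ₗ[ℝ]
        TangentSpace (𝓡 6) ((extChartAt (𝓡 6) p).symm z₁),
      IsReversibleTransport J cov P ∧ ∀ w, P (chartLift p _ w) = chartLift p _ (A w) := by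
  subst hz₀ hz₁
  obtain ⟨P, hinner, hP⟩ := exists_linearEquiv_of_isParallelCoord hJ.metric hc ha hb
  have hx := symm_mem_chart_source ((hc 0).mem_target a)
  have hlift : ∀ v, ∃ w, chartLift p _ w = v := fun v => ⟨_, chartLift_chartCoord hx v⟩
  refine ⟨P, ⟨?_, ?_, hinner, fun u => ?_, fun u₁ u₂ => ?_⟩, hP⟩
  · refine isParallelTransport_of_isParallelCoord (z' := z') hz a b _ fun u => ?_
    obtain ⟨w, rfl⟩ := hlift u
    exact ⟨c w, hc w, by rw [ha], by rw [hb]; exact (hP w).symm⟩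
  · refine isParallelTransport_of_isParallelCoord (z' := z') hz b a _ fun u => ?_
    obtain ⟨w, hw⟩ := hlift (P.symm u)
    exact ⟨c w, hc w, by rw [hb, ← hP, hw, P.apply_symm_apply], by rw [ha, hw]; rfl⟩
  · refine ext_inner_right ℝ fun v => ?_
    obtain ⟨v, rfl⟩ := P.surjective v
    obtain ⟨w, rfl⟩ := hlift v
    obtain ⟨w', rfl⟩ := hlift u
    have h := (isParallelBilin_kahler hJ).eq_of_isParallelCoord (hc w') (hc w) a b
    rw [ha, ha, hb, hb, ← hP, ← hP] at h
    exact (hinner _ _).trans h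
  · refine ext_inner_right ℝ fun v => ?_
    obtain ⟨v, rfl⟩ := P.surjective v
    obtain ⟨w, rfl⟩ := hlift v
    obtain ⟨w₁, rfl⟩ := hlift u₁
    obtain ⟨w₂, rfl⟩ := hlift u₂
    have h := (isParallelTrilin_torsion hJ.smooth hT).eq_of_isParallelCoord (hc w₁) (hc w₂) (hc w)
      a b
    rw [ha, ha, ha, hb, hb, hb, ← hP, ← hP, ← hP] at h
    exact (hinner _ _).trans h

theorem exists_isLinearFlow_isReversibleTransport [T2Space M]
    (hJ : IsCharacteristicConnection J cov) (hT : HasParallelTorsion cov) {z₀ : E6}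
    (hz₀ : z₀ ∈ (extChartAt (𝓡 6) p).target) :
    ∃ Φ, IsLinearFlow (christoffel cov p) (extChartAt (𝓡 6) p).target z₀ Φ ∧
      ∀ᶠ v in 𝓝 0, ∀ s ∈ Set.Icc (-1 : ℝ) 1,
        ∃ P : TangentSpace (𝓡 6) ((extChartAt (𝓡 6) p).symm z₀) ≃ₗ[ℝ]
            TangentSpace (𝓡 6) ((extChartAt (𝓡 6) p).symm (z₀ + s • v)),
          IsReversibleTransport J cov P ∧
          ∀ w, P (chartLift p _ w) = chartLift p _ (Φ v s w) := by
  obtain ⟨Φ, hΦ⟩ := exists_isLinearFlow (isOpen_extChartAt_target p)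
    (contDiffOn_christoffel hJ.smooth p).continuousOn hz₀
  refine ⟨Φ, hΦ, ?_⟩
  filter_upwards [hΦ.eventually_isParallelCoord, hΦ.map_zero] with v hparallel hzero s hs
  exact exists_isReversibleTransport_of_isParallelCoord hJ hT (a := 0) (b := 1)
    (contDiff_const.add ((contDiff_const.mul Real.smoothTransition.contDiff).smul contDiff_const))
    (by simp) (by simp) (hparallel s hs) (fun w => by simp [hzero]) fun w => by simp

theorem exists_isReversibleTransport [T2Space M] [ConnectedSpace M]
    (hJ : IsCharacteristicConnection J cov) (hT : HasParallelTorsion cov) (x y : M) :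
    ∃ P : TangentSpace (𝓡 6) x ≃ₗ[ℝ] TangentSpace (𝓡 6) y, IsReversibleTransport J cov P := by
  have hlocal : ∀ x : M, ∀ᶠ y in 𝓝 x, ∃ P : TangentSpace (𝓡 6) x ≃ₗ[ℝ] TangentSpace (𝓡 6) y,
      IsReversibleTransport J cov P := fun x => by
    obtain ⟨Φ, -, hP⟩ := exists_isLinearFlow_isReversibleTransport hJ hT
      (mem_extChartAt_target (I := 𝓡 6) x)
    have hsub : Filter.Tendsto (fun y => extChartAt (𝓡 6) x y - extChartAt (𝓡 6) x x) (𝓝 x)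
        (𝓝 0) := by
      simpa using (continuousAt_extChartAt (I := 𝓡 6) x).tendsto.sub_const (extChartAt (𝓡 6) x x)
    filter_upwards [hsub.eventually hP, extChartAt_source_mem_nhds (I := 𝓡 6) x] with y hy hys
    have hPy := (hy 1 (by norm_num)).imp fun _ h => h.1
    rwa [one_smul, add_sub_cancel, (extChartAt (𝓡 6) x).left_inv hys, extChartAt_to_inv x] at hPy
  refine PreconnectedSpace.induction₂' (fun x y => ∃ P : TangentSpace (𝓡 6) x ≃ₗ[ℝ]
    TangentSpace (𝓡 6) y, IsReversibleTransport J cov P) (fun x => ?_) ⟨?_⟩ x y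
  · filter_upwards [hlocal x] with y ⟨P, hP⟩
    exact ⟨⟨P, hP⟩, _, hP.symm⟩
  · rintro x y z ⟨P, hP⟩ ⟨Q, hQ⟩
    exact ⟨_, hP.trans hQ⟩

end Transport

section CovariantDerivativeInCharts

variable {E : Type*} [NormedAddCommGroup E] [NormedSpace ℝ E] {M : Type*} [TopologicalSpace M]
  [ChartedSpace E M] [IsManifold 𝓘(ℝ, E) ∞ M] {p : M} {X : (x : M) → TangentSpace 𝓘(ℝ, E) x}

theorem eventually_chartLift_chartCoord (p : M) (X : (x : M) → TangentSpace 𝓘(ℝ, E) x) :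
    ∀ᶠ x in 𝓝 p, X x = chartLift p x (chartCoord p _ (X ((extChartAt 𝓘(ℝ, E) p).symm
      (extChartAt 𝓘(ℝ, E) p x)))) := by
  filter_upwards [extChartAt_source_mem_nhds (I := 𝓘(ℝ, E)) p] with x hx
  rw [(extChartAt 𝓘(ℝ, E) p).left_inv hx, chartLift_chartCoord (by simpa using hx)]

theorem contMDiffAt_of_contDiffAt_chartCoord
    (hX : ContDiffAt ℝ ∞ (fun z => chartCoord p _ (X ((extChartAt 𝓘(ℝ, E) p).symm z)))
      (extChartAt 𝓘(ℝ, E) p p)) : CMDiffAt ∞ (T% X) p := by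
  refine (contMDiffAt_chartLift (mem_chart_source E p)
    (hX.contMDiffAt.comp p contMDiffAt_extChartAt)).congr_of_eventuallyEq ?_
  filter_upwards [eventually_chartLift_chartCoord p X] with x hx using congrArg _ hx

theorem differentiableAt_chartCoord (hX : MDiffAt (T% X) p) :
    DifferentiableAt ℝ (fun z => chartCoord p _ (X ((extChartAt 𝓘(ℝ, E) p).symm z)))
      (extChartAt 𝓘(ℝ, E) p p) := by
  have hcoord : MDiffAt (fun x => chartCoord p x (X x))
      ((extChartAt 𝓘(ℝ, E) p).symm (extChartAt 𝓘(ℝ, E) p p)) := by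
    rw [extChartAt_to_inv]
    exact (mdifferentiableAt_iff_chartCoord (mem_chart_source E p)).1 hX
  have hsymm := ((contMDiffOn_extChartAt_symm (I := 𝓘(ℝ, E)) (n := ∞) p).contMDiffAt
    ((isOpen_extChartAt_target p).mem_nhds (mem_extChartAt_target p))).mdifferentiableAt (by simp)
  exact (hcoord.comp _ hsymm).differentiableAt

theorem chartCoord_cov [FiniteDimensional ℝ E]
    {cov : CovariantDerivative 𝓘(ℝ, E) E (fun x : M => TangentSpace 𝓘(ℝ, E) x)}
    (hX : MDiffAt (T% X) p) {ξ' : E →L[ℝ] E}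
    (hξ : HasFDerivAt (fun z => chartCoord p _ (X ((extChartAt 𝓘(ℝ, E) p).symm z))) ξ'
      (extChartAt 𝓘(ℝ, E) p p)) (v : TangentSpace 𝓘(ℝ, E) p) :
    chartCoord p p (cov X p v) = ξ' (chartCoord p p v) +
      christoffel cov p (extChartAt 𝓘(ℝ, E) p p) (chartCoord p p v) (chartCoord p p (X p)) := by
  have hp := mem_chart_source E p
  have h := cov_chartLift (cov := cov) (mem_extChartAt_target (I := 𝓘(ℝ, E)) p) hξ
    (chartCoord p p v)
  rw [extChartAt_to_inv, chartLift_chartCoord hp] at h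
  rw [cov_eq_of_eventuallyEq hX (eventually_chartLift_chartCoord p X), h, chartCoord_chartLift hp]

end CovariantDerivativeInCharts

section InvariantTensors

variable {M : Type*} [TopologicalSpace M] [ChartedSpace E6 M] [IsManifold (𝓡 6) ∞ M]
  [RiemannianBundle (fun x : M => TangentSpace (𝓡 6) x)]
  {J : OrthogonalACS M} {cov : AffineConnection M} {ξ : (x : M) → TangentSpace (𝓡 6) x}
  {L : (x : M) → TangentSpace (𝓡 6) x →L[ℝ] TangentSpace (𝓡 6) x}

/-- The vector field `ξ` is preserved by the parallel transports of `cov`. -/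
def IsInvariantField (J : OrthogonalACS M) (cov : AffineConnection M)
    (ξ : (x : M) → TangentSpace (𝓡 6) x) : Prop :=
  ∀ x y (P : TangentSpace (𝓡 6) x ≃ₗ[ℝ] TangentSpace (𝓡 6) y), IsReversibleTransport J cov P →
    P (ξ x) = ξ y

/-- The field `L` of endomorphisms commutes with the parallel transports of `cov`. -/
def IsInvariantEndo (J : OrthogonalACS M) (cov : AffineConnection M)
    (L : (x : M) → TangentSpace (𝓡 6) x →L[ℝ] TangentSpace (𝓡 6) x) : Prop :=
  ∀ x y (P : TangentSpace (𝓡 6) x ≃ₗ[ℝ] TangentSpace (𝓡 6) y), IsReversibleTransport J cov P →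
    ∀ v, P (L x v) = L y (P v)

/-- The matrix of the field `L` of endomorphisms in the chart at `p`, at the point with
coordinates `z`. -/
def chartEndo (p : M) (L : (x : M) → TangentSpace (𝓡 6) x →L[ℝ] TangentSpace (𝓡 6) x) (z : E6) :
    E6 →L[ℝ] E6 :=
  (chartCoord p ((extChartAt (𝓡 6) p).symm z)).comp ((L _).comp (chartLift p _))

variable [IsContMDiffRiemannianBundle (𝓡 6) ∞ E6 (fun x : M => TangentSpace (𝓡 6) x)]
  [T2Space M]

theorem IsInvariantField.contDiffOn_chartCoord (hξ : IsInvariantField J cov ξ)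
    (hJ : IsCharacteristicConnection J cov) (hT : HasParallelTorsion cov) (p : M) :
    ContDiffOn ℝ ∞ (fun z => chartCoord p _ (ξ ((extChartAt (𝓡 6) p).symm z)))
        (extChartAt (𝓡 6) p).target ∧
      ∀ z ∈ (extChartAt (𝓡 6) p).target,
        HasFDerivAt (fun z => chartCoord p _ (ξ ((extChartAt (𝓡 6) p).symm z)))
          (-(christoffel cov p z).flip (chartCoord p _ (ξ ((extChartAt (𝓡 6) p).symm z)))) z := by
  refine IsLinearFlow.contDiffOn_of_equivariant (ρ := fun (A : E6 →L[ℝ] E6) w => A w)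
    (ρ' := (ContinuousLinearMap.id ℝ (E6 →L[ℝ] E6)).flip)
    (fun w : E6 => ((ContinuousLinearMap.id ℝ (E6 →L[ℝ] E6)).flip w).hasFDerivAt) (fun _ => rfl)
    (isOpen_extChartAt_target p) (contDiffOn_christoffel hJ.smooth p) fun z₀ hz₀ => ?_
  obtain ⟨Φ, hΦ, htransport⟩ := exists_isLinearFlow_isReversibleTransport hJ hT hz₀
  refine ⟨Φ, hΦ, ?_⟩
  filter_upwards [htransport, hΦ.line_mem] with v hv hmem s hs
  obtain ⟨P, hP, hPΦ⟩ := hv s hs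
  have h := hPΦ (chartCoord p _ (ξ ((extChartAt (𝓡 6) p).symm z₀)))
  rw [chartLift_chartCoord (symm_mem_chart_source hz₀), hξ _ _ P hP] at h
  rw [h, chartCoord_chartLift (symm_mem_chart_source
    (hmem s ⟨by linarith [hs.1], by linarith [hs.2]⟩))]

theorem IsInvariantField.contMDiff (hξ : IsInvariantField J cov ξ)
    (hJ : IsCharacteristicConnection J cov) (hT : HasParallelTorsion cov) :
    ContMDiff (𝓡 6) (𝓡 6).tangent ∞ (fun x => (⟨x, ξ x⟩ : TangentBundle (𝓡 6) M)) := fun p =>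
  contMDiffAt_of_contDiffAt_chartCoord ((hξ.contDiffOn_chartCoord hJ hT p).1.contDiffAt
    ((isOpen_extChartAt_target p).mem_nhds (mem_extChartAt_target p)))

theorem IsInvariantField.cov_eq_zero (hξ : IsInvariantField J cov ξ)
    (hJ : IsCharacteristicConnection J cov) (hT : HasParallelTorsion cov) (p : M) :
    cov ξ p = 0 := by
  ext1 v
  have h := chartCoord_cov (cov := cov) ((hξ.contMDiff hJ hT p).mdifferentiableAt (by simp))
    ((hξ.contDiffOn_chartCoord hJ hT p).2 _ (mem_extChartAt_target p)) v
  rw [extChartAt_to_inv, neg_apply, ContinuousLinearMap.flip_apply, neg_add_cancel] at h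
  rw [← chartLift_chartCoord (mem_chart_source E6 p) (cov ξ p v), h, map_zero, zero_apply]

theorem IsInvariantEndo.eventually_chartEndo_mul (hL : IsInvariantEndo J cov L)
    (hJ : IsCharacteristicConnection J cov) (hT : HasParallelTorsion cov) {p : M} {z₀ : E6}
    (hz₀ : z₀ ∈ (extChartAt (𝓡 6) p).target) :
    ∃ Φ, IsLinearFlow (christoffel cov p) (extChartAt (𝓡 6) p).target z₀ Φ ∧
      ∀ᶠ v in 𝓝 0, ∀ s ∈ Set.Icc (-1 : ℝ) 1, chartEndo p L (z₀ + s • v) =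
        Φ v s * chartEndo p L z₀ * Ring.inverse (Φ v s) := by
  obtain ⟨Φ, hΦ, htransport⟩ := exists_isLinearFlow_isReversibleTransport hJ hT hz₀
  refine ⟨Φ, hΦ, ?_⟩
  filter_upwards [htransport, hΦ.line_mem] with v hv hmem s hs
  obtain ⟨P, hP, hPΦ⟩ := hv s hs
  have hx₀ := symm_mem_chart_source hz₀
  have hx := symm_mem_chart_source (hmem s ⟨by linarith [hs.1], by linarith [hs.2]⟩)
  have hΦP : ∀ w, Φ v s w = chartCoord p _ (P (chartLift p _ w)) := fun w => by
    rw [hPΦ, chartCoord_chartLift hx]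
  have hunit : IsUnit (Φ v s) := by
    have hinj : Function.Injective (Φ v s) := fun w w' hw => by
      have h := P.injective ((hPΦ w).trans ((congrArg _ hw).trans (hPΦ w').symm))
      rw [← chartCoord_chartLift hx₀ w, h, chartCoord_chartLift hx₀]
    rw [ContinuousLinearMap.isUnit_iff_bijective]
    exact ⟨hinj, (LinearMap.injective_iff_surjective (f := (Φ v s).toLinearMap)).1 hinj⟩
  have hcomm : chartEndo p L (z₀ + s • v) * Φ v s = Φ v s * chartEndo p L z₀ := by
    ext1 w
    change chartCoord p _ (L _ (chartLift p _ (Φ v s w))) =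
      Φ v s (chartCoord p _ (L _ (chartLift p _ w)))
    rw [← hPΦ, ← hL _ _ P hP, hΦP, chartLift_chartCoord hx₀]
  rw [← hcomm, mul_assoc, Ring.mul_inverse_cancel _ hunit, mul_one]

theorem IsInvariantEndo.contDiffOn_chartEndo (hL : IsInvariantEndo J cov L)
    (hJ : IsCharacteristicConnection J cov) (hT : HasParallelTorsion cov) (p : M) :
    ContDiffOn ℝ ∞ (chartEndo p L) (extChartAt (𝓡 6) p).target ∧
      ∀ z ∈ (extChartAt (𝓡 6) p).target, ∃ ψ' : E6 →L[ℝ] E6 →L[ℝ] E6,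
        HasFDerivAt (chartEndo p L) ψ' z ∧ ∀ v, ψ' v =
          chartEndo p L z * christoffel cov p z v - christoffel cov p z v * chartEndo p L z :=
  IsLinearFlow.contDiffOn_of_conj (isOpen_extChartAt_target p)
    (contDiffOn_christoffel hJ.smooth p) fun _ => hL.eventually_chartEndo_mul hJ hT

theorem IsInvariantEndo.contMDiff (hL : IsInvariantEndo J cov L)
    (hJ : IsCharacteristicConnection J cov) (hT : HasParallelTorsion cov) :
    ContMDiff (𝓡 6) ((𝓡 6).prod 𝓘(ℝ, E6 →L[ℝ] E6)) ∞ (fun x => TotalSpace.mk' (E6 →L[ℝ] E6)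
      (E := fun x : M => TangentSpace (𝓡 6) x →L[ℝ] TangentSpace (𝓡 6) x) x (L x)) := by
  intro p
  have hcoord := ((hL.contDiffOn_chartEndo hJ hT p).1.contDiffAt
    ((isOpen_extChartAt_target p).mem_nhds (mem_extChartAt_target p))).contMDiffAt.comp p
      (contMDiffAt_extChartAt (I := 𝓡 6) (n := ∞))
  refine (Trivialization.contMDiffAt_section_iff (s := L) (trivializationAt (E6 →L[ℝ] E6)
    (fun x : M => TangentSpace (𝓡 6) x →L[ℝ] TangentSpace (𝓡 6) x) p)
    (mem_baseSet_trivializationAt _ _ p)).2 (hcoord.congr_of_eventuallyEq ?_)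
  filter_upwards [extChartAt_source_mem_nhds (I := 𝓡 6) p] with x hx
  rw [hom_trivializationAt_apply, Function.comp_apply, chartEndo,
    (extChartAt (𝓡 6) p).left_inv hx]
  rfl

theorem IsInvariantEndo.cov_apply (hL : IsInvariantEndo J cov L)
    (hJ : IsCharacteristicConnection J cov) (hT : HasParallelTorsion cov) {p : M}
    {Y : (x : M) → TangentSpace (𝓡 6) x} (hY : IsDiffAt Y p) (v : TangentSpace (𝓡 6) p) :
    cov (fun x => L x (Y x)) p v = L p (cov Y p v) := by
  have hp := mem_chart_source E6 p
  have hLY : IsDiffAt (fun x => L x (Y x)) p :=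
    MDifferentiableAt.clm_bundle_apply ((hL.contMDiff hJ hT p).mdifferentiableAt (by simp)) hY
  obtain ⟨ψ', hψ, hψ'⟩ := (hL.contDiffOn_chartEndo hJ hT p).2 _ (mem_extChartAt_target p)
  have hη := (differentiableAt_chartCoord hY).hasFDerivAt
  have hLη := (hψ.clm_apply hη).congr_of_eventuallyEq
    (f₁ := fun z => chartCoord p _ (L _ (Y ((extChartAt (𝓡 6) p).symm z)))) <| by
    filter_upwards [(isOpen_extChartAt_target p).mem_nhds (mem_extChartAt_target p)] with z hz
    change _ = chartCoord p _ (L _ (chartLift p _ (chartCoord p _ (Y _))))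
    rw [chartLift_chartCoord (symm_mem_chart_source hz)]
  have hψp : ∀ w, chartEndo p L (extChartAt (𝓡 6) p p) (chartCoord p p w) =
      chartCoord p p (L p w) := fun w => by
    rw [chartEndo, extChartAt_to_inv]
    change chartCoord p p (L p (chartLift p p (chartCoord p p w))) = _
    rw [chartLift_chartCoord hp]
  have hcov : chartCoord p p (cov (fun x => L x (Y x)) p v) =
      chartCoord p p (L p (cov Y p v)) := by
    rw [chartCoord_cov hLY hLη, ← hψp (cov Y p v), chartCoord_cov hY hη]
    rw [extChartAt_to_inv]
    simp [-extChartAt, hψ', hψp]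
    abel
  rw [← chartLift_chartCoord hp (cov (fun x => L x (Y x)) p v), hcov, chartLift_chartCoord hp]

end InvariantTensors

section Curvature

variable {M : Type*} [TopologicalSpace M] [ChartedSpace E6 M] [IsManifold (𝓡 6) ∞ M]
  {cov : AffineConnection M} {ξ η X : (x : M) → TangentSpace (𝓡 6) x}

theorem contMDiff_cov [T2Space M] (hcov : cov.ContMDiffCovariantDerivative ∞)
    (hX : ContMDiff (𝓡 6) (𝓡 6).tangent ∞ (fun x => (⟨x, X x⟩ : TangentBundle (𝓡 6) M)))
    (hξ : ContMDiff (𝓡 6) (𝓡 6).tangent ∞ (fun x => (⟨x, ξ x⟩ : TangentBundle (𝓡 6) M))) :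
    ContMDiff (𝓡 6) (𝓡 6).tangent ∞
      (fun x => (⟨x, cov X x (ξ x)⟩ : TangentBundle (𝓡 6) M)) := fun x =>
  (contMDiffAt_cov hcov isOpen_univ hX.contMDiffOn (Set.mem_univ x)).clm_bundle_apply (hξ x)

variable [RiemannianBundle (fun x : M => TangentSpace (𝓡 6) x)] {J : OrthogonalACS M}

theorem IsInvariantField.isInvariantEndo_torsion (hξ : IsInvariantField J cov ξ) :
    IsInvariantEndo J cov fun x => cov.torsion x (ξ x) := fun x y P hP v => by
  rw [hP.map_torsion, hξ x y P hP]

variable [IsContMDiffRiemannianBundle (𝓡 6) ∞ E6 (fun x : M => TangentSpace (𝓡 6) x)] [T2Space M]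

theorem IsInvariantField.mlieBracket_eq (hξ : IsInvariantField J cov ξ)
    (hJ : IsCharacteristicConnection J cov) (hT : HasParallelTorsion cov) {x : M}
    (hX : IsDiffAt X x) :
    VectorField.mlieBracket (𝓡 6) ξ X x = cov X x (ξ x) - cov.torsion x (ξ x) (X x) := by
  have hξx : IsDiffAt ξ x := (hξ.contMDiff hJ hT x).mdifferentiableAt (by simp)
  rw [cov.torsion_apply hξx hX, hξ.cov_eq_zero hJ hT, zero_apply]
  abel

theorem IsInvariantField.mlieBracket_mlieBracket_eq (hξ : IsInvariantField J cov ξ)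
    (hη : IsInvariantField J cov η) (hJ : IsCharacteristicConnection J cov)
    (hT : HasParallelTorsion cov)
    (hX : ContMDiff (𝓡 6) (𝓡 6).tangent ∞ (fun x => (⟨x, X x⟩ : TangentBundle (𝓡 6) M)))
    (x : M) :
    VectorField.mlieBracket (𝓡 6) ξ (VectorField.mlieBracket (𝓡 6) η X) x =
      cov (fun y => cov X y (η y)) x (ξ x) - cov.torsion x (η x) (cov X x (ξ x)) -
        (cov.torsion x (ξ x) (cov X x (η x)) -
          cov.torsion x (ξ x) (cov.torsion x (η x) (X x))) := by
  have hXd : ∀ y, IsDiffAt X y := fun y => (hX y).mdifferentiableAt (by simp)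
  have hcov : IsDiffAt (fun y => cov X y (η y)) x :=
    (contMDiff_cov hJ.smooth hX (hη.contMDiff hJ hT) x).mdifferentiableAt (by simp)
  have htors : IsDiffAt (fun y => cov.torsion y (η y) (X y)) x :=
    ((hη.isInvariantEndo_torsion.contMDiff hJ hT x).clm_bundle_apply (hX x)).mdifferentiableAt
      (by simp)
  have hbracket : VectorField.mlieBracket (𝓡 6) η X =
      fun y => cov X y (η y) - cov.torsion y (η y) (X y) :=
    funext fun y => hη.mlieBracket_eq hJ hT (hXd y)
  have hdiff := mdifferentiableAt_sub_section hcov htors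
  have hsub : cov (fun y => cov X y (η y) - cov.torsion y (η y) (X y)) x =
      cov (fun y => cov X y (η y)) x - cov (fun y => cov.torsion y (η y) (X y)) x := by
    have hadd := cov.isCovariantDerivativeOnUniv.add hdiff htors
    rw [sub_add_cancel] at hadd
    exact eq_sub_of_add_eq hadd.symm
  rw [hbracket, hξ.mlieBracket_eq (X := fun y => cov X y (η y) - cov.torsion y (η y) (X y))
    hJ hT hdiff, hsub, sub_apply, hη.isInvariantEndo_torsion.cov_apply hJ hT (hXd x), map_sub]

theorem IsInvariantField.cov_cov_sub_cov_cov (hξ : IsInvariantField J cov ξ)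
    (hη : IsInvariantField J cov η) (hJ : IsCharacteristicConnection J cov)
    (hT : HasParallelTorsion cov) (hξη : ∀ x, cov.torsion x (ξ x) (η x) = 0)
    (hX : ContMDiff (𝓡 6) (𝓡 6).tangent ∞ (fun x => (⟨x, X x⟩ : TangentBundle (𝓡 6) M)))
    (x : M) :
    cov (fun y => cov X y (η y)) x (ξ x) - cov (fun y => cov X y (ξ y)) x (η x) =
      cov.torsion x (η x) (cov.torsion x (ξ x) (X x)) -
        cov.torsion x (ξ x) (cov.torsion x (η x) (X x)) := by
  have : IsManifold (𝓡 6) (minSmoothness ℝ 3) M := by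
    simpa using (inferInstance : IsManifold (𝓡 6) 3 M)
  have hbracket : VectorField.mlieBracket (𝓡 6) ξ η = 0 := funext fun y => by
    rw [hξ.mlieBracket_eq hJ hT ((hη.contMDiff hJ hT y).mdifferentiableAt (by simp)),
      hη.cov_eq_zero hJ hT, hξη, zero_apply, sub_zero]
    rfl
  have hle : minSmoothness ℝ 2 ≤ ∞ := by
    simpa using (by exact_mod_cast le_top : ((2 : ℕ∞) : ℕ∞ω) ≤ ∞)
  have hjacobi := VectorField.leibniz_identity_mlieBracket_apply (I := 𝓡 6)
    ((hξ.contMDiff hJ hT x).of_le hle) ((hη.contMDiff hJ hT x).of_le hle) ((hX x).of_le hle)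
  rw [hξ.mlieBracket_mlieBracket_eq hη hJ hT hX, hη.mlieBracket_mlieBracket_eq hξ hJ hT hX,
    hbracket, VectorField.mlieBracket_zero_left, Pi.zero_apply, zero_add] at hjacobi
  rw [← sub_eq_zero] at hjacobi ⊢
  rw [← hjacobi]
  abel

theorem IsInvariantField.torsion_commutator_comm (hξ : IsInvariantField J cov ξ)
    (hη : IsInvariantField J cov η) (hJ : IsCharacteristicConnection J cov)
    (hT : HasParallelTorsion cov) (hξη : ∀ x, cov.torsion x (ξ x) (η x) = 0)
    {L : (x : M) → TangentSpace (𝓡 6) x →L[ℝ] TangentSpace (𝓡 6) x}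
    (hL : IsInvariantEndo J cov L) (x : M) (v : TangentSpace (𝓡 6) x) :
    cov.torsion x (η x) (cov.torsion x (ξ x) (L x v)) -
        cov.torsion x (ξ x) (cov.torsion x (η x) (L x v)) =
      L x (cov.torsion x (η x) (cov.torsion x (ξ x) v) -
        cov.torsion x (ξ x) (cov.torsion x (η x) v)) := by
  obtain ⟨X, hX, hXv⟩ := exists_contMDiff_eventuallyEq (chartAt E6 x).open_source
    (contMDiffOn_chartLift_const x (chartCoord x x v)) (mem_chart_source E6 x)
  have hXx : X x = v := by
    rw [← hXv.self_of_nhds, chartLift_chartCoord (mem_chart_source E6 x)]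
  have hLX : ContMDiff (𝓡 6) (𝓡 6).tangent ∞
      (fun x => (⟨x, L x (X x)⟩ : TangentBundle (𝓡 6) M)) := fun y =>
    (hL.contMDiff hJ hT y).clm_bundle_apply (hX y)
  have hcov : ∀ {ζ : (x : M) → TangentSpace (𝓡 6) x}, IsInvariantField J cov ζ →
      IsDiffAt (fun y => cov X y (ζ y)) x := fun hζ =>
    (contMDiff_cov hJ.smooth hX (hζ.contMDiff hJ hT) x).mdifferentiableAt (by simp)
  have hcurv := hξ.cov_cov_sub_cov_cov hη hJ hT hξη hX x
  have hcurvL := hξ.cov_cov_sub_cov_cov hη hJ hT hξη hLX x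
  simp only [hL.cov_apply hJ hT ((hX _).mdifferentiableAt (by simp)),
    hL.cov_apply hJ hT (hcov hξ), hL.cov_apply hJ hT (hcov hη)] at hcurvL
  rw [hXx] at hcurv hcurvL
  rw [← hcurvL, ← hcurv, map_sub]

end Curvature

section Quaternions

open scoped Quaternion

/-- The imaginary quaternion `a i + b j + c k`. -/
def imQuat (a b c : ℝ) : ℍ[ℝ] := ⟨0, a, b, c⟩

@[simp] theorem imQuat_re (a b c : ℝ) : (imQuat a b c).re = 0 := rfl

@[simp] theorem imQuat_imI (a b c : ℝ) : (imQuat a b c).imI = a := rfl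

@[simp] theorem imQuat_imJ (a b c : ℝ) : (imQuat a b c).imJ = b := rfl

@[simp] theorem imQuat_imK (a b c : ℝ) : (imQuat a b c).imK = c := rfl

theorem imQuat_mul_self {a b c : ℝ} (h : a ^ 2 + b ^ 2 + c ^ 2 = 1) :
    imQuat a b c * imQuat a b c = -1 := by
  ext <;> simp
  · linear_combination -h
  all_goals ring

theorem exists_imQuat_eq_of_mul_self {u : ℍ[ℝ]} (hu : u * u = -1) :
    ∃ a b c : ℝ, a ^ 2 + b ^ 2 + c ^ 2 = 1 ∧ imQuat a b c = u := by
  have hre := congrArg (·.re) hu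
  have hI := congrArg (·.imI) hu
  have hJ := congrArg (·.imJ) hu
  have hK := congrArg (·.imK) hu
  simp only [Quaternion.re_mul, Quaternion.imI_mul, Quaternion.imJ_mul, Quaternion.imK_mul,
    Quaternion.re_neg, Quaternion.imI_neg, Quaternion.imJ_neg, Quaternion.imK_neg,
    Quaternion.re_one, Quaternion.imI_one, Quaternion.imJ_one, Quaternion.imK_one] at hre hI hJ hK
  have h0 : u.re = 0 := by
    by_contra h
    have := mul_self_nonneg u.re
    have hI' : u.imI = 0 := by grind
    have hJ' : u.imJ = 0 := by grind
    have hK' : u.imK = 0 := by grind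
    rw [hI', hJ', hK'] at hre
    linarith
  refine ⟨u.imI, u.imJ, u.imK, ?_, by ext <;> simp [h0]⟩
  rw [h0] at hre
  linear_combination -hre

theorem commute_of_commutator_central {a b : ℍ[ℝ]} (h : ∀ p, Commute (a * b - b * a) p) :
    Commute a b := by
  have hi := (h (imQuat 1 0 0)).eq
  have hj := (h (imQuat 0 1 0)).eq
  have hiJ := congrArg (·.imJ) hi
  have hiK := congrArg (·.imK) hi
  have hjK := congrArg (·.imK) hj
  simp at hiJ hiK hjK
  ext <;> simp <;> linarith

theorem exists_eq_smul_of_star_eq_neg {a : ℍ[ℝ]} (ha : star a = -a) :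
    ∃ (u : ℍ[ℝ]) (s : ℝ), u * u = -1 ∧ a = s • u := by
  rcases eq_or_ne a 0 with rfl | ha0
  · exact ⟨imQuat 1 0 0, 0, imQuat_mul_self (by norm_num), by simp⟩
  have hn : ‖a‖ ≠ 0 := norm_ne_zero_iff.2 ha0
  have haa : a * a = -((‖a‖ * ‖a‖ : ℝ) : ℍ[ℝ]) := by
    rw [← Quaternion.normSq_eq_norm_mul_self, ← Quaternion.self_mul_star, ha, mul_neg, neg_neg]
  refine ⟨‖a‖⁻¹ • a, ‖a‖, ?_, by rw [smul_smul, mul_inv_cancel₀ hn, one_smul]⟩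
  rw [smul_mul_smul_comm, haa, smul_neg, ← Quaternion.coe_smul, smul_eq_mul]
  field_simp
  simp

theorem exists_eq_smul_of_commute_of_mul_self {u b : ℍ[ℝ]} (hu : u * u = -1) (hb : star b = -b)
    (h : Commute u b) : ∃ t : ℝ, b = t • u := by
  have hstar : star u = -u := by
    obtain ⟨x, y, z, -, rfl⟩ := exists_imQuat_eq_of_mul_self hu
    exact Quaternion.star_eq_neg.2 rfl
  have hreal : u * b = (u * b).re := Quaternion.star_eq_self.1 <| by
    rw [star_mul, hb, hstar, neg_mul_neg, h.eq]
  refine ⟨-(u * b).re, ?_⟩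
  calc b = -(u * (u * b)) := by rw [← mul_assoc, hu, neg_one_mul, neg_neg]
    _ = -(u * b).re • u := by rw [hreal, Quaternion.mul_coe_eq_smul, neg_smul, Quaternion.re_coe]

theorem exists_eq_smul_of_commute {a b : ℍ[ℝ]} (ha : star a = -a) (hb : star b = -b)
    (h : Commute a b) : ∃ (u : ℍ[ℝ]) (s t : ℝ), u * u = -1 ∧ a = s • u ∧ b = t • u := by
  obtain ⟨u, s, hu, rfl⟩ := exists_eq_smul_of_star_eq_neg ha
  rcases eq_or_ne s 0 with rfl | hs
  · obtain ⟨v, t, hv, rfl⟩ := exists_eq_smul_of_star_eq_neg hb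
    exact ⟨v, 0, t, hv, by simp, rfl⟩
  · have huv : Commute u b := by simpa [smul_smul, hs] using h.smul_left s⁻¹
    obtain ⟨t, rfl⟩ := exists_eq_smul_of_commute_of_mul_self hu hb huv
    exact ⟨u, s, t, hu, rfl, rfl⟩

theorem exists_semiconjBy_I {u : ℍ[ℝ]} (hu : u * u = -1) :
    ∃ p ≠ 0, SemiconjBy p u (imQuat 1 0 0) := by
  have hI : imQuat 1 0 0 * imQuat 1 0 0 = -1 := imQuat_mul_self (by norm_num)
  by_cases h : u + imQuat 1 0 0 = 0
  · refine ⟨imQuat 0 1 0, fun h0 => by simpa using congrArg (·.imJ) h0, ?_⟩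
    rw [eq_neg_of_add_eq_zero_left h]
    ext <;> simp
  · exact ⟨u + imQuat 1 0 0, h, by rw [SemiconjBy, add_mul, mul_add, hu, hI, add_comm]⟩

theorem exists_semiconjBy_commute {u x y : ℍ[ℝ]} (hu : u ≠ 0) (hxy : x * x = y * y)
    (hx : u * x = -(x * u)) (hy : u * y = -(y * u)) :
    ∃ p ≠ 0, SemiconjBy p x y ∧ Commute p u := by
  by_cases h : x + y = 0
  · refine ⟨u, hu, ?_, Commute.refl u⟩
    rw [SemiconjBy, hx, eq_neg_of_add_eq_zero_right h, neg_mul]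
  have hx0 : x ≠ 0 := by
    rintro rfl
    exact h (by simpa using hxy.symm)
  have hsum : (x + y) * u = -(u * (x + y)) := by rw [add_mul, mul_add, hx, hy]; abel
  refine ⟨(x + y) * x, mul_ne_zero h hx0, ?_, ?_⟩
  · rw [SemiconjBy, ← mul_assoc y, mul_add, ← hxy, ← add_mul, add_comm y x, mul_assoc]
  · rw [Commute, SemiconjBy, ← mul_assoc u, ← neg_eq_iff_eq_neg.2 hsum, neg_mul, mul_assoc,
      mul_assoc, hx, mul_neg, neg_neg]

theorem exists_mul_self_semiconjBy {p u : ℍ[ℝ]} (hp : p ≠ 0) (hu : u * u = -1) :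
    ∃ v : ℍ[ℝ], v * v = -1 ∧ SemiconjBy p u v := by
  have h : SemiconjBy p u (p * u * p⁻¹) := by rw [SemiconjBy, inv_mul_cancel_right₀ hp]
  refine ⟨_, mul_right_cancel₀ hp ?_, h⟩
  rw [← (h.mul_right h).eq, hu, mul_neg_one, neg_one_mul]

/-- A rotation taking `u` to `i` leaves the freedom of rotating the `jk`-plane, which puts the
component of `v` orthogonal to `u` on the `k`-axis. -/
theorem exists_semiconjBy_pair {u v : ℍ[ℝ]} (hu : u * u = -1) (hv : v * v = -1) {c : ℝ}
    (hc : c ^ 2 ≤ 1) (huv : u * v + v * u = ((-2 * c : ℝ) : ℍ[ℝ])) :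
    ∃ p : ℍ[ℝ], ‖p‖ = 1 ∧ SemiconjBy p u (imQuat 1 0 0) ∧
      SemiconjBy p v (imQuat c 0 (√(1 - c ^ 2))) := by
  set I := imQuat 1 0 0 with hI
  obtain ⟨p, hp, hpu⟩ := exists_semiconjBy_I hu
  obtain ⟨w, hw, hpv⟩ := exists_mul_self_semiconjBy hp hv
  obtain ⟨a, b, d, habd, rfl⟩ := exists_imQuat_eq_of_mul_self hw
  obtain rfl : a = c := by
    have h : I * imQuat a b d + imQuat a b d * I = ((-2 * c : ℝ) : ℍ[ℝ]) :=
      mul_right_cancel₀ hp <| by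
        rw [← ((hpu.mul_right hpv).add_right (hpv.mul_right hpu)).eq, huv, Quaternion.coe_commutes]
    have hre := congrArg (·.re) h
    simp [hI] at hre
    linarith
  have hsq : √(1 - a ^ 2) ^ 2 = 1 - a ^ 2 := Real.sq_sqrt (by linarith)
  obtain ⟨m, hm, hmv, hmI⟩ := exists_semiconjBy_commute (u := I) (x := imQuat 0 b d)
    (y := imQuat 0 0 √(1 - a ^ 2)) (fun h => by simpa [hI] using congrArg (·.imI) h)
    (by ext <;> simp <;> linarith) (by ext <;> simp [hI]) (by ext <;> simp [hI])
  have hmv' : SemiconjBy m (imQuat a b d) (imQuat a 0 √(1 - a ^ 2)) := by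
    have hadd : ∀ y z, imQuat a y z = a • I + imQuat 0 y z := fun y z => by ext <;> simp [hI]
    rw [hadd, hadd]
    exact SemiconjBy.add_right (hmI.smul_right a) hmv
  have hnormalize : ∀ x y, SemiconjBy (m * p) x y → SemiconjBy (‖m * p‖⁻¹ • (m * p)) x y :=
    fun x y h => by rw [SemiconjBy, smul_mul_assoc, mul_smul_comm, h.eq]
  exact ⟨‖m * p‖⁻¹ • (m * p), norm_smul_inv_norm (mul_ne_zero hm hp),
    hnormalize _ _ (SemiconjBy.mul_left hmI hpu), hnormalize _ _ (hmv'.mul_left hpv)⟩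

end Quaternions

section QuatModel

open scoped Quaternion

/-- The model `ℍ ⊕ ℂ` of a six-dimensional Euclidean space with an orthonormal frame: the first
four vectors of the frame correspond to `1, i, j, k ∈ ℍ`, the last two to `1, i ∈ ℂ`. -/
abbrev QuatModel : Type := WithLp 2 (ℍ[ℝ] × ℂ)

/-- The coordinates on `ℍ ⊕ ℂ` with respect to the frame `1, i, j, k, 1, i`. -/
def quatCoord : QuatModel ≃ₗᵢ[ℝ] E6 where
  toFun w := !₂[w.fst.re, w.fst.imI, w.fst.imJ, w.fst.imK, w.snd.re, w.snd.im]
  invFun v := WithLp.toLp 2 (⟨v 0, v 1, v 2, v 3⟩, ⟨v 4, v 5⟩)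
  map_add' v w := by ext i; fin_cases i <;> simp
  map_smul' c w := by ext i; fin_cases i <;> simp
  left_inv _ := rfl
  right_inv v := by ext i; fin_cases i <;> rfl
  norm_map' w := by
    rw [← sq_eq_sq₀ (norm_nonneg _) (norm_nonneg _), EuclideanSpace.real_norm_sq_eq,
      WithLp.prod_norm_sq_eq_of_L2, sq ‖w.fst‖, ← Quaternion.normSq_eq_norm_mul_self,
      Quaternion.normSq_def', Complex.sq_norm, Complex.normSq_apply, Fin.sum_univ_six]
    change w.fst.re ^ 2 + w.fst.imI ^ 2 + w.fst.imJ ^ 2 + w.fst.imK ^ 2 + w.snd.re ^ 2 +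
      w.snd.im ^ 2 = _
    ring

/-- The endomorphism `(x, w) ↦ (p x, z w)` of `ℍ ⊕ ℂ`. -/
def leftMul (p : ℍ[ℝ]) (z : ℂ) : QuatModel →L[ℝ] QuatModel :=
  ((WithLp.prodContinuousLinearEquiv 2 ℝ ℍ[ℝ] ℂ).symm.toContinuousLinearMap.comp
    ((ContinuousLinearMap.mul ℝ ℍ[ℝ] p).prodMap (ContinuousLinearMap.mul ℝ ℂ z))).comp
    (WithLp.prodContinuousLinearEquiv 2 ℝ ℍ[ℝ] ℂ).toContinuousLinearMap

theorem leftMul_fst (p : ℍ[ℝ]) (z : ℂ) (w : QuatModel) : (leftMul p z w).fst = p * w.fst := rfl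

theorem leftMul_snd (p : ℍ[ℝ]) (z : ℂ) (w : QuatModel) : (leftMul p z w).snd = z * w.snd := rfl

/-- For a unit quaternion `q`, the isometry `(x, w) ↦ (x q, w)` of `ℍ ⊕ ℂ`. In complex coordinates
on `ℍ`, these are the transformations in `SU(2)`. -/
def rightMul (q : ℍ[ℝ]) : QuatModel →ₗ[ℝ] QuatModel where
  toFun w := WithLp.toLp 2 (w.fst * q, w.snd)
  map_add' _ _ := congrArg (WithLp.toLp 2) (Prod.ext (add_mul _ _ _) rfl)
  map_smul' _ _ := congrArg (WithLp.toLp 2) (Prod.ext (smul_mul_assoc _ _ _) rfl)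

theorem rightMul_fst (q : ℍ[ℝ]) (w : QuatModel) : (rightMul q w).fst = w.fst * q := rfl

theorem rightMul_snd (q : ℍ[ℝ]) (w : QuatModel) : (rightMul q w).snd = w.snd := rfl

/-- The 3-form `⟨a ·, ·⟩ ∧ ⟨ζ, ·⟩` on `ℍ ⊕ ℂ` (for an imaginary quaternion `a`). -/
def wedgeForm (a : ℍ[ℝ]) (ζ : ℂ) (X Y Z : QuatModel) : ℝ :=
  inner ℝ (a * X.fst) Y.fst * inner ℝ ζ Z.snd + inner ℝ (a * Y.fst) Z.fst * inner ℝ ζ X.snd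
    + inner ℝ (a * Z.fst) X.fst * inner ℝ ζ Y.snd

theorem inner_mul_left_skew {a : ℍ[ℝ]} (ha : star a = -a) (x y : ℍ[ℝ]) :
    (inner ℝ (a * x) y : ℝ) = -inner ℝ (a * y) x := by
  have ha0 := Quaternion.star_eq_neg.1 ha
  simp [Quaternion.inner_def, ha0]
  ring

theorem inner_mul_right {q : ℍ[ℝ]} (hq : ‖q‖ = 1) (x y : ℍ[ℝ]) :
    (inner ℝ (x * q) (y * q) : ℝ) = inner ℝ x y := by
  rw [Quaternion.inner_def, Quaternion.inner_def, star_mul, mul_assoc, ← mul_assoc q,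
    Quaternion.self_mul_star, Quaternion.normSq_eq_norm_mul_self, hq]
  simp

/-- Moving `x` to `1` by a right multiplication reduces `B x` to the functional `B 1`. -/
theorem exists_eq_inner_mul_of_rightInvariant {B : ℍ[ℝ] →ₗ[ℝ] ℍ[ℝ] →ₗ[ℝ] ℝ} (hB₁ : B 1 1 = 0)
    (hB : ∀ q : ℍ[ℝ], ‖q‖ = 1 → ∀ x y, B (x * q) (y * q) = B x y) :
    ∃ a : ℍ[ℝ], star a = -a ∧ ∀ x y, B x y = inner ℝ (a * x) y := by
  set a := (InnerProductSpace.toDual ℝ ℍ[ℝ]).symm (B 1).toContinuousLinearMap with ha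
  have hinner : ∀ y, (inner ℝ a y : ℝ) = B 1 y := fun y => by
    rw [ha, InnerProductSpace.toDual_symm_apply]
    rfl
  refine ⟨a, ?_, fun x y => ?_⟩
  · refine Quaternion.star_eq_neg.2 ?_
    simpa [Quaternion.inner_def, hB₁] using hinner 1
  rcases eq_or_ne x 0 with rfl | hx
  · simp
  have hn : ‖x‖ ≠ 0 := norm_ne_zero_iff.2 hx
  have hx1 : x * (‖x‖⁻¹ • star x) = ‖x‖ • 1 := by
    rw [mul_smul_comm, Quaternion.self_mul_star, Quaternion.normSq_eq_norm_mul_self,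
      ← Quaternion.coe_smul, smul_eq_mul, inv_mul_cancel_left₀ hn, ← Quaternion.coe_mul_eq_smul,
      mul_one]
  calc B x y = B (x * (‖x‖⁻¹ • star x)) (y * (‖x‖⁻¹ • star x)) :=
        (hB _ (by rw [norm_smul, norm_star, norm_inv, norm_norm, inv_mul_cancel₀ hn]) x y).symm
    _ = B 1 (y * star x) := by
        rw [hx1, mul_smul_comm, map_smul, map_smul, LinearMap.smul_apply, smul_smul,
          inv_mul_cancel₀ hn, one_smul]
    _ = inner ℝ (a * x) y := by
        rw [← hinner, Quaternion.inner_def, Quaternion.inner_def, star_mul, star_star, mul_assoc]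

/-- The inclusion of `ℍ` in `ℍ ⊕ ℂ`. -/
def inQuat : ℍ[ℝ] →ₗ[ℝ] QuatModel :=
  (WithLp.linearEquiv 2 ℝ (ℍ[ℝ] × ℂ)).symm.toLinearMap ∘ₗ LinearMap.inl ℝ ℍ[ℝ] ℂ

/-- The inclusion of `ℂ` in `ℍ ⊕ ℂ`. -/
def inComplex : ℂ →ₗ[ℝ] QuatModel :=
  (WithLp.linearEquiv 2 ℝ (ℍ[ℝ] × ℂ)).symm.toLinearMap ∘ₗ LinearMap.inr ℝ ℍ[ℝ] ℂ

theorem inComplex_eq (w : ℂ) :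
    inComplex w = w.re • inComplex 1 + w.im • inComplex Complex.I := by
  rw [← map_smul, ← map_smul, ← map_add]
  simp [Complex.re_add_im]

theorem inQuat_fst_add_inComplex_snd (w : QuatModel) : inQuat w.fst + inComplex w.snd = w :=
  congrArg (WithLp.toLp 2) (Prod.ext (add_zero _) (zero_add _))

theorem rightMul_inQuat (q x : ℍ[ℝ]) : rightMul q (inQuat x) = inQuat (x * q) := rfl

theorem rightMul_inComplex (q : ℍ[ℝ]) (w : ℂ) : rightMul q (inComplex w) = inComplex w :=
  congrArg (WithLp.toLp 2) (Prod.ext (zero_mul q) rfl)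

section InvariantForms

variable {T : QuatModel →ₗ[ℝ] QuatModel →ₗ[ℝ] QuatModel →ₗ[ℝ] ℝ}
  (hs : ∀ X Y Z, T X Y Z = -T Y X Z) (hs' : ∀ X Y Z, T X Y Z = -T X Z Y)
  (hT : ∀ q : ℍ[ℝ], ‖q‖ = 1 → ∀ X Y Z, T (rightMul q X) (rightMul q Y) (rightMul q Z) = T X Y Z)

include hT in
theorem trilin_inQuat_eq_zero (x y z : ℍ[ℝ]) : T (inQuat x) (inQuat y) (inQuat z) = 0 := by
  have h := hT (-1) (by simp) (inQuat x) (inQuat y) (inQuat z)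
  simp only [rightMul_inQuat, mul_neg_one, map_neg, LinearMap.neg_apply] at h
  linarith

include hT in
theorem trilin_inQuat_inComplex_eq_zero (x : ℍ[ℝ]) (w w' : ℂ) :
    T (inQuat x) (inComplex w) (inComplex w') = 0 := by
  have h := hT (-1) (by simp) (inQuat x) (inComplex w) (inComplex w')
  simp only [rightMul_inQuat, rightMul_inComplex, mul_neg_one, map_neg, LinearMap.neg_apply] at h
  linarith

include hs hs' in
theorem trilin_inComplex_eq_zero (w w' w'' : ℂ) :
    T (inComplex w) (inComplex w') (inComplex w'') = 0 := by
  have h₁ : ∀ X Z, T X X Z = 0 := fun X Z => by linarith [hs X X Z]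
  have h₂ : ∀ X Z, T Z X X = 0 := fun X Z => by linarith [hs' Z X X]
  have h₃ : ∀ X Z, T X Z X = 0 := fun X Z => by rw [hs', h₁, neg_zero]
  rw [inComplex_eq w, inComplex_eq w', inComplex_eq w'']
  simp [h₁, h₂, h₃]

include hs hT in
theorem exists_trilin_inQuat_inQuat_eq (w : ℂ) : ∃ a : ℍ[ℝ], star a = -a ∧
    ∀ x y, T (inQuat x) (inQuat y) (inComplex w) = inner ℝ (a * x) y := by
  refine exists_eq_inner_mul_of_rightInvariant
    (B := (T.compl₁₂ inQuat inQuat).compr₂ (LinearMap.applyₗ (inComplex w))) ?_ ?_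
  · change T (inQuat 1) (inQuat 1) (inComplex w) = 0
    linarith [hs (inQuat 1) (inQuat 1) (inComplex w)]
  · intro q hq x y
    have h := hT q hq (inQuat x) (inQuat y) (inComplex w)
    rwa [rightMul_inQuat, rightMul_inQuat, rightMul_inComplex] at h

include hs hs' hT in
/-- An `SU(2)`-invariant 3-form on `ℍ ⊕ ℂ` lies in `Λ²ℍ ∧ ℂ`, since `-1 ∈ SU(2)` acts by a sign on
the other components. -/
theorem exists_eq_wedgeForm_add_wedgeForm : ∃ a b : ℍ[ℝ], star a = -a ∧ star b = -b ∧
    ∀ X Y Z, T X Y Z = wedgeForm a 1 X Y Z + wedgeForm b Complex.I X Y Z := by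
  obtain ⟨a, ha, hTa⟩ := exists_trilin_inQuat_inQuat_eq hs hT 1
  obtain ⟨b, hb, hTb⟩ := exists_trilin_inQuat_inQuat_eq hs hT Complex.I
  have hw : ∀ x y w, T (inQuat x) (inQuat y) (inComplex w) =
      w.re * inner ℝ (a * x) y + w.im * inner ℝ (b * x) y := fun x y w => by
    rw [inComplex_eq w, map_add, map_smul, map_smul, hTa, hTb, smul_eq_mul, smul_eq_mul]
  have hw' : ∀ x w y, T (inQuat x) (inComplex w) (inQuat y) =
      w.re * inner ℝ (a * y) x + w.im * inner ℝ (b * y) x := fun x w y => by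
    rw [hs', hw, inner_mul_left_skew ha, inner_mul_left_skew hb]
    ring
  have hcc : ∀ w w' z, T (inComplex w) (inComplex w') (inQuat z) = 0 := fun w w' z => by
    rw [hs', hs, trilin_inQuat_inComplex_eq_zero hT, neg_zero, neg_zero]
  refine ⟨a, b, ha, hb, fun X Y Z => ?_⟩
  conv_lhs => rw [← inQuat_fst_add_inComplex_snd X, ← inQuat_fst_add_inComplex_snd Y,
    ← inQuat_fst_add_inComplex_snd Z]
  simp only [map_add, LinearMap.add_apply, trilin_inQuat_eq_zero hT, hw, hw', hcc,
    trilin_inQuat_inComplex_eq_zero hT, trilin_inComplex_eq_zero hs hs', hs (inComplex X.snd),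
    wedgeForm, Complex.inner, inner_mul_left_skew ha Z.fst, inner_mul_left_skew hb Z.fst]
  simp
  ring

end InvariantForms

end QuatModel

section QuatModelForms

open scoped Quaternion

theorem leftMul_leftMul (p p' : ℍ[ℝ]) (z z' : ℂ) (w : QuatModel) :
    leftMul p z (leftMul p' z' w) = leftMul (p * p') (z * z') w :=
  congrArg (WithLp.toLp 2) (Prod.ext (mul_assoc _ _ _).symm (mul_assoc _ _ _).symm)

theorem leftMul_rightMul (p q : ℍ[ℝ]) (z : ℂ) (w : QuatModel) :
    leftMul p z (rightMul q w) = rightMul q (leftMul p z w) :=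
  congrArg (WithLp.toLp 2) (Prod.ext (mul_assoc _ _ _).symm rfl)

theorem inner_mul_left {p : ℍ[ℝ]} (hp : ‖p‖ = 1) (x y : ℍ[ℝ]) :
    (inner ℝ (p * x) (p * y) : ℝ) = inner ℝ x y :=
  LinearIsometry.inner_map_map
    (⟨LinearMap.mulLeft ℝ p, fun x => by simp [hp]⟩ : ℍ[ℝ] →ₗᵢ[ℝ] ℍ[ℝ]) x y

theorem inner_complex_mul_left {z : ℂ} (hz : ‖z‖ = 1) (w w' : ℂ) :
    (inner ℝ (z * w) (z * w') : ℝ) = inner ℝ w w' :=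
  LinearIsometry.inner_map_map
    (⟨LinearMap.mulLeft ℝ z, fun x => by simp [hz]⟩ : ℂ →ₗᵢ[ℝ] ℂ) w w'

theorem inner_leftMul {p : ℍ[ℝ]} {z : ℂ} (hp : ‖p‖ = 1) (hz : ‖z‖ = 1) (v w : QuatModel) :
    (inner ℝ (leftMul p z v) (leftMul p z w) : ℝ) = inner ℝ v w := by
  rw [WithLp.prod_inner_apply, WithLp.prod_inner_apply]
  exact congrArg₂ (· + ·) (inner_mul_left hp _ _) (inner_complex_mul_left hz _ _)

/-- The isometry `(x, w) ↦ (p x, z w)` of `ℍ ⊕ ℂ` for a unit quaternion `p` and a unit complex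
number `z`, by which we change frames. -/
def leftRotation {p : ℍ[ℝ]} {z : ℂ} (hp : ‖p‖ = 1) (hz : ‖z‖ = 1) : QuatModel ≃ₗᵢ[ℝ] QuatModel :=
  ((leftMul p z).toLinearMap.isometryOfInner (inner_leftMul hp hz)).toLinearIsometryEquiv rfl

theorem leftRotation_apply {p : ℍ[ℝ]} {z : ℂ} (hp : ‖p‖ = 1) (hz : ‖z‖ = 1) (w : QuatModel) :
    leftRotation hp hz w = leftMul p z w := rfl

theorem inner_rightMul {q : ℍ[ℝ]} (hq : ‖q‖ = 1) (v w : QuatModel) :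
    (inner ℝ (rightMul q v) (rightMul q w) : ℝ) = inner ℝ v w := by
  rw [WithLp.prod_inner_apply, WithLp.prod_inner_apply]
  exact congrArg (· + _) (inner_mul_right hq _ _)

theorem wedgeForm_rightMul {q : ℍ[ℝ]} (hq : ‖q‖ = 1) (a : ℍ[ℝ]) (ζ : ℂ) (X Y Z : QuatModel) :
    wedgeForm a ζ (rightMul q X) (rightMul q Y) (rightMul q Z) = wedgeForm a ζ X Y Z := by
  have h : ∀ x y : ℍ[ℝ], (inner ℝ (a * (x * q)) (y * q) : ℝ) = inner ℝ (a * x) y :=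
    fun x y => by rw [← mul_assoc, inner_mul_right hq]
  simp only [wedgeForm, rightMul_fst, rightMul_snd, h]

theorem wedgeForm_leftMul {p a b : ℍ[ℝ]} {z : ℂ} (hp : ‖p‖ = 1) (hz : ‖z‖ = 1)
    (h : SemiconjBy p a b) (ζ : ℂ) (X Y Z : QuatModel) :
    wedgeForm b (z * ζ) (leftMul p z X) (leftMul p z Y) (leftMul p z Z) = wedgeForm a ζ X Y Z := by
  have hq : ∀ x y : ℍ[ℝ], (inner ℝ (b * (p * x)) (p * y) : ℝ) = inner ℝ (a * x) y :=
    fun x y => by rw [← mul_assoc, ← h.eq, mul_assoc, inner_mul_left hp]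
  simp only [wedgeForm, leftMul_fst, leftMul_snd, hq, inner_complex_mul_left hz]

theorem wedgeForm_smul_left (s : ℝ) (a : ℍ[ℝ]) (ζ : ℂ) (X Y Z : QuatModel) :
    wedgeForm (s • a) ζ X Y Z = wedgeForm a (s * ζ) X Y Z := by
  simp only [wedgeForm, smul_mul_assoc, real_inner_smul_left, ← Complex.real_smul]
  ring

theorem wedgeForm_add_right (a : ℍ[ℝ]) (ζ ζ' : ℂ) (X Y Z : QuatModel) :
    wedgeForm a (ζ + ζ') X Y Z = wedgeForm a ζ X Y Z + wedgeForm a ζ' X Y Z := by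
  simp only [wedgeForm, inner_add_left]
  ring

theorem inner_leftMul_left (p : ℍ[ℝ]) (z : ℂ) (v w : QuatModel) :
    (inner ℝ (leftMul p z v) w : ℝ) = inner ℝ (p * v.fst) w.fst + inner ℝ (z * v.snd) w.snd :=
  WithLp.prod_inner_apply _ _

theorem wedgeForm_inComplex (a : ℍ[ℝ]) (ζ w : ℂ) (Y Z : QuatModel) :
    wedgeForm a ζ (inComplex w) Y Z = inner ℝ ζ w * inner ℝ (leftMul a 0 Y) Z := by
  have hfst : (inComplex w).fst = 0 := rfl
  have hsnd : (inComplex w).snd = w := rfl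
  simp only [wedgeForm, inner_leftMul_left, hfst, hsnd, mul_zero, zero_mul, inner_zero_left,
    inner_zero_right]
  ring

theorem wedgeForm_eq_inner_leftMul_I (a : ℍ[ℝ]) (ζ : ℂ) (X Y Z : QuatModel) :
    wedgeForm a ζ X Y Z = inner ℝ (leftMul a Complex.I X) Y * inner ℝ (inComplex ζ) Z +
      inner ℝ (leftMul a Complex.I Y) Z * inner ℝ (inComplex ζ) X +
        inner ℝ (leftMul a Complex.I Z) X * inner ℝ (inComplex ζ) Y := by
  have hin : ∀ W : QuatModel, (inner ℝ (inComplex ζ) W : ℝ) = inner ℝ ζ W.snd := fun W => by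
    rw [WithLp.prod_inner_apply]
    exact (congrArg (· + _) (inner_zero_left W.fst)).trans (zero_add _)
  simp only [wedgeForm, hin, inner_leftMul_left, Complex.inner]
  simp
  ring

theorem quatCoord_apply (w : QuatModel) :
    quatCoord w = !₂[w.fst.re, w.fst.imI, w.fst.imJ, w.fst.imK, w.snd.re, w.snd.im] := rfl

theorem normalForm_quatCoord (α₁ α₅ : ℝ) (X Y Z : QuatModel) :
    normalForm α₁ α₅ (quatCoord X) (quatCoord Y) (quatCoord Z) =
      wedgeForm (imQuat α₅ 0 α₁) 1 X Y Z := by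
  simp [wedgeForm, normalForm, wedge3, Matrix.det_fin_three, Complex.inner, Quaternion.inner_def,
    quatCoord_apply]
  ring

end QuatModelForms

section SpecialUnitary

open scoped Quaternion

/-- The matrix of `x ↦ x q` on `ℍ = ℂ ⊕ ℂ j`, regarded as a complex vector space by left
multiplication. -/
def quatMatrix (q : ℍ[ℝ]) : Matrix (Fin 2) (Fin 2) ℂ :=
  !![⟨q.re, q.imI⟩, ⟨-q.imJ, q.imK⟩; ⟨q.imJ, q.imK⟩, ⟨q.re, -q.imI⟩]

/-- The quaternion `z + w j`. -/
def quatOfPair (z w : ℂ) : ℍ[ℝ] := ⟨z.re, z.im, w.re, w.im⟩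

@[simp] theorem quatOfPair_re (z w : ℂ) : (quatOfPair z w).re = z.re := rfl

@[simp] theorem quatOfPair_imI (z w : ℂ) : (quatOfPair z w).imI = z.im := rfl

@[simp] theorem quatOfPair_imJ (z w : ℂ) : (quatOfPair z w).imJ = w.re := rfl

@[simp] theorem quatOfPair_imK (z w : ℂ) : (quatOfPair z w).imK = w.im := rfl

theorem quatOfPair_mul (z w : ℂ) (q : ℍ[ℝ]) : quatOfPair z w * q =
    quatOfPair (quatMatrix q 0 0 * z + quatMatrix q 0 1 * w)
      (quatMatrix q 1 0 * z + quatMatrix q 1 1 * w) := by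
  ext <;> simp [quatMatrix] <;> ring

theorem quat_norm_eq_one_iff {q : ℍ[ℝ]} :
    ‖q‖ = 1 ↔ q.re ^ 2 + q.imI ^ 2 + q.imJ ^ 2 + q.imK ^ 2 = 1 := by
  rw [← Quaternion.normSq_def', Quaternion.normSq_eq_norm_mul_self, ← sq,
    pow_eq_one_iff_of_nonneg (norm_nonneg q) two_ne_zero]

theorem quatMatrix_mem_specialUnitaryGroup {q : ℍ[ℝ]} (hq : ‖q‖ = 1) :
    quatMatrix q ∈ Matrix.specialUnitaryGroup (Fin 2) ℂ := by
  have hn := quat_norm_eq_one_iff.1 hq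
  rw [Matrix.mem_specialUnitaryGroup_iff, Matrix.mem_unitaryGroup_iff]
  constructor
  · ext i j
    fin_cases i <;> fin_cases j <;>
      simp [quatMatrix, Matrix.mul_apply, Fin.sum_univ_two, Matrix.star_eq_conjTranspose,
        Complex.ext_iff] <;>
      grind
  · simp [quatMatrix, Matrix.det_fin_two, Complex.ext_iff]
    grind

theorem exists_quatMatrix_eq {A : Matrix (Fin 2) (Fin 2) ℂ}
    (hA : A ∈ Matrix.specialUnitaryGroup (Fin 2) ℂ) : ∃ q : ℍ[ℝ], ‖q‖ = 1 ∧ quatMatrix q = A := by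
  obtain ⟨hunit, hdet⟩ := Matrix.mem_specialUnitaryGroup_iff.1 hA
  have hadj : star A = A.adjugate := by
    rw [← one_mul (star A), ← one_smul ℂ (1 : Matrix (Fin 2) (Fin 2) ℂ), ← hdet,
      ← Matrix.adjugate_mul, mul_assoc, Matrix.mem_unitaryGroup_iff.1 hunit, mul_one]
  rw [Matrix.adjugate_fin_two] at hadj
  have h₀ : star (A 0 0) = A 1 1 := congrFun (congrFun hadj 0) 0
  have h₁ : star (A 1 0) = -A 0 1 := congrFun (congrFun hadj 0) 1
  have hA₀₁ : A 0 1 = -star (A 1 0) := by rw [h₁, neg_neg]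
  refine ⟨⟨(A 0 0).re, (A 0 0).im, (A 1 0).re, (A 1 0).im⟩, quat_norm_eq_one_iff.2 ?_, ?_⟩
  · rw [Matrix.det_fin_two, ← h₀, hA₀₁] at hdet
    have hre := congrArg Complex.re hdet
    simp at hre
    linarith
  · ext i j
    fin_cases i <;> fin_cases j <;> simp [quatMatrix, ← h₀, hA₀₁, Complex.ext_iff]

end SpecialUnitary

section Frames

open scoped Quaternion

section Linear

variable {V : Type*} [NormedAddCommGroup V] [InnerProductSpace ℝ V] (φ : V ≃ₗᵢ[ℝ] QuatModel)

/-- The orthonormal frame of `V` which `φ` maps to the frame `1, i, j, k, 1, i` of `ℍ ⊕ ℂ`. -/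
def frameBasis : OrthonormalBasis (Fin 6) ℝ V := .ofRepr (φ.trans quatCoord)

theorem frameBasis_repr (v : V) : (frameBasis φ).repr v = quatCoord (φ v) := rfl

theorem exists_frameBasis_eq (e : OrthonormalBasis (Fin 6) ℝ V) : ∃ φ, frameBasis φ = e :=
  ⟨e.repr.trans quatCoord.symm, congrArg OrthonormalBasis.ofRepr
    (LinearIsometryEquiv.ext fun v => quatCoord.apply_symm_apply (e.repr v))⟩

theorem map_frameBasis (i : Fin 6) : φ (frameBasis φ i) =
    ![inQuat 1, inQuat (imQuat 1 0 0), inQuat (imQuat 0 1 0), inQuat (imQuat 0 0 1),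
      inComplex 1, inComplex Complex.I] i := by
  apply quatCoord.injective
  rw [← frameBasis_repr, OrthonormalBasis.repr_self]
  ext j
  fin_cases i <;> fin_cases j <;> simp [quatCoord_apply, inQuat, inComplex]

end Linear

theorem imQuat_I_mul_I : imQuat 1 0 0 * imQuat 1 0 0 = -1 := imQuat_mul_self (by norm_num)

theorem imQuat_I_mul_J : imQuat 1 0 0 * imQuat 0 1 0 = imQuat 0 0 1 := by
  ext <;> simp

theorem imQuat_I_mul_K : imQuat 1 0 0 * imQuat 0 0 1 = -imQuat 0 1 0 := by
  ext <;> simp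

theorem leftMul_inQuat (p : ℍ[ℝ]) (z : ℂ) (x : ℍ[ℝ]) :
    leftMul p z (inQuat x) = inQuat (p * x) :=
  congrArg (WithLp.toLp 2) (Prod.ext rfl (mul_zero z))

theorem leftMul_inComplex (p : ℍ[ℝ]) (z w : ℂ) :
    leftMul p z (inComplex w) = inComplex (z * w) :=
  congrArg (WithLp.toLp 2) (Prod.ext (mul_zero p) rfl)

variable {M : Type*} [TopologicalSpace M] [ChartedSpace E6 M]
  [RiemannianBundle (fun x : M => TangentSpace (𝓡 6) x)] {x : M}
  {φ : TangentSpace (𝓡 6) x ≃ₗᵢ[ℝ] QuatModel}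

/-- The coordinates `ℂ³ = ℍ ⊕ ℂ`, in which `(z₁, z₂)` corresponds to `z₁ + z₂ j`. -/
def ofComplexCoord (z : Fin 3 → ℂ) : QuatModel :=
  WithLp.toLp 2 (quatOfPair (z 0) (z 1), z 2)

theorem ofComplexCoord_surjective : Function.Surjective ofComplexCoord := fun w =>
  ⟨![⟨w.fst.re, w.fst.imI⟩, ⟨w.fst.imJ, w.fst.imK⟩, w.snd], rfl⟩

theorem map_ofComplex (z : Fin 3 → ℂ) :
    φ (ofComplex (frameBasis φ) z) = ofComplexCoord z := by
  simp only [ofComplex, map_add, map_smul, map_frameBasis]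
  refine quatCoord.injective ?_
  ext i
  fin_cases i <;> simp [quatCoord_apply, inQuat, inComplex, ofComplexCoord]

theorem ofComplexCoord_blockMatrix_mulVec (q : ℍ[ℝ]) (z : Fin 3 → ℂ) :
    ofComplexCoord ((blockMatrix (quatMatrix q)).mulVec z) = rightMul q (ofComplexCoord z) := by
  refine congrArg (WithLp.toLp 2) (Prod.ext ?_ ?_)
  · change _ = quatOfPair (z 0) (z 1) * q
    rw [quatOfPair_mul]
    simp [blockMatrix, quatMatrix, Matrix.mulVec, dotProduct, Fin.sum_univ_three]
  · simp [blockMatrix, Matrix.mulVec, dotProduct, Fin.sum_univ_three, ofComplexCoord]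

theorem mem_SU2At_frameBasis_iff {a : TangentSpace (𝓡 6) x →ₗ[ℝ] TangentSpace (𝓡 6) x} :
    a ∈ SU2At (frameBasis φ) ↔ ∃ q : ℍ[ℝ], ‖q‖ = 1 ∧ ∀ v, φ (a v) = rightMul q (φ v) := by
  constructor
  · rintro ⟨A, hA, ha⟩
    obtain ⟨q, hq, rfl⟩ := exists_quatMatrix_eq hA
    refine ⟨q, hq, fun v => ?_⟩
    obtain ⟨z, hz⟩ := ofComplexCoord_surjective (φ v)
    obtain rfl : ofComplex (frameBasis φ) z = v := φ.injective (by rw [map_ofComplex, hz])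
    rw [ha, map_ofComplex, map_ofComplex, ofComplexCoord_blockMatrix_mulVec]
  · rintro ⟨q, hq, ha⟩
    refine ⟨_, quatMatrix_mem_specialUnitaryGroup hq, fun z => φ.injective ?_⟩
    rw [ha, map_ofComplex, map_ofComplex, ofComplexCoord_blockMatrix_mulVec]

variable [IsManifold (𝓡 6) ∞ M] {J : OrthogonalACS M}

theorem isAdapted_frameBasis_iff : IsAdapted J (frameBasis φ) ↔
    ∀ v, φ (J x v) = leftMul (imQuat 1 0 0) Complex.I (φ v) := by
  constructor
  · rintro ⟨h₀, h₂, h₄⟩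
    have h₁ := J.sq x (frameBasis φ 0)
    have h₃ := J.sq x (frameBasis φ 2)
    have h₅ := J.sq x (frameBasis φ 4)
    rw [h₀] at h₁
    rw [h₂] at h₃
    rw [h₄] at h₅
    refine LinearMap.congr_fun (f := φ.toLinearMap ∘ₗ (J x).toLinearMap)
      (g := (leftMul (imQuat 1 0 0) Complex.I).toLinearMap ∘ₗ φ.toLinearMap)
      ((frameBasis φ).toBasis.ext fun i => ?_)
    change φ (J x ((frameBasis φ).toBasis i)) = leftMul _ _ (φ ((frameBasis φ).toBasis i))
    rw [OrthonormalBasis.coe_toBasis]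
    fin_cases i <;> simp [h₀, h₁, h₂, h₃, h₄, h₅, map_frameBasis, leftMul_inQuat,
      leftMul_inComplex, imQuat_I_mul_I, imQuat_I_mul_J, imQuat_I_mul_K]
  · intro h
    refine ⟨?_, ?_, ?_⟩ <;> apply φ.injective <;> rw [h, map_frameBasis, map_frameBasis]
    · exact (leftMul_inQuat _ _ _).trans (congrArg inQuat (mul_one _))
    · exact (leftMul_inQuat _ _ _).trans (congrArg inQuat imQuat_I_mul_J)
    · exact (leftMul_inComplex _ _ _).trans (congrArg inComplex (mul_one _))

end Frames

section FrameFields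

open scoped Quaternion

variable {M : Type*} [TopologicalSpace M] [ChartedSpace E6 M]
  [RiemannianBundle (fun x : M => TangentSpace (𝓡 6) x)]
  {φ : (x : M) → TangentSpace (𝓡 6) x ≃ₗᵢ[ℝ] QuatModel}

/-- The field of endomorphisms which is `(x, w) ↦ (p x, z w)` in the frames `φ`. -/
def frameEndo (φ : (x : M) → TangentSpace (𝓡 6) x ≃ₗᵢ[ℝ] QuatModel) (p : ℍ[ℝ]) (z : ℂ) (x : M) :
    TangentSpace (𝓡 6) x →L[ℝ] TangentSpace (𝓡 6) x :=
  ((φ x).symm.toContinuousLinearEquiv.toContinuousLinearMap.comp (leftMul p z)).comp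
    (φ x).toContinuousLinearEquiv.toContinuousLinearMap

theorem map_frameEndo (p : ℍ[ℝ]) (z : ℂ) (x : M) (v : TangentSpace (𝓡 6) x) :
    φ x (frameEndo φ p z x v) = leftMul p z (φ x v) :=
  (φ x).apply_symm_apply _

variable [IsManifold (𝓡 6) ∞ M] {J : OrthogonalACS M} {cov : AffineConnection M}

/-- A reduction of the holonomy to `SU(2)`: a (not necessarily continuous) field of frames, written
as isometries to `ℍ ⊕ ℂ`, in which every parallel transport is an element of `SU(2)`. -/
def IsSU2FrameField (cov : AffineConnection M)
    (φ : (x : M) → TangentSpace (𝓡 6) x ≃ₗᵢ[ℝ] QuatModel) : Prop :=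
  ∀ ⦃x y : M⦄ ⦃P : TangentSpace (𝓡 6) x →ₗ[ℝ] TangentSpace (𝓡 6) y⦄, IsParallelTransport cov x y P →
    ∃ q : ℍ[ℝ], ‖q‖ = 1 ∧ ∀ v, φ y (P v) = rightMul q (φ x v)

theorem IsSU2FrameField.isInvariantEndo_frameEndo (hφ : IsSU2FrameField cov φ) (p : ℍ[ℝ]) (z : ℂ) :
    IsInvariantEndo J cov (frameEndo φ p z) := fun x y P hP v => by
  obtain ⟨q, -, hq⟩ := hφ hP.transport
  apply (φ y).injective
  rw [map_frameEndo]
  exact (hq _).trans (by rw [map_frameEndo, ← leftMul_rightMul, ← hq]; rfl)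

theorem IsSU2FrameField.isInvariantField_inComplex (hφ : IsSU2FrameField cov φ) (w : ℂ) :
    IsInvariantField J cov (fun x => (φ x).symm (inComplex w)) := fun x y P hP => by
  obtain ⟨q, -, hq⟩ := hφ hP.transport
  apply (φ y).injective
  rw [LinearIsometryEquiv.apply_symm_apply]
  exact (hq _).trans (by rw [LinearIsometryEquiv.apply_symm_apply, rightMul_inComplex])

theorem IsSU2FrameField.trans_leftRotation (hφ : IsSU2FrameField cov φ) {p : ℍ[ℝ]} {z : ℂ}
    (hp : ‖p‖ = 1) (hz : ‖z‖ = 1) :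
    IsSU2FrameField cov (fun x => (φ x).trans (leftRotation hp hz)) := fun x y P hP => by
  obtain ⟨q, hq, h⟩ := hφ hP
  refine ⟨q, hq, fun v => ?_⟩
  simp only [LinearIsometryEquiv.trans_apply, leftRotation_apply, h, leftMul_rightMul]

theorem IsSU2FrameField.holonomyGroup_subset (hφ : IsSU2FrameField cov φ) (x : M) :
    holonomyGroup cov x ⊆ SU2At (frameBasis (φ x)) := fun _ hP =>
  mem_SU2At_frameBasis_iff.2 (hφ hP)

theorem torsionForm_rightMul_of_SU2At_subset {x : M} {φ : TangentSpace (𝓡 6) x ≃ₗᵢ[ℝ] QuatModel}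
    (h : SU2At (frameBasis φ) ⊆ isotropyGroup J cov x) {q : ℍ[ℝ]} (hq : ‖q‖ = 1)
    (X Y Z : QuatModel) :
    torsionForm cov x (φ.symm (rightMul q X)) (φ.symm (rightMul q Y)) (φ.symm (rightMul q Z)) =
      torsionForm cov x (φ.symm X) (φ.symm Y) (φ.symm Z) := by
  have hmem : φ.symm.toLinearMap ∘ₗ rightMul q ∘ₗ φ.toLinearMap ∈ SU2At (frameBasis φ) :=
    mem_SU2At_frameBasis_iff.2 ⟨q, hq, fun v => by simp⟩
  simpa using (h hmem).2.2 (φ.symm X) (φ.symm Y) (φ.symm Z)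

theorem SU2At_subset_isotropyGroup {x : M} {φ : TangentSpace (𝓡 6) x ≃ₗᵢ[ℝ] QuatModel}
    {p : ℍ[ℝ]} {z : ℂ} {F : QuatModel → QuatModel → QuatModel → ℝ}
    (hJ : ∀ v, φ (J x v) = leftMul p z (φ v))
    (hT : ∀ X Y Z, torsionForm cov x X Y Z = F (φ X) (φ Y) (φ Z))
    (hF : ∀ q : ℍ[ℝ], ‖q‖ = 1 → ∀ X Y Z,
      F (rightMul q X) (rightMul q Y) (rightMul q Z) = F X Y Z) :
    SU2At (frameBasis φ) ⊆ isotropyGroup J cov x := fun a ha => by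
  obtain ⟨q, hq, hqa⟩ := mem_SU2At_frameBasis_iff.1 ha
  refine ⟨fun X Y => ?_, fun X => φ.injective ?_, fun X Y Z => ?_⟩
  · rw [← φ.inner_map_map, hqa, hqa, inner_rightMul hq, φ.inner_map_map]
  · rw [hqa, hJ, hJ, hqa, leftMul_rightMul]
  · rw [hT, hT, hqa, hqa, hqa, hF q hq]

variable [IsContMDiffRiemannianBundle (𝓡 6) ∞ E6 (fun x : M => TangentSpace (𝓡 6) x)]
  [T2Space M] [ConnectedSpace M]

theorem IsRelatedToSU2.exists_isSU2FrameField (hJ : IsRelatedToSU2 J cov) :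
    ∃ φ : (x : M) → TangentSpace (𝓡 6) x ≃ₗᵢ[ℝ] QuatModel, IsSU2FrameField cov φ ∧
      (∀ x v, φ x (J x v) = leftMul (imQuat 1 0 0) Complex.I (φ x v)) ∧
      ∃ T : QuatModel →ₗ[ℝ] QuatModel →ₗ[ℝ] QuatModel →ₗ[ℝ] ℝ,
        (∀ q : ℍ[ℝ], ‖q‖ = 1 → ∀ X Y Z,
          T (rightMul q X) (rightMul q Y) (rightMul q Z) = T X Y Z) ∧
        ∀ x X Y Z, torsionForm cov x X Y Z = T (φ x X) (φ x Y) (φ x Z) := by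
  obtain ⟨x₀⟩ : Nonempty M := inferInstance
  obtain ⟨e, hadapted, hhol, hiso⟩ := hJ.su2 x₀
  obtain ⟨φ₀, rfl⟩ := exists_frameBasis_eq e
  choose P hP using exists_isReversibleTransport hJ.characteristic hJ.parallel x₀
  refine ⟨fun x => ((P x).symm.isometryOfInner (hP x).symm.inner_map).trans φ₀,
    fun x y Q hQ => ?_, fun x v => ?_,
    ((torsionTrilin cov x₀).compl₁₂ φ₀.symm.toLinearMap φ₀.symm.toLinearMap).compr₂
      (LinearMap.lcomp ℝ ℝ φ₀.symm.toLinearMap),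
    fun q hq => torsionForm_rightMul_of_SU2At_subset hiso hq, fun x X Y Z => ?_⟩
  · obtain ⟨q, hq, hloop⟩ := mem_SU2At_frameBasis_iff.1
      (hhol (((hP x).transport.trans hQ).trans (hP y).transport_symm))
    refine ⟨q, hq, fun v => ?_⟩
    simpa using hloop ((P x).symm v)
  · exact (congrArg φ₀ ((hP x).symm.map_acs v)).trans (isAdapted_frameBasis_iff.1 hadapted _)
  · change _ = torsionForm cov x₀ (φ₀.symm (φ₀ ((P x).symm X))) (φ₀.symm (φ₀ ((P x).symm Y)))
      (φ₀.symm (φ₀ ((P x).symm Z)))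
    rw [φ₀.symm_apply_apply, φ₀.symm_apply_apply, φ₀.symm_apply_apply, torsionForm, torsionForm,
      ← (hP x).symm.map_torsion, (hP x).symm.inner_map]

end FrameFields

section NormalizedTorsion

open scoped Quaternion

variable {M : Type*} [TopologicalSpace M] [ChartedSpace E6 M] [IsManifold (𝓡 6) ∞ M]
  [RiemannianBundle (fun x : M => TangentSpace (𝓡 6) x)]
  {J : OrthogonalACS M} {cov : AffineConnection M}

theorem map_torsion_inComplex {x : M} {φ : TangentSpace (𝓡 6) x ≃ₗᵢ[ℝ] QuatModel} {a b : ℍ[ℝ]}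
    (h : ∀ X Y Z, torsionForm cov x X Y Z =
      wedgeForm a 1 (φ X) (φ Y) (φ Z) + wedgeForm b Complex.I (φ X) (φ Y) (φ Z))
    (w : ℂ) (v : TangentSpace (𝓡 6) x) :
    φ (cov.torsion x (φ.symm (inComplex w)) v) = leftMul (w.re • a + w.im • b) 0 (φ v) := by
  refine ext_inner_right ℝ fun u => ?_
  obtain ⟨u, rfl⟩ := φ.surjective u
  rw [φ.inner_map_map]
  refine (h _ v u).trans ?_
  rw [φ.apply_symm_apply, wedgeForm_inComplex, wedgeForm_inComplex]
  simp only [inner_leftMul_left, add_mul, smul_mul_assoc, inner_add_left, real_inner_smul_left,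
    Complex.inner]
  simp

theorem torsionForm_antisymm (x : M) (X Y Z : TangentSpace (𝓡 6) x) :
    torsionForm cov x X Y Z = -torsionForm cov x Y X Z := by
  rw [torsionForm, cov.torsion_antisymm, inner_neg_left]
  rfl

variable [IsContMDiffRiemannianBundle (𝓡 6) ∞ E6 (fun x : M => TangentSpace (𝓡 6) x)]
  [T2Space M] {φ : (x : M) → TangentSpace (𝓡 6) x ≃ₗᵢ[ℝ] QuatModel}

theorem IsSU2FrameField.commute_of_torsionForm_eq [ConnectedSpace M] (hφ : IsSU2FrameField cov φ)
    (hJ : IsCharacteristicConnection J cov) (hT : HasParallelTorsion cov) {a b : ℍ[ℝ]}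
    (h : ∀ x X Y Z, torsionForm cov x X Y Z =
      wedgeForm a 1 (φ x X) (φ x Y) (φ x Z) + wedgeForm b Complex.I (φ x X) (φ x Y) (φ x Z)) :
    Commute a b := by
  obtain ⟨x⟩ : Nonempty M := inferInstance
  have ha : ∀ x v, φ x (cov.torsion x ((φ x).symm (inComplex 1)) v) = leftMul a 0 (φ x v) :=
    fun x v => by simpa using map_torsion_inComplex (h x) 1 v
  have hb : ∀ x v, φ x (cov.torsion x ((φ x).symm (inComplex Complex.I)) v) =
      leftMul b 0 (φ x v) := fun x v => by simpa using map_torsion_inComplex (h x) Complex.I v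
  have hzero : ∀ x, cov.torsion x ((φ x).symm (inComplex 1)) ((φ x).symm (inComplex Complex.I)) =
      0 := fun x => (φ x).injective (by simp [ha, leftMul_inComplex])
  refine commute_of_commutator_central fun p => ?_
  have hcomm := (hφ.isInvariantField_inComplex 1).torsion_commutator_comm
    (hφ.isInvariantField_inComplex Complex.I) hJ hT hzero (hφ.isInvariantEndo_frameEndo p 0) x
    ((φ x).symm (inQuat 1))
  have hmodel := congrArg (φ x) hcomm
  simp only [map_sub, map_frameEndo, ha, hb, LinearIsometryEquiv.apply_symm_apply,
    leftMul_inQuat] at hmodel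
  have hfst : b * (a * (p * 1)) - a * (b * (p * 1)) = p * (b * (a * 1)) - p * (a * (b * 1)) :=
    congrArg WithLp.fst hmodel
  rw [← Commute.neg_left_iff, neg_sub, commute_iff_eq, sub_mul, mul_sub, mul_assoc, mul_assoc]
  simpa only [mul_one] using hfst

theorem IsSU2FrameField.exists_torsionForm_eq_wedgeForm [ConnectedSpace M]
    (hφ : IsSU2FrameField cov φ) (hJ : IsCharacteristicConnection J cov)
    (hT : HasParallelTorsion cov) {T : QuatModel →ₗ[ℝ] QuatModel →ₗ[ℝ] QuatModel →ₗ[ℝ] ℝ}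
    (hTinv : ∀ q : ℍ[ℝ], ‖q‖ = 1 → ∀ X Y Z,
      T (rightMul q X) (rightMul q Y) (rightMul q Z) = T X Y Z)
    (hTφ : ∀ x X Y Z, torsionForm cov x X Y Z = T (φ x X) (φ x Y) (φ x Z)) :
    ∃ (u : ℍ[ℝ]) (ζ : ℂ), u * u = -1 ∧
      ∀ x X Y Z, torsionForm cov x X Y Z = wedgeForm u ζ (φ x X) (φ x Y) (φ x Z) := by
  obtain ⟨x⟩ : Nonempty M := inferInstance
  have hmodel : ∀ X Y Z, T X Y Z = torsionForm cov x ((φ x).symm X) ((φ x).symm Y) ((φ x).symm Z) :=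
    fun X Y Z => by simp [hTφ]
  obtain ⟨a, b, ha, hb, hab⟩ := exists_eq_wedgeForm_add_wedgeForm (T := T)
    (fun X Y Z => by rw [hmodel, hmodel, torsionForm_antisymm])
    (fun X Y Z => by rw [hmodel, hmodel, hJ.skew]) hTinv
  have hform := fun x X Y Z => (hTφ x X Y Z).trans (hab _ _ _)
  obtain ⟨u, s, t, hu, rfl, rfl⟩ :=
    exists_eq_smul_of_commute ha hb (hφ.commute_of_torsionForm_eq hJ hT hform)
  refine ⟨u, s * 1 + t * Complex.I, hu, fun x X Y Z => ?_⟩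
  rw [hform, wedgeForm_smul_left, wedgeForm_smul_left, wedgeForm_add_right]

theorem IsRelatedToSU2.exists_normalized_isSU2FrameField [ConnectedSpace M]
    (hJ : IsRelatedToSU2 J cov) (hT : ∃ x : M, cov.torsion x ≠ 0) :
    ∃ (φ : (x : M) → TangentSpace (𝓡 6) x ≃ₗᵢ[ℝ] QuatModel) (u : ℍ[ℝ]) (r : ℝ),
      IsSU2FrameField cov φ ∧ u * u = -1 ∧ 0 < r ∧
      (∀ x v, φ x (J x v) = leftMul u Complex.I (φ x v)) ∧
      ∀ x X Y Z, torsionForm cov x X Y Z =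
        wedgeForm (imQuat 1 0 0) r (φ x X) (φ x Y) (φ x Z) := by
  obtain ⟨φ, hφ, hφJ, T, hTinv, hTφ⟩ := hJ.exists_isSU2FrameField
  obtain ⟨a, ζ, ha, hform⟩ :=
    hφ.exists_torsionForm_eq_wedgeForm hJ.characteristic hJ.parallel hTinv hTφ
  have hζ : ζ ≠ 0 := by
    rintro rfl
    obtain ⟨x, hx⟩ := hT
    refine hx (ContinuousLinearMap.ext fun X => ContinuousLinearMap.ext fun Y => ?_)
    exact ext_inner_right ℝ fun Z => (hform x X Y Z).trans (by simp [wedgeForm])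
  have hζn : ‖ζ‖ ≠ 0 := norm_ne_zero_iff.2 hζ
  obtain ⟨p, hp, hpa, -⟩ := exists_semiconjBy_pair ha ha (c := 1) (by norm_num)
    (by rw [ha, ← Quaternion.coe_one, ← Quaternion.coe_neg, ← Quaternion.coe_add]; norm_num)
  have hz : ‖(‖ζ‖⁻¹ • star ζ : ℂ)‖ = 1 := by simp [hζn]
  have hzζ : (‖ζ‖⁻¹ • star ζ : ℂ) * ζ = ‖ζ‖ := by
    rw [smul_mul_assoc, Complex.star_def, Complex.conj_mul', Complex.real_smul]
    push_cast
    field_simp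
  have hp0 : p ≠ 0 := norm_ne_zero_iff.1 (by simp [hp])
  obtain ⟨u, hu, hpu⟩ := exists_mul_self_semiconjBy hp0 imQuat_I_mul_I
  refine ⟨fun x => (φ x).trans (leftRotation hp hz), u, ‖ζ‖,
    hφ.trans_leftRotation hp hz, hu, norm_pos_iff.2 hζ, fun x v => ?_, fun x X Y Z => ?_⟩
  · simp only [LinearIsometryEquiv.trans_apply, leftRotation_apply, hφJ, leftMul_leftMul]
    rw [hpu.eq, mul_comm Complex.I]
  · simp only [LinearIsometryEquiv.trans_apply, leftRotation_apply, hform]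
    rw [← hzζ, wedgeForm_leftMul hp hz hpa]

end NormalizedTorsion

section SmoothFamilies

variable {M : Type*} [TopologicalSpace M] [ChartedSpace E6 M] [IsManifold (𝓡 6) ∞ M]

theorem contMDiff_sum_smul_endo {E : Type*} [NormedAddCommGroup E] [NormedSpace ℝ E] {H : Type*}
    [TopologicalSpace H] {I : ModelWithCorners ℝ E H} {N : Type*} [TopologicalSpace N]
    [ChartedSpace H N] {ι : Type*} [Fintype ι] {f : ι → N → ℝ}
    {L : ι → (x : M) → TangentSpace (𝓡 6) x →L[ℝ] TangentSpace (𝓡 6) x}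
    (hf : ∀ i, ContMDiff I 𝓘(ℝ, ℝ) ∞ (f i))
    (hL : ∀ i, ContMDiff (𝓡 6) ((𝓡 6).prod 𝓘(ℝ, E6 →L[ℝ] E6)) ∞
      (fun x => TotalSpace.mk' (E6 →L[ℝ] E6)
        (E := fun x : M => TangentSpace (𝓡 6) x →L[ℝ] TangentSpace (𝓡 6) x) x (L i x))) :
    ContMDiff (I.prod (𝓡 6)) ((𝓡 6).prod 𝓘(ℝ, E6 →L[ℝ] E6)) ∞
      (fun p : N × M => TotalSpace.mk' (E6 →L[ℝ] E6)
        (E := fun x : M => TangentSpace (𝓡 6) x →L[ℝ] TangentSpace (𝓡 6) x) p.2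
          (∑ i, f i p.1 • L i p.2)) := fun p₀ => by
  rw [contMDiffAt_hom_bundle]
  refine ⟨contMDiffAt_snd, ?_⟩
  have hcoord : ∀ i, ContMDiffAt (I.prod (𝓡 6)) 𝓘(ℝ, E6 →L[ℝ] E6) ∞
      (fun p : N × M => ContinuousLinearMap.inCoordinates E6 (TangentSpace (𝓡 6) : M → Type) E6
        (TangentSpace (𝓡 6) : M → Type) p₀.2 p.2 p₀.2 p.2 (L i p.2)) p₀ := fun i =>
    ((contMDiffAt_hom_bundle _).1 (hL i p₀.2)).2.comp p₀ contMDiffAt_snd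
  have hsum := ContMDiffAt.sum (t := Finset.univ) fun i _ =>
    ((hf i p₀.1).comp p₀ contMDiffAt_fst).smul (hcoord i)
  refine hsum.congr_of_eventuallyEq (.of_forall fun p => ContinuousLinearMap.ext fun v => ?_)
  simp only [ContinuousLinearMap.inCoordinates, ContinuousLinearMap.comp_apply]
  simp

end SmoothFamilies

section SphereFamily

open scoped Quaternion

theorem S2.sum_sq (q : S2) : q.1 0 ^ 2 + q.1 1 ^ 2 + q.1 2 ^ 2 = 1 := by
  rw [← Fin.sum_univ_three (fun i => q.1 i ^ 2), ← EuclideanSpace.real_norm_sq_eq,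
    mem_sphere_zero_iff_norm.1 q.2, one_pow]

/-- The point `(a, b, c)` of the sphere. -/
def S2.mk {a b c : ℝ} (h : a ^ 2 + b ^ 2 + c ^ 2 = 1) : S2 :=
  ⟨!₂[a, b, c], by
    rw [mem_sphere_zero_iff_norm, EuclideanSpace.norm_eq, Fin.sum_univ_three]
    simp [h]⟩

theorem S2.contMDiff_apply (i : Fin 3) : ContMDiff (𝓡 2) 𝓘(ℝ, ℝ) ∞ (fun q : S2 => q.1 i) := by
  have : Fact (Module.finrank ℝ (EuclideanSpace ℝ (Fin 3)) = 2 + 1) := ⟨by simp⟩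
  have hcoe : ContMDiff (𝓡 2) 𝓘(ℝ, EuclideanSpace ℝ (Fin 3)) ∞
      ((↑) : S2 → EuclideanSpace ℝ (Fin 3)) := contMDiff_coe_sphere
  exact (EuclideanSpace.proj (𝕜 := ℝ) i).contDiff.contMDiff.comp hcoe

/-- The sphere as the set of imaginary quaternions of norm one. -/
def S2.toQuat (q : S2) : ℍ[ℝ] := imQuat (q.1 0) (q.1 1) (q.1 2)

theorem S2.toQuat_mul_self (q : S2) : q.toQuat * q.toQuat = -1 := imQuat_mul_self q.sum_sq

theorem S2.norm_toQuat (q : S2) : ‖q.toQuat‖ = 1 := by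
  rw [quat_norm_eq_one_iff]
  simp [S2.toQuat, q.sum_sq]

theorem S2.toQuat_injective : Function.Injective S2.toQuat := fun q q' h => by
  refine Subtype.ext (PiLp.ext fun i => ?_)
  fin_cases i
  exacts [congrArg (·.imI) h, congrArg (·.imJ) h, congrArg (·.imK) h]

variable {M : Type*} [TopologicalSpace M] [ChartedSpace E6 M]
  [RiemannianBundle (fun x : M => TangentSpace (𝓡 6) x)]
  {φ : (x : M) → TangentSpace (𝓡 6) x ≃ₗᵢ[ℝ] QuatModel}

theorem frameEndo_toQuat (q : S2) (x : M) : frameEndo φ q.toQuat Complex.I x =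
    ∑ i, ![q.1 0, q.1 1, q.1 2, 1] i •
      frameEndo φ (![imQuat 1 0 0, imQuat 0 1 0, imQuat 0 0 1, 0] i)
        (![0, 0, 0, Complex.I] i) x := by
  refine ContinuousLinearMap.ext fun v => (φ x).injective ?_
  have hfst : q.toQuat = q.1 0 • imQuat 1 0 0 + q.1 1 • imQuat 0 1 0 + q.1 2 • imQuat 0 0 1 := by
    ext <;> simp [S2.toQuat]
  simp only [Fin.sum_univ_four, add_apply, smul_apply, map_add, map_smul, map_frameEndo]
  refine congrArg (WithLp.toLp 2) (Prod.ext ?_ ?_)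
  · change q.toQuat * _ = _
    rw [hfst]
    simp [leftMul_fst, add_mul]
  · simp [leftMul_snd]

variable [IsManifold (𝓡 6) ∞ M]
  [IsContMDiffRiemannianBundle (𝓡 6) ∞ E6 (fun x : M => TangentSpace (𝓡 6) x)] [T2Space M]
  {J : OrthogonalACS M} {cov : AffineConnection M}

/-- The almost complex structure which acts on `ℍ ⊕ ℂ` by left multiplication with the imaginary
unit quaternion `q` and with `i`. -/
def sphereACS (hφ : IsSU2FrameField cov φ) (hJ : IsCharacteristicConnection J cov)
    (hT : HasParallelTorsion cov) (q : S2) : OrthogonalACS M where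
  toFun := frameEndo φ q.toQuat Complex.I
  smooth := (hφ.isInvariantEndo_frameEndo (J := J) _ _).contMDiff hJ hT
  sq x v := (φ x).injective <| by
    rw [map_frameEndo, map_frameEndo, leftMul_leftMul, q.toQuat_mul_self, Complex.I_mul_I, map_neg]
    exact congrArg (WithLp.toLp 2) (Prod.ext (neg_one_mul _) (neg_one_mul _))
  orthogonal x v w := by
    rw [← (φ x).inner_map_map, map_frameEndo, map_frameEndo,
      inner_leftMul q.norm_toQuat Complex.norm_I, (φ x).inner_map_map]

theorem map_sphereACS (hφ : IsSU2FrameField cov φ) (hJ : IsCharacteristicConnection J cov)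
    (hT : HasParallelTorsion cov) (q : S2) (x : M) (v : TangentSpace (𝓡 6) x) :
    φ x (sphereACS hφ hJ hT q x v) = leftMul q.toQuat Complex.I (φ x v) :=
  map_frameEndo _ _ _ _

theorem isSphereFamily_sphereACS (hφ : IsSU2FrameField cov φ)
    (hJ : IsCharacteristicConnection J cov) (hT : HasParallelTorsion cov) :
    IsSphereFamily (sphereACS hφ hJ hT) where
  smooth := by
    have hcoord : ∀ i, ContMDiff (𝓡 2) 𝓘(ℝ, ℝ) ∞ fun q : S2 => ![q.1 0, q.1 1, q.1 2, 1] i := by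
      simpa [Fin.forall_fin_succ] using
        ⟨S2.contMDiff_apply 0, S2.contMDiff_apply 1, S2.contMDiff_apply 2, contMDiff_const⟩
    exact (contMDiff_sum_smul_endo hcoord fun i =>
      (hφ.isInvariantEndo_frameEndo (J := J) _ _).contMDiff hJ hT).congr fun p =>
        congrArg (TotalSpace.mk p.2) (frameEndo_toQuat p.1 p.2)
  injective x q q' h := S2.toQuat_injective <| by
    have hone := congrArg (fun L : TangentSpace (𝓡 6) x →L[ℝ] TangentSpace (𝓡 6) x =>
      φ x (L ((φ x).symm (inQuat 1)))) h
    simp only [map_sphereACS, LinearIsometryEquiv.apply_symm_apply, leftMul_inQuat,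
      mul_one] at hone
    exact congrArg WithLp.fst hone

theorem exists_sphereACS_eq (hφ : IsSU2FrameField cov φ) (hJ : IsCharacteristicConnection J cov)
    (hT : HasParallelTorsion cov) {J' : OrthogonalACS M} {u : ℍ[ℝ]} (hu : u * u = -1)
    (hJ' : ∀ x v, φ x (J' x v) = leftMul u Complex.I (φ x v)) :
    ∃ q, sphereACS hφ hJ hT q = J' := by
  obtain ⟨a, b, c, h, rfl⟩ := exists_imQuat_eq_of_mul_self hu
  refine ⟨S2.mk h, OrthogonalACS.ext (funext fun x => ContinuousLinearMap.ext fun v => ?_)⟩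
  exact (φ x).injective ((map_sphereACS hφ hJ hT _ x v).trans (hJ' x v).symm)

end SphereFamily

section TorsionOrbits

open scoped Quaternion

/-- Replacing `(i, r)` by `(-i, -r)` does not change the form, so that the angle between `q` and
`i` may be assumed to be at most `π / 2`. -/
theorem S2.exists_leftMul_wedgeForm (q : S2) (r : ℝ) : ∃ (p : ℍ[ℝ]) (z : ℂ), ‖p‖ = 1 ∧ ‖z‖ = 1 ∧
    SemiconjBy p q.toQuat (imQuat 1 0 0) ∧ ∀ X Y Z, wedgeForm (imQuat 1 0 0) r X Y Z =
      wedgeForm (imQuat (r * |q.1 0|) 0 (r * √(1 - q.1 0 ^ 2))) 1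
        (leftMul p z X) (leftMul p z Y) (leftMul p z Z) := by
  obtain ⟨σ, hσ, hσq⟩ : ∃ σ : ℝ, σ * σ = 1 ∧ |q.1 0| = σ * q.1 0 := by
    rcases abs_choice (q.1 0) with h | h
    · exact ⟨1, by norm_num, by rw [h, one_mul]⟩
    · exact ⟨-1, by norm_num, by rw [h, neg_one_mul]⟩
  obtain ⟨p, hp, hpq, hpI⟩ := exists_semiconjBy_pair (c := |q.1 0|) (v := σ • imQuat 1 0 0)
    q.toQuat_mul_self (by rw [smul_mul_smul_comm, hσ, one_smul, imQuat_I_mul_I])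
    (by rw [sq_abs]; nlinarith [q.sum_sq])
    (by ext <;> simp [S2.toQuat, hσq]; ring)
  have hz : ‖(σ : ℂ)‖ = 1 := by
    rw [Complex.norm_real, Real.norm_eq_abs, ← sq_eq_sq₀ (abs_nonneg _) zero_le_one, sq_abs, sq, hσ,
      one_pow]
  have hσσ : (σ : ℂ) * (σ * r) = r := by rw [← mul_assoc, ← Complex.ofReal_mul, hσ]; simp
  have hsmul : imQuat (r * |q.1 0|) 0 (r * √(1 - q.1 0 ^ 2)) =
      r • imQuat |q.1 0| 0 √(1 - |q.1 0| ^ 2) := by ext <;> simp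
  refine ⟨p, σ, hp, hz, hpq, fun X Y Z => ?_⟩
  calc wedgeForm (imQuat 1 0 0) r X Y Z
      = wedgeForm (σ • imQuat 1 0 0) (σ * r) X Y Z := by rw [wedgeForm_smul_left, hσσ]
    _ = wedgeForm (imQuat |q.1 0| 0 √(1 - |q.1 0| ^ 2)) (σ * (σ * r))
          (leftMul p σ X) (leftMul p σ Y) (leftMul p σ Z) := (wedgeForm_leftMul hp hz hpI ..).symm
    _ = _ := by rw [hσσ, hsmul, wedgeForm_smul_left, mul_one]

variable {M : Type*} [TopologicalSpace M] [ChartedSpace E6 M] [IsManifold (𝓡 6) ∞ M]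
  [RiemannianBundle (fun x : M => TangentSpace (𝓡 6) x)]
  [IsContMDiffRiemannianBundle (𝓡 6) ∞ E6 (fun x : M => TangentSpace (𝓡 6) x)] [T2Space M]
  {φ : (x : M) → TangentSpace (𝓡 6) x ≃ₗᵢ[ℝ] QuatModel}
  {J : OrthogonalACS M} {cov : AffineConnection M}
  (hφ : IsSU2FrameField cov φ) (hJ : IsCharacteristicConnection J cov) (hT : HasParallelTorsion cov)
  {r : ℝ} (hform : ∀ x X Y Z, torsionForm cov x X Y Z =
    wedgeForm (imQuat 1 0 0) r (φ x X) (φ x Y) (φ x Z))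

include hform in
theorem exists_isSU2FrameField_sphereACS (q : S2) :
    ∃ ψ : (x : M) → TangentSpace (𝓡 6) x ≃ₗᵢ[ℝ] QuatModel, IsSU2FrameField cov ψ ∧
      (∀ x v, ψ x (sphereACS hφ hJ hT q x v) = leftMul (imQuat 1 0 0) Complex.I (ψ x v)) ∧
      ∀ x X Y Z, torsionForm cov x X Y Z =
        wedgeForm (imQuat (r * |q.1 0|) 0 (r * √(1 - q.1 0 ^ 2))) 1
          (ψ x X) (ψ x Y) (ψ x Z) := by
  obtain ⟨p, z, hp, hz, hpq, hwedge⟩ := q.exists_leftMul_wedgeForm r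
  refine ⟨fun x => (φ x).trans (leftRotation hp hz), hφ.trans_leftRotation hp hz, fun x v => ?_,
    fun x X Y Z => (hform x X Y Z).trans (hwedge _ _ _)⟩
  simp only [LinearIsometryEquiv.trans_apply, leftRotation_apply, map_sphereACS, leftMul_leftMul]
  rw [hpq.eq, mul_comm Complex.I]

include hform in
theorem hasTorsionOrbit_sphereACS (q : S2) : HasTorsionOrbit (sphereACS hφ hJ hT q) cov
    (r * √(1 - q.1 0 ^ 2)) (r * |q.1 0|) := fun x => by
  obtain ⟨ψ, -, hψJ, hψT⟩ := exists_isSU2FrameField_sphereACS hφ hJ hT hform q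
  refine ⟨frameBasis (ψ x), isAdapted_frameBasis_iff.2 (hψJ x), fun X Y Z => ?_⟩
  rw [hψT, frameBasis_repr, frameBasis_repr, frameBasis_repr, normalForm_quatCoord]

include hform in
theorem exists_hasTorsionOrbit_sphereACS (hr : 0 < r) {α₁ α₅ : ℝ} (h₁ : 0 ≤ α₁) (h₅ : 0 ≤ α₅)
    (h : α₁ ^ 2 + α₅ ^ 2 = r ^ 2) :
    ∃ q, HasTorsionOrbit (sphereACS hφ hJ hT q) cov α₁ α₅ := by
  have hq : (α₅ / r) ^ 2 + (α₁ / r) ^ 2 + 0 ^ 2 = 1 := by field_simp; linarith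
  refine ⟨S2.mk hq, ?_⟩
  have horbit := hasTorsionOrbit_sphereACS hφ hJ hT hform (S2.mk hq)
  have hq₀ : (S2.mk hq).1 0 = α₅ / r := rfl
  have hsqrt : 1 - (α₅ / r) ^ 2 = (α₁ / r) ^ 2 := by linarith
  rwa [hq₀, hsqrt, Real.sqrt_sq (by positivity), abs_of_nonneg (by positivity),
    mul_div_cancel₀ _ hr.ne', mul_div_cancel₀ _ hr.ne'] at horbit

include hform in
theorem isRelatedToSU2_sphereACS (q : S2) : IsRelatedToSU2 (sphereACS hφ hJ hT q) cov where
  characteristic :=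
    { smooth := hJ.smooth
      metric := hJ.metric
      complex := fun _ _ hY v =>
        (hφ.isInvariantEndo_frameEndo (J := J) _ _).cov_apply hJ hT hY v
      skew := hJ.skew }
  parallel := hT
  su2 x := by
    obtain ⟨ψ, hψ, hψJ, hψT⟩ := exists_isSU2FrameField_sphereACS hφ hJ hT hform q
    exact ⟨frameBasis (ψ x), isAdapted_frameBasis_iff.2 (hψJ x), hψ.holonomyGroup_subset x,
      SU2At_subset_isotropyGroup (hψJ x) (hψT x) fun _ hq' => wedgeForm_rightMul hq' _ _⟩

end TorsionOrbits

section IntrinsicTorsion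

open scoped Quaternion

variable {M : Type*} [TopologicalSpace M] [ChartedSpace E6 M] [IsManifold (𝓡 6) ∞ M]

/-- The Levi-Civita connection `∇_v Y - ½ T(v, Y) = ∇_v Y + ½ T(Y, v)` of a metric connection with
skew-symmetric torsion. -/
def leviCivita (cov : AffineConnection M) : AffineConnection M :=
  cov.addOneForm fun x => (1 / 2 : ℝ) • cov.torsion x

theorem leviCivita_apply (cov : AffineConnection M) (Y : (x : M) → TangentSpace (𝓡 6) x) (x : M)
    (v : TangentSpace (𝓡 6) x) :
    leviCivita cov Y x v = cov Y x v + (1 / 2 : ℝ) • cov.torsion x (Y x) v := rfl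

theorem leviCivita_torsion (cov : AffineConnection M) (x : M) : (leviCivita cov).torsion x = 0 := by
  refine ContinuousLinearMap.ext fun u => ContinuousLinearMap.ext fun v => ?_
  have hdiff : ∀ w : TangentSpace (𝓡 6) x, IsDiffAt (FiberBundle.extend E6 w) x := fun w =>
    FiberBundle.mdifferentiableAt_extend (𝓡 6) E6 (V := fun x : M => TangentSpace (𝓡 6) x) w
  have htorsion := cov.torsion_apply (hdiff u) (hdiff v)
  have hlc := (leviCivita cov).torsion_apply (hdiff u) (hdiff v)
  simp only [leviCivita_apply, FiberBundle.extend_apply_self] at htorsion hlc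
  rw [cov.torsion_antisymm v u] at hlc
  rw [hlc, zero_apply, zero_apply]
  rw [← sub_eq_zero] at htorsion
  refine Eq.trans ?_ (neg_eq_zero.2 htorsion)
  module

variable [RiemannianBundle (fun x : M => TangentSpace (𝓡 6) x)]
  {J : OrthogonalACS M} {cov : AffineConnection M}
  {φ : (x : M) → TangentSpace (𝓡 6) x ≃ₗᵢ[ℝ] QuatModel} {r : ℝ}

theorem torsionForm_eq_kahlerWedge (x : M)
    (hφJ : ∀ v, φ x (J x v) = leftMul (imQuat 1 0 0) Complex.I (φ x v))
    (hform : ∀ X Y Z, torsionForm cov x X Y Z =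
      wedgeForm (imQuat 1 0 0) r (φ x X) (φ x Y) (φ x Z)) :
    torsionForm cov x = kahlerWedge J x ((φ x).symm (inComplex r)) := by
  funext X Y Z
  simp only [hform, wedgeForm_eq_inner_leftMul_I, kahlerWedge, kahlerForm, ← hφJ,
    ← (φ x).inner_map_map ((φ x).symm _), ← (φ x).inner_map_map (J x _),
    (φ x).apply_symm_apply]

theorem thetaMap_torsionForm_ne_zero (hr : r ≠ 0) (x : M)
    (hφJ : ∀ v, φ x (J x v) = leftMul (imQuat 1 0 0) Complex.I (φ x v))
    (hform : ∀ X Y Z, torsionForm cov x X Y Z =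
      wedgeForm (imQuat 1 0 0) r (φ x X) (φ x Y) (φ x Z)) :
    thetaMap J x (torsionForm cov x) ≠ 0 := fun h => by
  have hval := congrFun (congrFun (congrFun h ((φ x).symm (inQuat 1)))
    ((φ x).symm (inQuat (imQuat 1 0 0)))) ((φ x).symm (inComplex 1))
  simp only [thetaMap, hform, hφJ, LinearIsometryEquiv.apply_symm_apply, leftMul_inQuat,
    leftMul_inComplex] at hval
  have hne : imQuat 1 0 0 ≠ 0 := fun h => one_ne_zero (congrArg (·.imI) h)
  simp [wedgeForm, inQuat, inComplex, Complex.inner, Quaternion.inner_def, hr, hne] at hval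

variable [IsContMDiffRiemannianBundle (𝓡 6) ∞ E6 (fun x : M => TangentSpace (𝓡 6) x)]

theorem IsCharacteristicConnection.inner_torsion_left (hJ : IsCharacteristicConnection J cov)
    (x : M) (X Y Z : TangentSpace (𝓡 6) x) :
    (inner ℝ (cov.torsion x X Y) Z : ℝ) = -inner ℝ X (cov.torsion x Z Y) := by
  rw [real_inner_comm _ X]
  calc torsionForm cov x X Y Z = -torsionForm cov x X Z Y := hJ.skew x X Y Z
    _ = torsionForm cov x Z X Y := by rw [torsionForm_antisymm, neg_neg]
    _ = -torsionForm cov x Z Y X := hJ.skew x Z X Y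

theorem isLeviCivita_leviCivita (hJ : IsCharacteristicConnection J cov) :
    IsLeviCivita (leviCivita cov) := by
  refine ⟨?_, leviCivita_torsion cov⟩
  rw [CovariantDerivative.isMetricCompatible_iff]
  intro x X σ τ _ hσ hτ
  rw [hJ.metric.mvfderiv_inner_eq X hσ hτ]
  simp only [leviCivita_apply]
  rw [inner_add_left, inner_add_right, real_inner_smul_left, real_inner_smul_right,
    hJ.inner_torsion_left]
  ring

theorem derivJ_leviCivita (hJ : IsCharacteristicConnection J cov) (x : M)
    (X Y : TangentSpace (𝓡 6) x) : derivJ J (leviCivita cov) x X Y =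
      (1 / 2 : ℝ) • (cov.torsion x (J x Y) X - J x (cov.torsion x Y X)) := by
  have hY : IsDiffAt (FiberBundle.extend E6 Y) x :=
    FiberBundle.mdifferentiableAt_extend (𝓡 6) E6 (V := fun x : M => TangentSpace (𝓡 6) x) Y
  rw [derivJ, leviCivita_apply, leviCivita_apply, hJ.complex x _ hY, FiberBundle.extend_apply_self,
    map_add, map_smul]
  module

theorem intrinsicTorsion_leviCivita (hJ : IsCharacteristicConnection J cov) (x : M) :
    intrinsicTorsion J (leviCivita cov) x = thetaMap J x (torsionForm cov x) := by
  funext X Y Z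
  have h₁ := torsionForm_antisymm (cov := cov) x (J x Y) X (J x Z)
  have h₂ := torsionForm_antisymm (cov := cov) x Y X Z
  rw [torsionForm] at h₁ h₂
  rw [intrinsicTorsion, derivJ_leviCivita hJ, real_inner_smul_left, inner_sub_left, J.orthogonal,
    thetaMap, h₁, h₂]
  ring

theorem isStrictTypeW4_of_torsionForm (hJ : IsCharacteristicConnection J cov) (hr : r ≠ 0)
    (hφJ : ∀ x v, φ x (J x v) = leftMul (imQuat 1 0 0) Complex.I (φ x v))
    (hform : ∀ x X Y Z, torsionForm cov x X Y Z =
      wedgeForm (imQuat 1 0 0) r (φ x X) (φ x Y) (φ x Z)) : IsStrictTypeW4 J := by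
  refine ⟨leviCivita cov, isLeviCivita_leviCivita hJ, fun x => ?_⟩
  rw [intrinsicTorsion_leviCivita hJ]
  refine ⟨⟨(φ x).symm (inComplex r), ?_⟩, thetaMap_torsionForm_ne_zero hr x (hφJ x) (hform x)⟩
  rw [← torsionForm_eq_kahlerWedge x (hφJ x) (hform x)]

end IntrinsicTorsion

end

theorem mainTheorem6 {M : Type*} [TopologicalSpace M] [T2Space M] [SecondCountableTopology M]
    [ConnectedSpace M] [ChartedSpace E6 M] [IsManifold (𝓡 6) ∞ M]
    [RiemannianBundle (fun x : M => TangentSpace (𝓡 6) x)]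
    [IsContMDiffRiemannianBundle (𝓡 6) ∞ E6 (fun x : M => TangentSpace (𝓡 6) x)]
    (J : OrthogonalACS M) (cov : AffineConnection M)
    (hJ : IsRelatedToSU2 J cov) (hT : ∃ x : M, cov.torsion x ≠ 0) :
    ∃ Jt : S2 → OrthogonalACS M,
      IsSphereFamily Jt ∧ (∃ q, Jt q = J) ∧
      (∀ q, IsRelatedToSU2 (Jt q) cov) ∧
      (∃ r : ℝ, 0 < r ∧
        (∀ q, ∃ α₁ α₅ : ℝ, 0 ≤ α₁ ∧ 0 ≤ α₅ ∧ α₁ ^ 2 + α₅ ^ 2 = r ^ 2 ∧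
          HasTorsionOrbit (Jt q) cov α₁ α₅) ∧
        (∀ α₁ α₅ : ℝ, 0 ≤ α₁ → 0 ≤ α₅ → α₁ ^ 2 + α₅ ^ 2 = r ^ 2 →
          ∃ q, HasTorsionOrbit (Jt q) cov α₁ α₅)) ∧
      (∃ q, IsStrictTypeW4 (Jt q)) := by
  obtain ⟨φ, u, r, hφ, hu, hr, hφJ, hform⟩ := hJ.exists_normalized_isSU2FrameField hT
  have hrelated := isRelatedToSU2_sphereACS hφ hJ.characteristic hJ.parallel hform
  have horbit := hasTorsionOrbit_sphereACS hφ hJ.characteristic hJ.parallel hform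
  refine ⟨sphereACS hφ hJ.characteristic hJ.parallel, isSphereFamily_sphereACS _ _ _,
    exists_sphereACS_eq _ _ _ hu hφJ, hrelated,
    ⟨r, hr, fun q => ⟨_, _, by positivity, by positivity, ?_, horbit q⟩, fun α₁ α₅ h₁ h₅ h =>
      exists_hasTorsionOrbit_sphereACS hφ hJ.characteristic hJ.parallel hform hr h₁ h₅ h⟩,
    S2.mk (a := 1) (b := 0) (c := 0) (by norm_num), ?_⟩
  · have hq : (q.1 0) ^ 2 ≤ 1 := by nlinarith [q.sum_sq]
    rw [mul_pow, mul_pow, Real.sq_sqrt (by linarith), sq_abs]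
    ring
  · exact isStrictTypeW4_of_torsionForm (hrelated _).characteristic hr.ne'
      (fun x v => map_sphereACS hφ _ _ _ x v) hform
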